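/- A finite simple graph is outerplanar if it can be drawn in the plane without crossings (distinct vertices as distinct points, edges as simple arcs that meet vertices and one another only at common ends) so that every vertex lies on the boundary of the unbounded face. For graphs $H$ and $G$ let $\mathcal N(H,G)$ be the number of (not necessarily induced) subgraphs of $G$ isomorphic to $H$, let $P_k$ be the path on $k$ vertices, and let $$f_{\mathcal{OP}}(n,H)=\max\{\mathcal N(H,G) : G \text{ is an } n\text{-vertex outerplanar graph}\}.$$ For every $n\ge 8$, $$f_{\mathcal{OP}}(n,P_4)=2n^2-7n+2 .$$ Moreover, for every $n\ge 9$, an $n$-vertex graph $G$ is outerplanar with $\mathcal N(P_4,G)=f_{\mathcal{OP}}(n,P_4)$ if and only if $G$ is isomorphic to the fan $K_1+P_{n-1}$, the graph obtained from a path on $n-1$ vertices by adding one new vertex adjacent to all vertices of the path. -/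

import Mathlib

/-- A drawing without crossings of the simple graph `G` in the plane `ℂ`.
Vertices are distinct points; every edge `uv` is a simple arc joining the points `u` and `v`;
an arc passes through no vertex other than its two ends; and two distinct arcs meet only in the
points of common ends of the two edges. The values `arc e` for non-edges `e` play no role. -/
structure PlaneDrawing {V : Type*} (G : SimpleGraph V) where
  /-- the point of the plane that represents a vertex -/
  point : V → ℂ
  /-- the set of points of the plane that represents an edge -/
  arc : Sym2 V → Set ℂ
  point_injective : Function.Injective point
  arc_spec : ∀ u v : V, G.Adj u v →
    ∃ γ : Path (point u) (point v), Function.Injective γ ∧ Set.range γ = arc s(u, v)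
  mem_of_point_mem_arc : ∀ e ∈ G.edgeSet, ∀ w : V, point w ∈ arc e → w ∈ e
  arc_inter_arc : ∀ e ∈ G.edgeSet, ∀ f ∈ G.edgeSet, e ≠ f →
    ∀ z ∈ arc e ∩ arc f, ∃ w : V, w ∈ e ∧ w ∈ f ∧ point w = z

namespace PlaneDrawing

variable {V : Type*} {G : SimpleGraph V}

/-- All points of the plane that are covered by the drawing. -/
def support (D : PlaneDrawing G) : Set ℂ :=
  Set.range D.point ∪ ⋃ e ∈ G.edgeSet, D.arc e

/-- The outer face: the unbounded connected component of the complement of the drawing.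
(The drawing of a finite graph is compact, so there is exactly one such component.) -/
def outerFace (D : PlaneDrawing G) : Set ℂ :=
  {z | z ∈ D.supportᶜ ∧ ¬ Bornology.IsBounded (connectedComponentIn D.supportᶜ z)}

end PlaneDrawing

/-- A (finite) graph is outerplanar if it has a drawing without crossings in the plane such that
every vertex lies on the boundary of the outer face. -/
def IsOuterplanar {V : Type*} (G : SimpleGraph V) : Prop :=
  ∃ D : PlaneDrawing G, ∀ v : V, D.point v ∈ frontier D.outerFace

/-- The set of all numbers `N(H, G)`, where `G` runs over the `n`-vertex outerplanar graphs and
`N(H, G)` is the number of subgraphs of `G` that are isomorphic to `H`. The generalized outerplanar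
Turán number of `H` is the greatest element of this set. -/
def outerplanarCopyCounts {W : Type*} (n : ℕ) (H : SimpleGraph W) : Set ℕ :=
  {k | ∃ G : SimpleGraph (Fin n), IsOuterplanar G ∧ G.copyCount H = k}

/-- The generalized outerplanar Turán number of `H`: the maximum number of copies of `H` in an
`n`-vertex outerplanar graph. -/
noncomputable def outerplanarTuranNumber {W : Type*} (n : ℕ) (H : SimpleGraph W) : ℕ :=
  sSup (outerplanarCopyCounts n H)

/-- The join of two graphs: their disjoint union together with all edges between the two. -/
def graphJoin {V W : Type*} (G : SimpleGraph V) (H : SimpleGraph W) : SimpleGraph (V ⊕ W) :=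
  (G ⊕g H) ⊔ completeBipartiteGraph V W

/-- The fan `K₁ + P_m` on `m + 1` vertices. -/
def fanGraph (m : ℕ) : SimpleGraph (Fin 1 ⊕ Fin m) :=
  graphJoin (⊤ : SimpleGraph (Fin 1)) (SimpleGraph.pathGraph m)

/-! Upper bound, topology. When all vertices lie on the outer boundary, a far away point can be
joined to each vertex `v` while avoiding every vertex other than `v` and every edge not at `v`
(`exists_apex`). With this apex a `K₂,₃`, possibly with a subdivided edge, becomes a `K₃,₃`, and a
cycle with crossing chords becomes a subdivided `K₅`. These two are excluded by a parity argument: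
continuous logarithms of differences attach an integer to each pair (edge, vertex), and every pair
of disjoint edges gives a linear equation whose right side records whether the ends interleave
(`exists_crossing_integers`). Summed over all such pairs, each integer occurs twice while the right
sides have odd sum. All later arguments use only the three obstructions in `NoOuterObstruction`.

Upper bound, counting. The claimed maximum grows by `4n - 9` from `n - 1` to `n`, so it suffices to
delete a vertex lying on at most `4n - 9` paths. Since chords do not cross, there is a vertex `v` of
degree at most two, and hence there are at most `2n - 3` edges. Such a `v` lies on at most `4n - 10`
paths unless its neighbours `x`, `y` are adjacent. In that case the number is `2e - 6 + d(z) - ∑_R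
d`, where `e` is the number of edges, `z` the further common neighbour of `x` and `y` (with `d(z)`
read as `0` if there is none), and `R` the set of vertices adjacent to neither (`pathsThrough_ear`).
As `d(z) ≤ 4 + |R|`, at least `4n - 9` paths occur only for `d(z) = 3, 4, 5` (`heavy_ear`). If `d(z)
= 3`, some vertex is adjacent to all others. If `d(z) = 4` and `n ≥ 7`, a vertex elsewhere lies on
at most `4n - 10` paths. If `d(z) = 5`, the single vertex of `R` does so, unless `n = 8`.

The induction starts at seven vertices. For `n ≥ 9`, equality leaves no vertex on at most `4n - 10`
paths, so there is a universal vertex and the number of edges is `2n - 3`. The other vertices then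
induce a tree of maximum degree at most two, that is, a path. Conversely, the fan is counted by
deleting its last vertex repeatedly and is drawn with straight segments. -/

/-! ### Logarithm increments and the crossing parity -/

open Complex in
/-- Two continuous logarithms of the same function have the same increment. -/
lemma log_increment_unique {L L' : ℝ → ℂ} (hL : Continuous L) (hL' : Continuous L')
    (h : ∀ t, exp (L t) = exp (L' t)) : L 1 - L 0 = L' 1 - L' 0 := by
  have key := isCoveringMap_exp.eq_of_comp_eq (A := ℝ) hL
    (hL'.add (continuous_const (y := L 0 - L' 0)))
    (by
      funext t
      have h0 : exp (L 0 - L' 0) = 1 := by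
        rw [exp_sub, h 0, div_self (exp_ne_zero _)]
      simp [exp_add, h t, h0]) 0 (by simp)
  have := congrFun key 1
  simp only [Pi.add_apply] at this
  rw [this]; ring

/-- The increment of a continuous logarithm of `γ - w` along the path `γ`. -/
noncomputable def logIncrement {a b : ℂ} (γ : Path a b) (w : ℂ) : ℂ :=
  open Classical in
  if h : ∃ L : ℝ → ℂ, Continuous L ∧ ∀ t, Complex.exp (L t) = γ.extend t - w then
    h.choose 1 - h.choose 0 else 0

lemma logIncrement_eq {a b : ℂ} (γ : Path a b) (w : ℂ) {L : ℝ → ℂ} (hL : Continuous L)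
    (h : ∀ t, Complex.exp (L t) = γ.extend t - w) : logIncrement γ w = L 1 - L 0 := by
  have hex : ∃ L : ℝ → ℂ, Continuous L ∧ ∀ t, Complex.exp (L t) = γ.extend t - w := ⟨L, hL, h⟩
  rw [logIncrement, dif_pos hex]
  exact log_increment_unique hex.choose_spec.1 hL fun t ↦ by rw [hex.choose_spec.2, h]

/-- Shifting a logarithm by the constant `πi` changes the sign of the function but not the
increment. Thus one logarithm of `γ(s) - δ(t)` serves both paths. -/
lemma logIncrement_eq_of_neg {a b : ℂ} (γ : Path a b) (w : ℂ) {L : ℝ → ℂ} (hL : Continuous L)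
    (h : ∀ t, Complex.exp (L t) = w - γ.extend t) : logIncrement γ w = L 1 - L 0 := by
  rw [logIncrement_eq γ w (L := fun t ↦ L t + Real.pi * Complex.I) (by fun_prop)
    (fun t ↦ by rw [Complex.exp_add, h, Complex.exp_pi_mul_I]; ring)]
  ring

/-- For two disjoint paths there is a continuous logarithm of their difference. -/
lemma exists_log_difference {a b c d : ℂ} (γ : Path a b) (δ : Path c d)
    (h : Disjoint (Set.range γ) (Set.range δ)) :
    ∃ L : ℝ × ℝ → ℂ, Continuous L ∧
      ∀ s t, Complex.exp (L (s, t)) = γ.extend s - δ.extend t := by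
  have hne : ∀ x : ℝ × ℝ, γ.extend x.1 - δ.extend x.2 ≠ 0 := by
    intro x hx
    have h1 : γ.extend x.1 ∈ Set.range γ := by
      rw [← γ.extend_range]; exact Set.mem_range_self _
    have h2 : δ.extend x.2 ∈ Set.range δ := by
      rw [← δ.extend_range]; exact Set.mem_range_self _
    rw [sub_eq_zero.1 hx] at h1
    exact Set.disjoint_left.1 h h1 h2
  let F : C(ℝ × ℝ, ℂ) := ⟨fun x ↦ γ.extend x.1 - δ.extend x.2, by fun_prop⟩
  obtain ⟨L, ⟨-, hL⟩, -⟩ := Complex.isCoveringMapOn_exp.existsUnique_continuousMap_lifts F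
    (a₀ := (0, 0)) (e₀ := Complex.log (F (0, 0))) (Complex.exp_log (hne (0, 0))) hne
  exact ⟨L, L.continuous, fun s t ↦ congrFun hL (s, t)⟩

/-- The four terms are the increments of a single function on the unit square along its four sides,
and these cancel around the boundary. -/
lemma logIncrement_square {a b c d : ℂ} (γ : Path a b) (δ : Path c d)
    (h : Disjoint (Set.range γ) (Set.range δ)) :
    logIncrement γ c - logIncrement γ d + logIncrement δ b - logIncrement δ a = 0 := by
  obtain ⟨L, hc, hL⟩ := exists_log_difference γ δ h
  rw [logIncrement_eq γ c (L := fun s ↦ L (s, 0)) (by fun_prop) (fun s ↦ by simp [hL]),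
    logIncrement_eq γ d (L := fun s ↦ L (s, 1)) (by fun_prop) (fun s ↦ by simp [hL]),
    logIncrement_eq_of_neg δ b (L := fun t ↦ L (1, t)) (by fun_prop) (fun t ↦ by simp [hL]),
    logIncrement_eq_of_neg δ a (L := fun t ↦ L (0, t)) (by fun_prop) (fun t ↦ by simp [hL])]
  ring

/-- This fixes the increments modulo `2πi` by the end points alone; the integer left over is what
the parity argument uses. -/
lemma exp_logIncrement {a b c d : ℂ} (γ : Path a b) (δ : Path c d)
    (h : Disjoint (Set.range γ) (Set.range δ)) :
    Complex.exp (logIncrement γ c) = (b - c) / (a - c) ∧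
    Complex.exp (logIncrement γ d) = (b - d) / (a - d) := by
  obtain ⟨L, hc, hL⟩ := exists_log_difference γ δ h
  rw [logIncrement_eq γ c (L := fun s ↦ L (s, 0)) (by fun_prop) (fun s ↦ by simp [hL]),
    logIncrement_eq γ d (L := fun s ↦ L (s, 1)) (by fun_prop) (fun s ↦ by simp [hL])]
  simp only [Complex.exp_sub, hL]
  simp

/-- The combinatorial crossing parity identity: for every system of paths between points there are
integers `n a b c` that detect, for every pair of disjoint paths, whether the pairs of end indices
interleave. -/
lemma exists_crossing_integers {ι : Type*} [LinearOrder ι] (f : ι → ℂ)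
    (γ : ∀ a b, Path (f a) (f b)) :
    ∃ n : ι → ι → ι → ℤ, ∀ a b c d, a < b → c < d → a < c → b ≠ c → b ≠ d →
      Disjoint (Set.range (γ a b)) (Set.range (γ c d)) →
      n a b c - n a b d + n c d b - n c d a = if c < b ∧ b < d then 1 else 0 := by
  classical
  -- The logarithm of `f y - f x` is normalised so that exchanging the arguments costs exactly `πi`,
  -- with a sign given by the order. This is how interleaving enters.
  let l : ι → ι → ℂ := fun x y ↦
    if x < y then Complex.log (f y - f x) else Complex.log (f x - f y) + Real.pi * Complex.I
  have hl : ∀ x y, f x ≠ f y → Complex.exp (l x y) = f y - f x := by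
    intro x y hxy
    by_cases h : x < y
    · simp only [l, if_pos h]
      exact Complex.exp_log (sub_ne_zero.2 hxy.symm)
    · simp only [l, if_neg h]
      rw [Complex.exp_add, Complex.exp_log (sub_ne_zero.2 hxy), Complex.exp_pi_mul_I]; ring
  have hs : ∀ x y, x < y → l y x = l x y + Real.pi * Complex.I := by
    intro x y h
    simp [l, h, h.not_gt]
  let n : ι → ι → ι → ℤ := fun a b c ↦
    if h : ∃ k : ℤ, logIncrement (γ a b) (f c) = l c b - l c a + k * (2 * Real.pi * Complex.I)
    then h.choose else 0
  have hn : ∀ a b c, f c ≠ f b → f c ≠ f a →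
      Complex.exp (logIncrement (γ a b) (f c)) = (f b - f c) / (f a - f c) →
      logIncrement (γ a b) (f c) = l c b - l c a + n a b c * (2 * Real.pi * Complex.I) := by
    intro a b c hb ha h
    have hex : ∃ k : ℤ,
        logIncrement (γ a b) (f c) = l c b - l c a + k * (2 * Real.pi * Complex.I) := by
      apply Complex.exp_eq_exp_iff_exists_int.1
      rw [h, Complex.exp_sub, hl _ _ hb, hl _ _ ha]
    simp only [n, dif_pos hex]
    exact hex.choose_spec
  refine ⟨n, fun a b c d hab hcd hac hbc hbd hdis ↦ ?_⟩
  have hne : ∀ {x y}, x ∈ Set.range (γ a b) → y ∈ Set.range (γ c d) → x ≠ y :=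
    fun hx hy hxy ↦ Set.disjoint_left.1 hdis hx (hxy ▸ hy)
  have ma : f a ∈ Set.range (γ a b) := ⟨0, by simp⟩
  have mb : f b ∈ Set.range (γ a b) := ⟨1, by simp⟩
  have mc : f c ∈ Set.range (γ c d) := ⟨0, by simp⟩
  have md : f d ∈ Set.range (γ c d) := ⟨1, by simp⟩
  have key := logIncrement_square _ _ hdis
  obtain ⟨e1, e2⟩ := exp_logIncrement _ _ hdis
  obtain ⟨e3, e4⟩ := exp_logIncrement _ _ hdis.symm
  rw [hn a b c (hne mb mc).symm (hne ma mc).symm e1, hn a b d (hne mb md).symm (hne ma md).symm e2,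
    hn c d b (hne mb md) (hne mb mc) e4, hn c d a (hne ma md) (hne ma mc) e3] at key
  have hpi : (Real.pi : ℂ) * Complex.I ≠ 0 := by
    simp [Real.pi_ne_zero]
  have fin : ∀ m : ℤ, (Real.pi : ℂ) * Complex.I *
      (2 * ((n a b c - n a b d + n c d b - n c d a : ℤ) : ℂ) - 2 * (m : ℂ)) = 0 →
      n a b c - n a b d + n c d b - n c d a = m := by
    intro m hm
    have := (mul_eq_zero.1 hm).resolve_left hpi
    have h2 : ((n a b c - n a b d + n c d b - n c d a : ℤ) : ℂ) = m := by linear_combination this / 2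
    exact_mod_cast h2
  -- The half turns for the pairs `a, c` and `a, d` cancel since `a` precedes both. Those for `b, c`
  -- and `b, d` add up to a full turn exactly when `b` lies between `c` and `d`.
  rw [hs a c hac, hs a d (hac.trans hcd)] at key
  split_ifs with hif
  · apply fin
    rw [hs c b hif.1, hs b d hif.2] at key
    push_cast
    linear_combination key
  · apply fin
    rcases lt_or_gt_of_ne hbc with h | h
    · rw [hs b c h, hs b d (h.trans hcd)] at key
      push_cast
      linear_combination key
    · have h' : d < b := lt_of_le_of_ne (not_lt.1 fun h' ↦ hif ⟨h, h'⟩) hbd.symm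
      rw [hs c b h, hs d b h'] at key
      push_cast
      linear_combination key

lemma joinedIn_univ_path (x y : ℂ) : Nonempty (Path x y) :=
  ⟨(PathConnectedSpace.joined x y).somePath⟩

/-- The complete graph on five vertices has no drawing in which disjoint edges are disjoint. -/
lemma no_planar_K5 (f : Fin 5 → ℂ) (R : Fin 5 → Fin 5 → Set ℂ)
    (hJ : ∀ a b, a < b → JoinedIn (R a b) (f a) (f b))
    (hD : ∀ a b c d, a < b → c < d → a < c → b ≠ c → b ≠ d → Disjoint (R a b) (R c d)) :
    False := by
  classical
  let γ : ∀ a b, Path (f a) (f b) := fun a b ↦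
    if h : a < b then (hJ a b h).somePath else (joinedIn_univ_path _ _).some
  have hγ : ∀ a b, a < b → Set.range (γ a b) ⊆ R a b := by
    intro a b h
    simp only [γ, dif_pos h]
    rintro _ ⟨t, rfl⟩
    exact (hJ a b h).somePath_mem t
  obtain ⟨n, hn⟩ := exists_crossing_integers f γ
  have hn' : ∀ a b c d, a < b → c < d → a < c → b ≠ c → b ≠ d →
      n a b c - n a b d + n c d b - n c d a = if c < b ∧ b < d then 1 else 0 :=
    fun a b c d h1 h2 h3 h4 h5 ↦
      hn a b c d h1 h2 h3 h4 h5 ((hD a b c d h1 h2 h3 h4 h5).mono (hγ a b h1) (hγ c d h2))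
  have q : ∀ a b c d : Fin 5, a < b → b < c → c < d →
      n a b c - n a b d + n c d b - n c d a = 0 ∧
      n a c b - n a c d + n b d c - n b d a = 1 ∧
      n a d b - n a d c + n b c d - n b c a = 0 := by
    intro a b c d h1 h2 h3
    refine ⟨?_, ?_, ?_⟩
    · rw [hn' a b c d h1 h3 (h1.trans h2) h2.ne (h2.trans h3).ne, if_neg]
      exact fun h ↦ absurd h.1 h2.not_gt
    · rw [hn' a c b d (h1.trans h2) (h2.trans h3) h1 h2.ne' h3.ne, if_pos ⟨h2, h3⟩]
    · rw [hn' a d b c (h1.trans (h2.trans h3)) h2 h1 (h2.trans h3).ne' h3.ne', if_neg]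
      exact fun h ↦ absurd h.2 h3.not_gt
  obtain ⟨a1, a2, a3⟩ := q 0 1 2 3 (by decide) (by decide) (by decide)
  obtain ⟨b1, b2, b3⟩ := q 0 1 2 4 (by decide) (by decide) (by decide)
  obtain ⟨c1, c2, c3⟩ := q 0 1 3 4 (by decide) (by decide) (by decide)
  obtain ⟨d1, d2, d3⟩ := q 0 2 3 4 (by decide) (by decide) (by decide)
  obtain ⟨e1, e2, e3⟩ := q 1 2 3 4 (by decide) (by decide) (by decide)
  -- Modulo two, each `n a b c` occurs in two of the fifteen equations, once for each remaining
  -- choice of `d`. The right sides sum to five, one for each set of four vertices.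
  omega

/-- The complete bipartite graph with parts of size three has no drawing in which disjoint edges
are disjoint. -/
lemma no_planar_K33 (f g : Fin 3 → ℂ) (R : Fin 3 → Fin 3 → Set ℂ)
    (hJ : ∀ i j, JoinedIn (R i j) (f i) (g j))
    (hD : ∀ i j k l, i < k → j ≠ l → Disjoint (R i j) (R k l)) : False := by
  classical
  -- In the lexicographic order the first part precedes the second, so edges `i j` and `k l` with `i
  -- < k` interleave exactly when `j < l`.
  let F : Fin 3 ⊕ₗ Fin 3 → ℂ := fun x ↦ Sum.elim f g (ofLex x)
  let γ : ∀ a b, Path (F a) (F b) := fun a b ↦ match a, b with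
    | .inl i, .inr j => (hJ i j).somePath
    | .inl _, .inl _ => (joinedIn_univ_path _ _).some
    | .inr _, .inl _ => (joinedIn_univ_path _ _).some
    | .inr _, .inr _ => (joinedIn_univ_path _ _).some
  have hγ : ∀ i j, Set.range (γ (toLex (.inl i)) (toLex (.inr j))) ⊆ R i j := by
    rintro i j _ ⟨t, rfl⟩
    exact (hJ i j).somePath_mem t
  obtain ⟨n, hn⟩ := exists_crossing_integers F γ
  let p : Fin 3 → Fin 3 → Fin 3 → ℤ := fun i j k ↦
    n (toLex (.inl i)) (toLex (.inr j)) (toLex (.inl k))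
  let q : Fin 3 → Fin 3 → Fin 3 → ℤ := fun i j l ↦
    n (toLex (.inl i)) (toLex (.inr j)) (toLex (.inr l))
  have key : ∀ i j k l, i < k → j ≠ l →
      p i j k - q i j l + q k l j - p k l i = if j < l then 1 else 0 := by
    intro i j k l hik hjl
    have h := hn (toLex (.inl i)) (toLex (.inr j)) (toLex (.inl k)) (toLex (.inr l))
      (Sum.Lex.inl_lt_inr _ _) (Sum.Lex.inl_lt_inr _ _) (Sum.Lex.inl_lt_inl_iff.2 hik)
      (by simp) (by simpa using hjl) ((hD i j k l hik hjl).mono (hγ i j) (hγ k l))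
    simpa [p, q, Sum.Lex.inl_lt_inr, Sum.Lex.inr_lt_inr_iff] using h
  have key' : ∀ i k j l, i < k → j < l →
      p i j k - q i j l + q k l j - p k l i = 1 ∧ p i l k - q i l j + q k j l - p k j i = 0 :=
    fun i k j l hik hjl ↦ ⟨by rw [key i j k l hik hjl.ne, if_pos hjl],
      by rw [key i l k j hik hjl.ne', if_neg hjl.not_gt]⟩
  obtain ⟨a1, a2⟩ := key' 0 1 0 1 (by decide) (by decide)
  obtain ⟨a3, a4⟩ := key' 0 1 0 2 (by decide) (by decide)
  obtain ⟨a5, a6⟩ := key' 0 1 1 2 (by decide) (by decide)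
  obtain ⟨b1, b2⟩ := key' 0 2 0 1 (by decide) (by decide)
  obtain ⟨b3, b4⟩ := key' 0 2 0 2 (by decide) (by decide)
  obtain ⟨b5, b6⟩ := key' 0 2 1 2 (by decide) (by decide)
  obtain ⟨c1, c2⟩ := key' 1 2 0 1 (by decide) (by decide)
  obtain ⟨c3, c4⟩ := key' 1 2 0 2 (by decide) (by decide)
  obtain ⟨c5, c6⟩ := key' 1 2 1 2 (by decide) (by decide)
  -- Again each integer occurs in two equations, while nine of the eighteen right sides equal one.
  omega

/-! ### Obstructions to outerplanarity -/

/-- The consequences of outerplanarity used for counting: no `K₂,₃`, no `K₂,₃` with one subdivided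
edge, and no cycle with two crossing chords. -/
structure NoOuterObstruction {V : Type*} (G : SimpleGraph V) : Prop where
  k23 : ∀ x y a b c : V, x ≠ y → a ≠ b → a ≠ c → b ≠ c → G.Adj x a → G.Adj x b → G.Adj x c →
    G.Adj y a → G.Adj y b → G.Adj y c → False
  theta : ∀ x y u w a b : V, x ≠ y → u ≠ w → a ≠ u → a ≠ w → a ≠ y → b ≠ u → b ≠ w → b ≠ x →
    G.Adj x u → G.Adj x w → G.Adj y u → G.Adj y w → G.Adj x a → G.Adj y b → G.Adj a b → False
  cross : ∀ (w : ℕ → V) (k a b c d : ℕ), Set.InjOn w (Set.Iic k) →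
    (∀ i < k, G.Adj (w i) (w (i + 1))) → G.Adj (w k) (w 0) → a < b → b < c → c < d → d ≤ k →
    G.Adj (w a) (w c) → G.Adj (w b) (w d) → False

/-- The set of points of modulus larger than `r` is path connected. -/
lemma isPathConnected_norm_gt (r : ℝ) (hr : 0 ≤ r) : IsPathConnected {z : ℂ | r < ‖z‖} := by
  have h : IsPathConnected (Set.Ioi r ×ˢ (Set.univ : Set ℝ)) :=
    ((convex_Ioi r).prod convex_univ).isPathConnected ⟨(r + 1, 0), by simp⟩
  have h2 := h.image (f := fun x : ℝ × ℝ ↦ (x.1 : ℂ) * Complex.exp (x.2 * Complex.I))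
    (by fun_prop)
  convert h2 using 1
  ext z
  simp only [Set.mem_ofPred_eq, Set.mem_image, Set.mem_prod, Set.mem_Ioi, Set.mem_univ, and_true,
    Prod.exists]
  constructor
  · intro hz
    exact ⟨‖z‖, z.arg, hz, Complex.norm_mul_exp_arg_mul_I z⟩
  · rintro ⟨s, t, hs, rfl⟩
    rw [norm_mul, Complex.norm_exp_ofReal_mul_I, mul_one, Complex.norm_real, Real.norm_eq_abs,
      abs_of_pos (hr.trans_lt hs)]
    exact hs

namespace PlaneDrawing

variable {V : Type*} {G : SimpleGraph V} (D : PlaneDrawing G)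

/-- The part of the drawing that is spanned by a set of vertices. -/
def region (U : Set V) : Set ℂ := ⋃ e ∈ {e ∈ G.edgeSet | ∀ v ∈ e, v ∈ U}, D.arc e

/-- The complement of the part of the drawing that avoids the vertex `v`. -/
def star (v : V) : Set ℂ := (D.region {v}ᶜ ∪ D.point '' {v}ᶜ)ᶜ

lemma isCompact_arc {e : Sym2 V} (he : e ∈ G.edgeSet) : IsCompact (D.arc e) := by
  induction e using Sym2.ind with
  | _ u v =>
    obtain ⟨γ, -, h⟩ := D.arc_spec u v he
    rw [← h]
    exact isCompact_range γ.continuous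

lemma isCompact_region [Finite V] (U : Set V) : IsCompact (D.region U) :=
  (Set.toFinite _).isCompact_biUnion fun _ he ↦ D.isCompact_arc he.1

lemma isCompact_support [Finite V] : IsCompact D.support :=
  (Set.finite_range _).isCompact.union
    ((Set.toFinite _).isCompact_biUnion fun _ he ↦ D.isCompact_arc he)

/-- A common point of two different arcs is a common end of the two edges, which would belong to
both vertex sets. -/
lemma disjoint_region {U W : Set V} (h : Disjoint U W) : Disjoint (D.region U) (D.region W) := by
  rw [Set.disjoint_left]
  intro z hz hz'
  simp only [region, Set.mem_iUnion] at hz hz'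
  obtain ⟨e, he, hze⟩ := hz
  obtain ⟨f, hf, hzf⟩ := hz'
  have hef : e ≠ f := by
    rintro rfl
    induction e using Sym2.ind with
    | _ u v =>
      exact Set.disjoint_left.1 h (he.2 u (Sym2.mem_mk_left _ _)) (hf.2 u (Sym2.mem_mk_left _ _))
  obtain ⟨w, hwe, hwf, -⟩ := D.arc_inter_arc e he.1 f hf.1 hef z ⟨hze, hzf⟩
  exact Set.disjoint_left.1 h (he.2 w hwe) (hf.2 w hwf)

lemma disjoint_star {U : Set V} {v : V} (h : v ∉ U) : Disjoint (D.star v) (D.region U) := by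
  rw [Set.disjoint_left]
  intro z hz hz'
  apply hz
  left
  simp only [region, Set.mem_iUnion] at hz' ⊢
  obtain ⟨e, he, hze⟩ := hz'
  exact ⟨e, ⟨he.1, fun w hw hwv ↦ h (hwv ▸ he.2 w hw)⟩, hze⟩

lemma joinedIn_region {U : Set V} {u v : V} (hu : u ∈ U) (hv : v ∈ U) (h : G.Adj u v) :
    JoinedIn (D.region U) (D.point u) (D.point v) := by
  obtain ⟨γ, -, hγ⟩ := D.arc_spec u v h
  refine ⟨γ, fun t ↦ Set.mem_biUnion (x := s(u, v)) ⟨h, ?_⟩ (hγ ▸ Set.mem_range_self t)⟩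
  intro w hw
  rcases Sym2.mem_iff.1 hw with rfl | rfl <;> assumption

lemma joinedIn_region_walk {U : Set V} (w : ℕ → V) (i j : ℕ) (hij : i < j)
    (hU : ∀ t, i ≤ t → t ≤ j → w t ∈ U) (h : ∀ t, i ≤ t → t < j → G.Adj (w t) (w (t + 1))) :
    JoinedIn (D.region U) (D.point (w i)) (D.point (w j)) := by
  induction j, hij using Nat.le_induction with
  | base =>
    exact D.joinedIn_region (hU _ le_rfl (by simp)) (hU _ (by simp) le_rfl) (h i le_rfl (by simp))
  | succ j hj ih =>
    exact (ih (fun t h1 h2 ↦ hU t h1 (by omega)) (fun t h1 h2 ↦ h t h1 (by omega))).trans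
      (D.joinedIn_region (hU _ (by omega) (by omega)) (hU _ (by omega) le_rfl)
        (h j (by omega) (by omega)))

lemma support_compl_subset_star (v : V) : D.supportᶜ ⊆ D.star v := by
  apply Set.compl_subset_compl.2
  rintro z (hz | ⟨w, -, rfl⟩)
  · simp only [region, Set.mem_iUnion] at hz
    obtain ⟨e, he, hze⟩ := hz
    exact Or.inr (Set.mem_biUnion he.1 hze)
  · exact Or.inl ⟨w, rfl⟩

lemma point_mem_star (v : V) : D.point v ∈ D.star v := by
  rintro (hz | ⟨w, hw, h⟩)
  · simp only [region, Set.mem_iUnion] at hz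
    obtain ⟨e, he, hze⟩ := hz
    exact he.2 v (D.mem_of_point_mem_arc e he.1 v hze) rfl
  · exact hw (D.point_injective h)

lemma isOpen_star [Finite V] (v : V) : IsOpen (D.star v) :=
  ((D.isCompact_region _).union ((Set.toFinite _).image _).isCompact).isClosed.isOpen_compl

/-- If all vertices lie on the boundary of the outer face, then there is a point that can be joined
to every vertex `v` within the star of `v`. -/
lemma exists_apex [Finite V] (h : ∀ v, D.point v ∈ frontier D.outerFace) :
    ∃ q : ℂ, ∀ v, JoinedIn (D.star v) q (D.point v) := by
  obtain ⟨r, hr⟩ := D.isCompact_support.isBounded.subset_closedBall 0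
  set ρ := max r 0 with hρ
  have hfar : {z : ℂ | ρ < ‖z‖} ⊆ D.supportᶜ := by
    intro z hz hz'
    have := hr hz'
    simp only [Metric.mem_closedBall, dist_zero_right] at this
    exact absurd (lt_of_le_of_lt (le_max_left r 0) hz) this.not_gt
  have hpc := isPathConnected_norm_gt ρ (le_max_right _ _)
  obtain ⟨q, hq⟩ := hpc.nonempty
  have hopen : IsOpen D.supportᶜ := D.isCompact_support.isClosed.isOpen_compl
  refine ⟨q, fun v ↦ ?_⟩
  obtain ⟨ε, hε, hball⟩ := Metric.isOpen_iff.1 (D.isOpen_star v) _ (D.point_mem_star v)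
  obtain ⟨z, hz, hzv⟩ := Metric.mem_closure_iff.1 (frontier_subset_closure (h v)) ε hε
  have hzball : z ∈ Metric.ball (D.point v) ε := by rwa [Metric.mem_ball, dist_comm]
  -- The connection runs from `q` to `u` far outside the drawing, from `u` to `z` within the face,
  -- and from `z` to `v` in a small disc that only edges at `v` can meet.
  obtain ⟨u, hu, hur⟩ : ∃ u ∈ connectedComponentIn D.supportᶜ z, ρ < ‖u‖ := by
    by_contra! hcon
    exact hz.2 ((Metric.isBounded_closedBall (x := (0 : ℂ)) (r := ρ)).subset fun u hu ↦ by
      simpa using hcon u hu)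
  have hcomp : IsPathConnected (connectedComponentIn D.supportᶜ z) :=
    hopen.connectedComponentIn.isConnected_iff_isPathConnected.1
      (isConnected_connectedComponentIn_iff.2 hz.1)
  have h1 : JoinedIn D.supportᶜ q u := (hpc.joinedIn q hq u hur).mono hfar
  have h2 : JoinedIn D.supportᶜ u z :=
    (hcomp.joinedIn u hu z (mem_connectedComponentIn hz.1)).mono (connectedComponentIn_subset _ _)
  have h3 : JoinedIn (D.star v) z (D.point v) :=
    (((convex_ball (D.point v) ε).isPathConnected ⟨z, hzball⟩).joinedIn z hzball _
      (Metric.mem_ball_self hε)).mono hball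
  exact ((h1.trans h2).mono (D.support_compl_subset_star v)).trans h3

/-- Three connections between two vertices and three middle vertices violate outerplanarity. -/
lemma no_K23 [Finite V] (h : ∀ v, D.point v ∈ frontier D.outerFace) (x : Fin 2 → V)
    (m : Fin 3 → V) (U : Fin 2 → Fin 3 → Set V)
    (hJ : ∀ i j, JoinedIn (D.region (U i j)) (D.point (x i)) (D.point (m j)))
    (hm : ∀ i j l, j ≠ l → m l ∉ U i j)
    (hD : ∀ j l, j ≠ l → Disjoint (U 0 j) (U 1 l)) : False := by
  obtain ⟨q, hq⟩ := D.exists_apex h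
  -- The apex is the third vertex on the side of `x`. Its connections may meet one another freely,
  -- since they share the end `q`.
  refine no_planar_K33 ![q, D.point (x 0), D.point (x 1)] (fun j ↦ D.point (m j))
    (fun i j ↦ ![D.star (m j), D.region (U 0 j), D.region (U 1 j)] i) ?_ ?_
  · intro i j
    fin_cases i
    · exact hq (m j)
    · exact hJ 0 j
    · exact hJ 1 j
  · intro i j k l hik hjl
    fin_cases i <;> fin_cases k <;> simp at hik ⊢
    · exact D.disjoint_star (hm _ _ _ hjl.symm)
    · exact D.disjoint_star (hm _ _ _ hjl.symm)
    · exact D.disjoint_region (hD j l hjl)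

/-- The four ends of the chords, joined by the two chords and the four arcs of the cycle, form a
subdivided `K₄`. The apex completes it to a subdivided `K₅`. -/
lemma no_crossing_chords [Finite V] (h : ∀ v, D.point v ∈ frontier D.outerFace) (w : ℕ → V)
    (k a b c d : ℕ) (hw : Set.InjOn w (Set.Iic k)) (hadj : ∀ i < k, G.Adj (w i) (w (i + 1)))
    (hclose : G.Adj (w k) (w 0)) (hab : a < b) (hbc : b < c) (hcd : c < d) (hdk : d ≤ k)
    (hac : G.Adj (w a) (w c)) (hbd : G.Adj (w b) (w d)) : False := by
  obtain ⟨q, hq⟩ := D.exists_apex h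
  let S : Set ℕ → Set ℂ := fun T ↦ D.region (w '' T)
  have hdis : ∀ T T' : Set ℕ, T ⊆ Set.Iic k → T' ⊆ Set.Iic k → Disjoint T T' →
      Disjoint (S T) (S T') :=
    fun T T' hT hT' hTT ↦ D.disjoint_region (Set.disjoint_image_image fun i hi j hj hij ↦
      Set.disjoint_left.1 hTT hi (hw (hT hi) (hT' hj) hij ▸ hj))
  have hst : ∀ i ≤ k, ∀ T : Set ℕ, T ⊆ Set.Iic k → i ∉ T →
      Disjoint (D.star (w i)) (S T) := by
    intro i hi T hT hiT
    refine D.disjoint_star ?_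
    rintro ⟨j, hj, hji⟩
    exact hiT (hw (hT hj) hi hji ▸ hj)
  have hwalk : ∀ i j, i < j → j ≤ k → JoinedIn (S (Set.Icc i j)) (D.point (w i)) (D.point (w j)) :=
    fun i j hij hjk ↦ D.joinedIn_region_walk w i j hij
      (fun t h1 h2 ↦ ⟨t, ⟨h1, h2⟩, rfl⟩) (fun t _ h2 ↦ hadj t (by omega))
  have hchord : ∀ i j, G.Adj (w i) (w j) → JoinedIn (S {i, j}) (D.point (w i)) (D.point (w j)) :=
    fun i j hij ↦ D.joinedIn_region ⟨i, by simp, rfl⟩ ⟨j, by simp, rfl⟩ hij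
  -- The part of the cycle from `d` back to `a` runs through the closing edge; either end segment
  -- may be trivial.
  have hda : JoinedIn (S (Set.Icc 0 a ∪ Set.Icc d k)) (D.point (w a)) (D.point (w d)) := by
    have mono : ∀ T T' : Set ℕ, T ⊆ T' → S T ⊆ S T' := by
      intro T T' hT z hz
      simp only [S, region, Set.mem_iUnion] at hz ⊢
      obtain ⟨e, he, hze⟩ := hz
      exact ⟨e, ⟨he.1, fun v hv ↦ Set.image_mono hT (he.2 v hv)⟩, hze⟩
    have h0 : JoinedIn (S (Set.Icc 0 a ∪ Set.Icc d k)) (D.point (w k)) (D.point (w 0)) :=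
      (hchord k 0 hclose).mono (mono _ _ (by
        rintro i (rfl | rfl)
        · exact Or.inr ⟨hdk, le_rfl⟩
        · exact Or.inl ⟨le_rfl, Nat.zero_le _⟩))
    have h1 : JoinedIn (S (Set.Icc 0 a ∪ Set.Icc d k)) (D.point (w 0)) (D.point (w a)) := by
      rcases Nat.eq_zero_or_pos a with rfl | ha
      · exact JoinedIn.refl h0.target_mem
      · exact (hwalk 0 a ha (by omega)).mono (mono _ _ Set.subset_union_left)
    have h2 : JoinedIn (S (Set.Icc 0 a ∪ Set.Icc d k)) (D.point (w d)) (D.point (w k)) := by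
      rcases Nat.eq_or_lt_of_le hdk with rfl | ha
      · exact JoinedIn.refl h0.source_mem
      · exact (hwalk d k ha le_rfl).mono (mono _ _ Set.subset_union_right)
    exact ((h2.trans h0).trans h1).symm
  refine no_planar_K5 ![q, D.point (w a), D.point (w b), D.point (w c), D.point (w d)]
    (fun i j ↦ ![![∅, D.star (w a), D.star (w b), D.star (w c), D.star (w d)],
      ![∅, ∅, S (Set.Icc a b), S {a, c}, S (Set.Icc 0 a ∪ Set.Icc d k)],
      ![∅, ∅, ∅, S (Set.Icc b c), S {b, d}],
      ![∅, ∅, ∅, ∅, S (Set.Icc c d)],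
      ![∅, ∅, ∅, ∅, ∅]] i j) ?_ ?_
  · intro i j hij
    fin_cases i <;> fin_cases j <;> simp at hij ⊢
    · exact hq _
    · exact hq _
    · exact hq _
    · exact hq _
    · exact hwalk a b hab (by omega)
    · exact hchord a c hac
    · exact hda
    · exact hwalk b c hbc (by omega)
    · exact hchord b d hbd
    · exact hwalk c d hcd (by omega)
  · intro i j i' j' h1 h2 h3 h4 h5
    fin_cases i <;> fin_cases j <;> simp at h1 <;> fin_cases i' <;> simp at h3 h4 <;>
      fin_cases j' <;> simp at h2 h5 ⊢ <;>
    first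
    | (apply hst <;>
        (try simp only [Set.subset_def, Set.mem_insert_iff, Set.mem_singleton_iff, Set.mem_Icc,
          Set.mem_Iic, Set.mem_union]) <;> intros <;> omega)
    | (apply hdis <;>
        simp only [Set.subset_def, Set.disjoint_left, Set.mem_insert_iff, Set.mem_singleton_iff,
          Set.mem_Icc, Set.mem_Iic, Set.mem_union] <;> intros <;> omega)

end PlaneDrawing

/-- Outerplanar graphs contain none of the obstructions. -/
theorem IsOuterplanar.noOuterObstruction {V : Type*} [Finite V] {G : SimpleGraph V}
    (h : IsOuterplanar G) : NoOuterObstruction G := by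
  obtain ⟨D, hD⟩ := h
  refine ⟨?_, ?_, ?_⟩
  · intro x y a b c hxy hab hac hbc xa xb xc ya yb yc
    refine D.no_K23 hD ![x, y] ![a, b, c] (fun i j ↦ {![x, y] i, ![a, b, c] j}) ?_ ?_ ?_
    · intro i j
      refine D.joinedIn_region (by simp) (by simp) ?_
      fin_cases i <;> fin_cases j <;> assumption
    · intro i j l hjl
      fin_cases i <;> fin_cases j <;> fin_cases l <;> simp at hjl ⊢ <;>
        simp [*, Ne.symm, xa.ne', xb.ne', xc.ne', ya.ne', yb.ne', yc.ne', hab.symm, hac.symm,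
          hbc.symm]
    · intro j l hjl
      fin_cases j <;> fin_cases l <;> simp at hjl ⊢ <;>
        simp [*, xa.ne', xb.ne', xc.ne', ya.ne, yb.ne, yc.ne, hab.symm, hac.symm, hbc.symm,
          hxy.symm]
  · intro x y u w a b hxy huw hau haw hay hbu hbw hbx xu xw yu yw xa yb ab
    -- The vertex `a` is taken as third middle vertex and `b` is absorbed into its connection to
    -- `y`.
    refine D.no_K23 hD ![x, y] ![u, w, a]
      ![![{x, u}, {x, w}, {x, a}], ![{y, u}, {y, w}, {y, b, a}]] ?_ ?_ ?_
    · intro i j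
      fin_cases i <;> fin_cases j
      · exact D.joinedIn_region (by simp) (by simp) xu
      · exact D.joinedIn_region (by simp) (by simp) xw
      · exact D.joinedIn_region (by simp) (by simp) xa
      · exact D.joinedIn_region (by simp) (by simp) yu
      · exact D.joinedIn_region (by simp) (by simp) yw
      · exact (D.joinedIn_region (v := b) (by simp) (by simp) yb).trans
          (D.joinedIn_region (by simp) (by simp) ab.symm)
    · intro i j l hjl
      fin_cases i <;> fin_cases j <;> fin_cases l <;> simp at hjl ⊢ <;>
        simp [*, xu.ne', xw.ne', xa.ne', yu.ne', yw.ne', huw.symm, hau.symm, haw.symm, hbu.symm,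
          hbw.symm]
    · intro j l hjl
      fin_cases j <;> fin_cases l <;> simp at hjl ⊢ <;>
        simp [*, xu.ne', xw.ne', xa.ne', yu.ne, yw.ne, huw.symm, hau.symm, haw.symm, hxy.symm,
          hay.symm]
  · intro w k a b c d hw hadj hcl h1 h2 h3 h4 h5 h6
    exact D.no_crossing_chords hD w k a b c d hw hadj hcl h1 h2 h3 h4 h5 h6

/-! ### Degrees inside a vertex set and the edge bound -/

open Classical in
/-- The neighbours of `v` in the vertex set `S`. -/
noncomputable def nbrsIn {V : Type*} (G : SimpleGraph V) (S : Finset V) (v : V) : Finset V :=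
  S.filter (G.Adj v)

/-- The number of neighbours of `v` in the vertex set `S`. -/
noncomputable def degIn {V : Type*} (G : SimpleGraph V) (S : Finset V) (v : V) : ℕ :=
  (nbrsIn G S v).card

/-- The sum of all degrees in the subgraph induced by `S`, that is, twice its number of edges. -/
noncomputable def degSumIn {V : Type*} (G : SimpleGraph V) (S : Finset V) : ℕ :=
  ∑ v ∈ S, degIn G S v

section LowDegree

variable {V : Type*} {G : SimpleGraph V} {S : Finset V}

@[simp] lemma mem_nbrsIn {u v : V} : u ∈ nbrsIn G S v ↔ u ∈ S ∧ G.Adj v u := by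
  simp [nbrsIn]

lemma nbrsIn_mono {T : Finset V} (h : T ⊆ S) (v : V) : nbrsIn G T v ⊆ nbrsIn G S v :=
  fun u hu ↦ by rw [mem_nbrsIn] at hu ⊢; exact ⟨h hu.1, hu.2⟩

lemma degIn_mono {T : Finset V} (h : T ⊆ S) (v : V) : degIn G T v ≤ degIn G S v :=
  Finset.card_le_card (nbrsIn_mono h v)

lemma degIn_pos {u v : V} (hu : u ∈ S) (h : G.Adj v u) : 1 ≤ degIn G S v :=
  Finset.card_pos.2 ⟨u, mem_nbrsIn.2 ⟨hu, h⟩⟩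

/-- In a graph without crossing chords, every non-isolated vertex `p` of `S` is accompanied by
another non-isolated vertex of degree at most two. -/
lemma NoOuterObstruction.exists_low_ne (hG : NoOuterObstruction G) {p q : V} (hp : p ∈ S)
    (hq : q ∈ S) (hpq : G.Adj p q) :
    ∃ u ∈ S, u ≠ p ∧ 1 ≤ degIn G S u ∧ degIn G S u ≤ 2 := by
  classical
  by_contra! hcon
  -- These are the paths with `k` edges whose last vertex is `p`. Fixing the end guarantees that the
  -- start of a longest one differs from `p`.
  let good : ℕ → (ℕ → V) → Prop := fun k w ↦ Set.InjOn w (Set.Iic k) ∧ (∀ i ≤ k, w i ∈ S) ∧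
    (∀ i < k, G.Adj (w i) (w (i + 1))) ∧ w k = p
  have hbound : ∀ k w, good k w → k ≤ S.card := by
    rintro k w ⟨h1, h2, -, -⟩
    have : (Finset.Iic k).card ≤ S.card :=
      Finset.card_le_card_of_injOn w (fun i hi ↦ h2 i (by simpa using hi)) (by simpa using h1)
    rw [Nat.card_Iic] at this
    omega
  have hone : good 1 (fun i ↦ if i = 0 then q else p) := by
    refine ⟨?_, ?_, ?_, by simp⟩
    · intro i hi j hj hij
      simp only [Set.mem_Iic] at hi hj
      have := hpq.ne
      interval_cases i <;> interval_cases j <;> simp_all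
    · intro i hi
      dsimp only; split_ifs <;> assumption
    · intro i hi
      obtain rfl : i = 0 := by omega
      simpa using hpq.symm
  obtain ⟨k, ⟨w₀, hw₀⟩, hmax⟩ : ∃ k, (∃ w, good k w) ∧ ∀ k' w, good k' w → k' ≤ k := by
    refine ⟨Nat.findGreatest (fun k ↦ ∃ w, good k w) S.card, ?_, ?_⟩
    · exact Nat.findGreatest_spec (P := fun k ↦ ∃ w, good k w) (hbound _ _ hone) ⟨_, hone⟩
    · exact fun k' w h ↦ Nat.le_findGreatest (hbound _ _ h) ⟨w, h⟩
  have hk : 1 ≤ k := hmax 1 _ hone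
  have hidx : ∀ w, good k w → ∀ u ∈ S, G.Adj (w 0) u → ∃ j, 1 ≤ j ∧ j ≤ k ∧ w j = u := by
    intro w hw u hu hadj
    by_contra! hno
    have hnot : ∀ j ≤ k, w j ≠ u := by
      intro j hj
      rcases Nat.eq_zero_or_pos j with rfl | h
      · exact hadj.ne
      · exact hno j h hj
    have : good (k + 1) (fun t ↦ if t = 0 then u else w (t - 1)) := by
      refine ⟨?_, ?_, ?_, by simpa using hw.2.2.2⟩
      · intro i hi j hj hij
        simp only [Set.mem_Iic] at hi hj
        dsimp only at hij
        split_ifs at hij with h1 h2 h2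
        · omega
        · exact absurd hij.symm (hnot _ (by omega))
        · exact absurd hij (hnot _ (by omega))
        · have := hw.1 (by simp; omega) (by simp; omega) hij
          omega
      · intro i hi
        dsimp only
        split_ifs
        · exact hu
        · exact hw.2.1 _ (by omega)
      · intro i hi
        rcases Nat.eq_zero_or_pos i with rfl | h
        · simpa using hadj.symm
        · have := hw.2.2.1 (i - 1) (by omega)
          rw [Nat.sub_add_cancel h] at this
          simpa [h.ne'] using this
    have := hmax _ _ this
    omega
  -- By maximality all neighbours of the start lie on the path. Having at least three, it has a
  -- chord that avoids both `w 1` and any prescribed index `m`.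
  have htwo : ∀ w, good k w → ∀ m, ∃ j, 2 ≤ j ∧ j ≤ k ∧ j ≠ m ∧ G.Adj (w 0) (w j) := by
    intro w hw m
    have h0 : w 0 ≠ p := by
      rw [← hw.2.2.2]
      intro h
      have := hw.1 (by simp) (by simp) h
      omega
    have h3 := hcon (w 0) (hw.2.1 0 (by omega)) h0
      (degIn_pos (hw.2.1 1 hk) (hw.2.2.1 0 (by omega)))
    obtain ⟨u, hu, hu'⟩ : ∃ u ∈ nbrsIn G S (w 0), u ∉ ({w 1, w m} : Finset V) := by
      apply Finset.exists_mem_notMem_of_card_lt_card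
      exact lt_of_le_of_lt Finset.card_le_two h3
    rw [mem_nbrsIn] at hu
    obtain ⟨j, hj1, hjk, rfl⟩ := hidx w hw u hu.1 hu.2
    simp only [Finset.mem_insert, Finset.mem_singleton, not_or] at hu'
    refine ⟨j, ?_, hjk, fun h ↦ hu'.2 (by rw [h]), hu.2⟩
    have : j ≠ 1 := fun h ↦ hu'.1 (by rw [h])
    omega
  -- The index `i` is chosen least over all longest paths, not just along one. It therefore also
  -- bounds the chords of the rotated path below.
  have hex : ∃ i, 2 ≤ i ∧ i ≤ k ∧ ∃ w, good k w ∧ G.Adj (w 0) (w i) := by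
    obtain ⟨j, h1, h2, -, h3⟩ := htwo w₀ hw₀ 0
    exact ⟨j, h1, h2, w₀, hw₀, h3⟩
  have hmin := fun m ↦ Nat.find_min' (m := m) hex
  obtain ⟨hi2, hik, w, hw, hwi⟩ := Nat.find_spec hex
  set i := Nat.find hex
  obtain ⟨j, hj2, hjk, hji, hwj⟩ := htwo w hw i
  have hij : i ≤ j := hmin j ⟨hj2, hjk, w, hw, hwj⟩
  -- Rotation: the chord from `w 0` to `w i` replaces the edge from `w (i - 1)` to `w i`, giving
  -- another longest path, which starts at `w (i - 1)`.
  let w' : ℕ → V := fun t ↦ if t < i then w (i - 1 - t) else w t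
  have w'lt : ∀ t, t < i → w' t = w (i - 1 - t) := fun t h ↦ by simp [w', h]
  have w'ge : ∀ t, i ≤ t → w' t = w t := fun t h ↦ by simp [w', h]
  have hw'0 : w' 0 = w (i - 1) := w'lt 0 (by omega)
  have hw'last : w' (i - 1) = w 0 := by rw [w'lt _ (by omega), Nat.sub_self]
  have hw' : good k w' := by
    refine ⟨?_, ?_, ?_, by rw [w'ge k hik, hw.2.2.2]⟩
    · intro s hs t ht hst
      simp only [Set.mem_Iic] at hs ht
      simp only [w'] at hst
      split_ifs at hst <;>
        have := hw.1 (by simp; omega) (by simp; omega) hst <;> omega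
    · intro t ht
      dsimp only [w']
      split_ifs <;> exact hw.2.1 _ (by omega)
    · intro t ht
      rcases lt_trichotomy (t + 1) i with h | h | h
      · rw [w'lt t (by omega), w'lt (t + 1) h]
        have := hw.2.2.1 (i - 1 - (t + 1)) (by omega)
        rw [show i - 1 - (t + 1) + 1 = i - 1 - t by omega] at this
        exact this.symm
      · rw [w'lt t (by omega), w'ge (t + 1) (by omega), h, show i - 1 - t = 0 by omega]
        exact hwi
      · rw [w'ge t (by omega), w'ge (t + 1) (by omega)]
        exact hw.2.2.1 t ht
  obtain ⟨j', hj2', hjk', hji', hwj'⟩ := htwo w' hw' i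
  have hij' : i ≤ j' := hmin j' ⟨hj2', hjk', w', hw', hwj'⟩
  have hII : ∀ {m}, m ≤ k → Set.Iic m ⊆ Set.Iic k := fun h ↦ Set.Iic_subset_Iic.2 h
  -- Both starts have a chord beyond `i`. The longer one closes a cycle in which the shorter one
  -- crosses an edge to `w i`: the chord from `w 0` in the first case, the edge from `w (i - 1)` in
  -- the second.
  rcases le_or_gt j' j with h | h
  · refine hG.cross w j 0 (i - 1) i j' (hw.1.mono (hII hjk)) (fun t ht ↦ hw.2.2.1 t (by omega))
      hwj.symm (by omega) (by omega) (by omega) h hwi ?_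
    rw [hw'0, w'ge j' hij'] at hwj'
    exact hwj'
  · refine hG.cross w' j' 0 (i - 1) i j (hw'.1.mono (hII hjk'))
      (fun t ht ↦ hw'.2.2.1 t (by omega)) hwj'.symm (by omega) (by omega) (by omega) h.le ?_ ?_
    · rw [hw'0, w'ge i le_rfl]
      have := hw.2.2.1 (i - 1) (by omega)
      rwa [Nat.sub_add_cancel (by omega)] at this
    · rw [hw'last, w'ge j hij]
      exact hwj

/-- Every nonempty vertex set contains a vertex with at most two neighbours inside. -/
lemma NoOuterObstruction.exists_low (hG : NoOuterObstruction G) (hS : S.Nonempty) :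
    ∃ u ∈ S, degIn G S u ≤ 2 := by
  obtain ⟨p, hp⟩ := hS
  by_cases h : ∃ q ∈ S, G.Adj p q
  · obtain ⟨q, hq, hpq⟩ := h
    obtain ⟨u, hu, -, -, h2⟩ := hG.exists_low_ne hp hq hpq
    exact ⟨u, hu, h2⟩
  · refine ⟨p, hp, ?_⟩
    have : nbrsIn G S p = ∅ := by
      ext u
      simp only [mem_nbrsIn, Finset.notMem_empty, iff_false]
      exact fun hu ↦ h ⟨u, hu⟩
    simp [degIn, this]

variable [DecidableEq V]

lemma nbrsIn_erase (v u : V) : nbrsIn G (S.erase v) u = (nbrsIn G S u).erase v := by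
  ext x
  simp only [mem_nbrsIn, Finset.mem_erase]
  tauto

lemma degIn_erase_of_adj {u v : V} (hv : v ∈ S) (h : G.Adj u v) :
    degIn G (S.erase v) u + 1 = degIn G S u := by
  rw [degIn, nbrsIn_erase, degIn, Finset.card_erase_add_one]
  exact mem_nbrsIn.2 ⟨hv, h⟩

lemma degIn_erase_of_not_adj {u v : V} (h : ¬ G.Adj u v) :
    degIn G (S.erase v) u = degIn G S u := by
  rw [degIn, nbrsIn_erase, degIn, Finset.erase_eq_of_notMem]
  exact fun h' ↦ h (mem_nbrsIn.1 h').2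

lemma degSumIn_erase {v : V} (hv : v ∈ S) :
    degSumIn G S = degSumIn G (S.erase v) + 2 * degIn G S v := by
  have h1 : ∀ u ∈ S.erase v, degIn G S u =
      degIn G (S.erase v) u + if u ∈ nbrsIn G S v then 1 else 0 := by
    intro u hu
    by_cases h : G.Adj v u
    · rw [if_pos (mem_nbrsIn.2 ⟨Finset.mem_of_mem_erase hu, h⟩), degIn_erase_of_adj hv h.symm]
    · rw [if_neg (fun h' ↦ h (mem_nbrsIn.1 h').2),
        degIn_erase_of_not_adj (fun h' ↦ h h'.symm), add_zero]
  have h2 : (∑ u ∈ S.erase v, if u ∈ nbrsIn G S v then 1 else 0) = degIn G S v := by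
    rw [Finset.sum_boole]
    simp only [Nat.cast_id, degIn]
    congr 1
    ext u
    simp only [Finset.mem_filter, Finset.mem_erase, mem_nbrsIn]
    constructor
    · exact fun h ↦ h.2
    · exact fun h ↦ ⟨⟨h.2.ne', h.1⟩, h⟩
  rw [degSumIn, ← Finset.add_sum_erase _ _ hv, Finset.sum_congr rfl h1, Finset.sum_add_distrib, h2,
    degSumIn]
  ring

/-- Parity later raises a degree sum of at least `4n - 7` to the maximum `4n - 6`. -/
lemma even_degSumIn : Even (degSumIn G S) := by
  induction S using Finset.induction_on with
  | empty => simp [degSumIn]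
  | insert v S hv ih =>
    rw [degSumIn_erase (Finset.mem_insert_self v S), Finset.erase_insert hv]
    exact ih.add (even_two_mul _)

lemma degIn_le_card_sub_one {v : V} (hv : v ∈ S) : degIn G S v + 1 ≤ S.card := by
  rw [← Finset.card_erase_add_one hv]
  gcongr
  apply Finset.card_le_card
  intro u hu
  rw [mem_nbrsIn] at hu
  exact Finset.mem_erase.2 ⟨hu.2.ne', hu.1⟩

/-- An outerplanar graph on `n ≥ 2` vertices has at most `2 n - 3` edges. -/
lemma NoOuterObstruction.degSumIn_le (hG : NoOuterObstruction G) (hS : 2 ≤ S.card) :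
    degSumIn G S + 6 ≤ 4 * S.card := by
  obtain ⟨n, hn⟩ : ∃ n, S.card = n := ⟨_, rfl⟩
  rw [hn] at hS ⊢
  induction n, hS using Nat.le_induction generalizing S with
  | base =>
    have : degSumIn G S ≤ ∑ _v ∈ S, 1 := Finset.sum_le_sum fun v hv ↦ by
      have := degIn_le_card_sub_one (G := G) hv
      omega
    simp only [Finset.sum_const, smul_eq_mul, mul_one] at this
    omega
  | succ n hn2 ih =>
    obtain ⟨v, hv, h⟩ := hG.exists_low (S := S) (Finset.card_pos.1 (by omega))
    have hc := Finset.card_erase_add_one hv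
    have := ih (S := S.erase v) (by omega)
    rw [degSumIn_erase hv]
    omega

end LowDegree

/-! ### Counting the paths through a vertex -/

/-- `a, b, c, d` is a path on four vertices. -/
def IsPathQuad {V : Type*} (G : SimpleGraph V) (q : V × V × V × V) : Prop :=
  G.Adj q.1 q.2.1 ∧ G.Adj q.2.1 q.2.2.1 ∧ G.Adj q.2.2.1 q.2.2.2 ∧ q.1 ≠ q.2.2.1 ∧
    q.2.1 ≠ q.2.2.2 ∧ q.1 ≠ q.2.2.2

open Classical in
/-- The ordered paths on four vertices within `S`; every path appears in both directions. -/
noncomputable def pathQuads {V : Type*} (G : SimpleGraph V) (S : Finset V) :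
    Finset (V × V × V × V) :=
  (S ×ˢ S ×ˢ S ×ˢ S).filter (IsPathQuad G)

/-- The number of paths on four vertices within `S` that contain `v`: those that end in `v`, and
those with `v` as an inner vertex. -/
noncomputable def pathsThrough {V : Type*} [DecidableEq V] (G : SimpleGraph V) (S : Finset V)
    (v : V) : ℕ :=
  ∑ b ∈ nbrsIn G S v, ∑ c ∈ (nbrsIn G S b).erase v, (((nbrsIn G S c).erase b).erase v).card +
  ∑ a ∈ nbrsIn G S v, ∑ c ∈ (nbrsIn G S v).erase a, (((nbrsIn G S c).erase v).erase a).card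

section Gain

variable {V : Type*} {G : SimpleGraph V} {S : Finset V}

lemma mem_pathQuads {q : V × V × V × V} : q ∈ pathQuads G S ↔
    (q.1 ∈ S ∧ q.2.1 ∈ S ∧ q.2.2.1 ∈ S ∧ q.2.2.2 ∈ S) ∧ IsPathQuad G q := by
  simp [pathQuads]

lemma IsPathQuad.reverse {a b c d : V} (h : IsPathQuad G (a, b, c, d)) :
    IsPathQuad G (d, c, b, a) := by
  obtain ⟨h1, h2, h3, h4, h5, h6⟩ := h
  exact ⟨h3.symm, h2.symm, h1.symm, h5.symm, h4.symm, h6.symm⟩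

variable [DecidableEq V]

lemma card_pathQuads_first (v : V) (hv : v ∈ S) :
    ((pathQuads G S).filter (fun q ↦ q.1 = v)).card =
      ∑ b ∈ nbrsIn G S v, ∑ c ∈ (nbrsIn G S b).erase v,
        (((nbrsIn G S c).erase b).erase v).card := by
  simp_rw [← Finset.card_sigma]
  refine Finset.card_bij' (fun q _ ↦ ⟨q.2.1, q.2.2.1, q.2.2.2⟩)
    (fun s _ ↦ (v, s.1, s.2.1, s.2.2)) ?_ ?_ ?_ ?_
  · rintro ⟨a, b, c, d⟩ h
    simp only [Finset.mem_filter, mem_pathQuads, IsPathQuad] at h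
    obtain ⟨⟨⟨h1, h2, h3, h4⟩, h5, h6, h7, h8, h9, h10⟩, rfl⟩ := h
    simp [*, Ne.symm]
  · rintro ⟨b, c, d⟩ h
    simp only [Finset.mem_sigma, Finset.mem_erase, mem_nbrsIn] at h
    obtain ⟨⟨h1, h2⟩, ⟨h3, h4, h5⟩, h6, h7, h8, h9⟩ := h
    simp only [Finset.mem_filter, mem_pathQuads, IsPathQuad, and_true]
    exact ⟨⟨hv, h1, h4, h8⟩, h2, h5, h9, Ne.symm h3, Ne.symm h7, Ne.symm h6⟩
  · rintro ⟨a, b, c, d⟩ h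
    simp only [Finset.mem_filter] at h
    simp [h.2]
  · rintro ⟨b, c, d⟩ h
    rfl

lemma card_pathQuads_second (v : V) (hv : v ∈ S) :
    ((pathQuads G S).filter (fun q ↦ q.2.1 = v)).card =
      ∑ a ∈ nbrsIn G S v, ∑ c ∈ (nbrsIn G S v).erase a,
        (((nbrsIn G S c).erase v).erase a).card := by
  simp_rw [← Finset.card_sigma]
  refine Finset.card_bij' (fun q _ ↦ ⟨q.1, q.2.2.1, q.2.2.2⟩)
    (fun s _ ↦ (s.1, v, s.2.1, s.2.2)) ?_ ?_ ?_ ?_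
  · rintro ⟨a, b, c, d⟩ h
    simp only [Finset.mem_filter, mem_pathQuads, IsPathQuad] at h
    obtain ⟨⟨⟨h1, h2, h3, h4⟩, h5, h6, h7, h8, h9, h10⟩, rfl⟩ := h
    simp [*, h5.symm]
    exact ⟨h8.symm, h10.symm, h9.symm⟩
  · rintro ⟨b, c, d⟩ h
    simp only [Finset.mem_sigma, Finset.mem_erase, mem_nbrsIn] at h
    obtain ⟨⟨h1, h2⟩, ⟨h3, h4, h5⟩, h6, h7, h8, h9⟩ := h
    simp only [Finset.mem_filter, mem_pathQuads, IsPathQuad, and_true]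
    exact ⟨⟨h1, hv, h4, h8⟩, h2.symm, h5, h9, Ne.symm h3, Ne.symm h7, Ne.symm h6⟩
  · rintro ⟨a, b, c, d⟩ h
    simp only [Finset.mem_filter] at h
    simp [h.2]
  · rintro ⟨b, c, d⟩ h
    rfl

lemma card_pathQuads_third (v : V) :
    ((pathQuads G S).filter (fun q ↦ q.2.2.1 = v)).card =
      ((pathQuads G S).filter (fun q ↦ q.2.1 = v)).card := by
  refine Finset.card_bij' (fun q _ ↦ (q.2.2.2, q.2.2.1, q.2.1, q.1))
    (fun q _ ↦ (q.2.2.2, q.2.2.1, q.2.1, q.1)) ?_ ?_ (fun _ _ ↦ rfl) (fun _ _ ↦ rfl) <;>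
  · rintro ⟨a, b, c, d⟩ h
    simp only [Finset.mem_filter, mem_pathQuads] at h ⊢
    exact ⟨⟨⟨h.1.1.2.2.2, h.1.1.2.2.1, h.1.1.2.1, h.1.1.1⟩, h.1.2.reverse⟩, h.2⟩

lemma card_pathQuads_fourth (v : V) :
    ((pathQuads G S).filter (fun q ↦ q.2.2.2 = v)).card =
      ((pathQuads G S).filter (fun q ↦ q.1 = v)).card := by
  refine Finset.card_bij' (fun q _ ↦ (q.2.2.2, q.2.2.1, q.2.1, q.1))
    (fun q _ ↦ (q.2.2.2, q.2.2.1, q.2.1, q.1)) ?_ ?_ (fun _ _ ↦ rfl) (fun _ _ ↦ rfl) <;>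
  · rintro ⟨a, b, c, d⟩ h
    simp only [Finset.mem_filter, mem_pathQuads] at h ⊢
    exact ⟨⟨⟨h.1.1.2.2.2, h.1.1.2.2.1, h.1.1.2.1, h.1.1.1⟩, h.1.2.reverse⟩, h.2⟩

/-- A path meets `v` in exactly one of four positions. Reversal exchanges first with fourth and
second with third, whence the factor two. -/
lemma card_pathQuads_erase {v : V} (hv : v ∈ S) :
    (pathQuads G S).card = (pathQuads G (S.erase v)).card + 2 * pathsThrough G S v := by
  have e1 : pathQuads G S = pathQuads G (S.erase v) ∪
      ((pathQuads G S).filter (fun q ↦ q.1 = v) ∪ (pathQuads G S).filter (fun q ↦ q.2.1 = v) ∪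
      ((pathQuads G S).filter (fun q ↦ q.2.2.1 = v) ∪
        (pathQuads G S).filter (fun q ↦ q.2.2.2 = v))) := by
    ext q
    simp only [Finset.mem_union, Finset.mem_filter, mem_pathQuads, Finset.mem_erase]
    tauto
  rw [e1, Finset.card_union_of_disjoint, Finset.card_union_of_disjoint,
    Finset.card_union_of_disjoint, Finset.card_union_of_disjoint, card_pathQuads_third,
    card_pathQuads_fourth, card_pathQuads_first v hv, card_pathQuads_second v hv, pathsThrough]
  · ring
  all_goals
    rw [Finset.disjoint_left]
    rintro ⟨a, b, c, d⟩ h1 h2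
    simp only [Finset.mem_union, Finset.mem_filter, mem_pathQuads, Finset.mem_erase, IsPathQuad]
      at h1 h2
    have := fun h : G.Adj a b ↦ h.ne
    have := fun h : G.Adj b c ↦ h.ne
    have := fun h : G.Adj c d ↦ h.ne
    grind

lemma card_end_choices {v b c : V} (hb : b ∈ S) (hv : v ∈ S) (hc : c ∈ S) (hbv : b ≠ v)
    (hcb : G.Adj c b) :
    (((nbrsIn G S c).erase b).erase v).card + 1 + (if c ∈ nbrsIn G S v then 1 else 0) =
      degIn G S c := by
  rw [degIn, ← Finset.card_erase_add_one (mem_nbrsIn.2 ⟨hb, hcb⟩)]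
  split_ifs with h
  · rw [mem_nbrsIn] at h
    rw [← Finset.card_erase_add_one (a := v) (s := (nbrsIn G S c).erase b)]
    exact Finset.mem_erase.2 ⟨hbv.symm, mem_nbrsIn.2 ⟨hv, h.2.symm⟩⟩
  · rw [Finset.erase_eq_of_notMem (a := v), add_zero]
    exact fun h' ↦ h (mem_nbrsIn.2 ⟨hc, (mem_nbrsIn.1 (Finset.mem_of_mem_erase h')).2.symm⟩)

/-- This counts the paths that begin `v, b`. The last vertex ranges over the neighbours of `c`
except `b`, a loss of one for each `c`, and except `v`, a loss only when `c` is a common neighbour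
of `b` and `v`. -/
lemma sum_end_choices {v b : V} (hv : v ∈ S) (hb : b ∈ nbrsIn G S v) :
    ∑ c ∈ (nbrsIn G S b).erase v, (((nbrsIn G S c).erase b).erase v).card + degIn G S b +
      (nbrsIn G S b ∩ nbrsIn G S v).card = ∑ c ∈ (nbrsIn G S b).erase v, degIn G S c + 1 := by
  rw [mem_nbrsIn] at hb
  have h : ∀ c ∈ (nbrsIn G S b).erase v, degIn G S c =
      (((nbrsIn G S c).erase b).erase v).card + 1 + (if c ∈ nbrsIn G S v then 1 else 0) := by
    intro c hc
    rw [Finset.mem_erase, mem_nbrsIn] at hc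
    exact (card_end_choices hb.1 hv hc.2.1 hb.2.ne' hc.2.2.symm).symm
  rw [Finset.sum_congr rfl h, Finset.sum_add_distrib, Finset.sum_add_distrib, Finset.sum_boole,
    Finset.sum_const, smul_eq_mul, mul_one, degIn,
    ← Finset.card_erase_add_one (mem_nbrsIn.2 ⟨hv, hb.2.symm⟩)]
  have : ((nbrsIn G S b).erase v).filter (fun c ↦ c ∈ nbrsIn G S v) =
      nbrsIn G S b ∩ nbrsIn G S v := by
    ext c
    simp only [Finset.mem_filter, Finset.mem_erase, Finset.mem_inter, mem_nbrsIn]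
    constructor
    · exact fun h ↦ ⟨h.1.2, h.2⟩
    · exact fun h ↦ ⟨⟨h.2.2.ne', h.1⟩, h.2⟩
  rw [this]
  simp only [Nat.cast_id]
  ring

lemma pathsThrough_of_degIn_zero {v : V} (h : nbrsIn G S v = ∅) : pathsThrough G S v = 0 := by
  simp [pathsThrough, h]

lemma pathsThrough_of_degIn_one {v x : V} (hv : v ∈ S) (h : nbrsIn G S v = {x}) :
    pathsThrough G S v + degIn G S x = ∑ c ∈ (nbrsIn G S x).erase v, degIn G S c + 1 := by
  have hx : x ∈ nbrsIn G S v := by simp [h]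
  have h0 : nbrsIn G S x ∩ nbrsIn G S v = ∅ := by
    rw [h, Finset.inter_singleton_of_notMem]
    simp
  have := sum_end_choices hv hx
  rw [h0] at this
  rw [← this, pathsThrough, h]
  simp

/-- The degrees of `x` and `y` lost for paths ending at `v` are regained by those with `v` inside.
Only the triangle correction remains: one for each end, and one for each of the two middle counts.
-/
lemma pathsThrough_of_degIn_two [DecidableRel G.Adj] {v x y : V} (hv : v ∈ S) (hxy : x ≠ y)
    (h : nbrsIn G S v = {x, y}) :
    pathsThrough G S v + (if G.Adj x y then 4 else 0) =
      ∑ c ∈ (nbrsIn G S x).erase v, degIn G S c + ∑ c ∈ (nbrsIn G S y).erase v, degIn G S c := by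
  have hx : x ∈ nbrsIn G S v := by simp [h]
  have hy : y ∈ nbrsIn G S v := by simp [h]
  have e1 := sum_end_choices hv hx
  have e2 := sum_end_choices hv hy
  have i1 : (nbrsIn G S x ∩ nbrsIn G S v).card = if G.Adj x y then 1 else 0 := by
    have : nbrsIn G S x ∩ nbrsIn G S v = if G.Adj x y then {y} else ∅ := by
      rw [mem_nbrsIn] at hx hy
      ext c
      rw [h]
      split_ifs with hadj <;> simp only [Finset.mem_inter, mem_nbrsIn, Finset.mem_insert,
        Finset.mem_singleton, Finset.notMem_empty, iff_false]
      · constructor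
        · rintro ⟨h1, rfl | rfl⟩
          · exact absurd rfl h1.2.ne
          · rfl
        · rintro rfl
          exact ⟨⟨hy.1, hadj⟩, Or.inr rfl⟩
      · rintro ⟨h1, rfl | rfl⟩
        · exact h1.2.ne rfl
        · exact hadj h1.2
    rw [this]; split_ifs <;> simp
  have i2 : (nbrsIn G S y ∩ nbrsIn G S v).card = if G.Adj x y then 1 else 0 := by
    have : nbrsIn G S y ∩ nbrsIn G S v = if G.Adj x y then {x} else ∅ := by
      rw [mem_nbrsIn] at hx hy
      ext c
      rw [h]
      split_ifs with hadj <;> simp only [Finset.mem_inter, mem_nbrsIn, Finset.mem_insert,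
        Finset.mem_singleton, Finset.notMem_empty, iff_false]
      · constructor
        · rintro ⟨h1, rfl | rfl⟩
          · rfl
          · exact absurd rfl h1.2.ne
        · rintro rfl
          exact ⟨⟨hx.1, hadj.symm⟩, Or.inl rfl⟩
      · rintro ⟨h1, rfl | rfl⟩
        · exact hadj h1.2.symm
        · exact h1.2.ne rfl
    rw [this]; split_ifs <;> simp
  have hmid : ∀ a c : V, c ∈ nbrsIn G S v → a ∈ S → c ∈ S →
      (((nbrsIn G S c).erase v).erase a).card + 1 + (if G.Adj c a then 1 else 0) =
        degIn G S c ∨ a = v := by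
    intro a c hc ha hcS
    by_cases hav : a = v
    · exact Or.inr hav
    left
    rw [mem_nbrsIn] at hc
    rw [degIn, ← Finset.card_erase_add_one (mem_nbrsIn.2 ⟨hv, hc.2.symm⟩)]
    split_ifs with hadj
    · rw [← Finset.card_erase_add_one (a := a) (s := (nbrsIn G S c).erase v)]
      exact Finset.mem_erase.2 ⟨hav, mem_nbrsIn.2 ⟨ha, hadj⟩⟩
    · rw [Finset.erase_eq_of_notMem (a := a), add_zero]
      exact fun h' ↦ hadj (mem_nbrsIn.1 (Finset.mem_of_mem_erase h')).2
  have hxS := (mem_nbrsIn.1 hx).1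
  have hyS := (mem_nbrsIn.1 hy).1
  have m1 := (hmid x y hy hxS hyS).resolve_right (mem_nbrsIn.1 hx).2.ne'
  have m2 := (hmid y x hx hyS hxS).resolve_right (mem_nbrsIn.1 hy).2.ne'
  rw [i1] at e1
  rw [i2] at e2
  have expand : pathsThrough G S v =
      (∑ c ∈ (nbrsIn G S x).erase v, (((nbrsIn G S c).erase x).erase v).card +
        ∑ c ∈ (nbrsIn G S y).erase v, (((nbrsIn G S c).erase y).erase v).card) +
      ((((nbrsIn G S y).erase v).erase x).card + (((nbrsIn G S x).erase v).erase y).card) := by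
    have ex : ({x, y} : Finset V).erase x = {y} := by
      ext; simp only [Finset.mem_erase, Finset.mem_insert, Finset.mem_singleton]; grind
    have ey : ({x, y} : Finset V).erase y = {x} := by
      ext; simp only [Finset.mem_erase, Finset.mem_insert, Finset.mem_singleton]; grind
    rw [pathsThrough, h, Finset.sum_pair hxy, Finset.sum_pair hxy, ex, ey, Finset.sum_singleton,
      Finset.sum_singleton]
  rw [expand]
  simp only [G.adj_comm y x] at m1
  split_ifs at * <;> omega

lemma pathsThrough_of_adj {v x y : V} (hv : v ∈ S) (h : nbrsIn G S v = {x, y})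
    (hxy : G.Adj x y) : pathsThrough G S v + 4 =
      ∑ c ∈ (nbrsIn G S x).erase v, degIn G S c + ∑ c ∈ (nbrsIn G S y).erase v, degIn G S c := by
  classical
  rw [← pathsThrough_of_degIn_two hv hxy.ne h, if_pos hxy]

lemma pathsThrough_of_not_adj {v x y : V} (hv : v ∈ S) (hne : x ≠ y) (h : nbrsIn G S v = {x, y})
    (hxy : ¬ G.Adj x y) : pathsThrough G S v =
      ∑ c ∈ (nbrsIn G S x).erase v, degIn G S c + ∑ c ∈ (nbrsIn G S y).erase v, degIn G S c := by
  classical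
  rw [← pathsThrough_of_degIn_two hv hne h, if_neg hxy, add_zero]

end Gain

/-! ### Vertices of degree at most two and ears -/

section EarAnalysis

variable {V : Type*} [DecidableEq V] {G : SimpleGraph V} {S : Finset V}

lemma NoOuterObstruction.card_common_le (hG : NoOuterObstruction G) {x y : V} (hxy : x ≠ y) :
    (nbrsIn G S x ∩ nbrsIn G S y).card ≤ 2 := by
  by_contra! h
  obtain ⟨a, b, c, ha, hb, hc, hab, hac, hbc⟩ := Finset.two_lt_card_iff.1 h
  simp only [Finset.mem_inter, mem_nbrsIn] at ha hb hc
  exact hG.k23 x y a b c hxy hab hac hbc ha.1.2 hb.1.2 hc.1.2 ha.2.2 hb.2.2 hc.2.2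

/-- A vertex of degree at most one lies on few paths. -/
lemma NoOuterObstruction.pathsThrough_le_of_degIn_le_one (hG : NoOuterObstruction G) {v : V}
    (hv : v ∈ S) (hS : 3 ≤ S.card) (h : degIn G S v ≤ 1) :
    pathsThrough G S v + 10 ≤ 4 * S.card := by
  have : Nonempty V := ⟨v⟩
  obtain ⟨x, hx⟩ := Finset.card_le_one_iff_subset_singleton.1 h
  rcases Finset.subset_singleton_iff.1 hx with h0 | h1
  · rw [pathsThrough_of_degIn_zero h0]; omega
  · have hxv : x ∈ nbrsIn G S v := by simp [h1]
    rw [mem_nbrsIn] at hxv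
    have e := pathsThrough_of_degIn_one hv h1
    have hd : degIn G S v = 1 := by simp [degIn, h1]
    have hx1 : 1 ≤ degIn G S x := degIn_pos hv hxv.2.symm
    have hsum : ∑ c ∈ (nbrsIn G S x).erase v, degIn G S c + (degIn G S x + degIn G S v) ≤
        degSumIn G S := by
      rw [← Finset.sum_pair hxv.2.ne', ← Finset.sum_union]
      · apply Finset.sum_le_sum_of_subset
        intro c hc
        simp only [Finset.mem_union, Finset.mem_erase, mem_nbrsIn, Finset.mem_insert,
          Finset.mem_singleton] at hc
        rcases hc with hc | rfl | rfl
        exacts [hc.2.1, hxv.1, hv]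
      · rw [Finset.disjoint_left]
        intro c hc hc'
        simp only [Finset.mem_erase, mem_nbrsIn, Finset.mem_insert, Finset.mem_singleton] at hc hc'
        rcases hc' with rfl | rfl
        · exact hc.2.2.ne rfl
        · exact hc.1 rfl
    have hc := Finset.card_erase_add_one hv
    have hle := hG.degSumIn_le (S := S.erase v) (by omega)
    have := degSumIn_erase (G := G) hv
    -- The edge bound is applied after deleting the leaf `v`, which gives degree sum at most `4n -
    -- 8` for `S`, better by two than the direct bound.
    omega

/-- The common neighbours, other than `v`, of the two neighbours of a vertex `v`. -/
lemma NoOuterObstruction.third_common (hG : NoOuterObstruction G) {v x y : V} (hv : v ∈ S)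
    (hne : x ≠ y) (h : nbrsIn G S v = {x, y}) :
    (nbrsIn G S x).erase v ∩ (nbrsIn G S y).erase v = ∅ ∨
    ∃ z ∈ S, z ≠ v ∧ G.Adj x z ∧ G.Adj y z ∧
      (nbrsIn G S x).erase v ∩ (nbrsIn G S y).erase v = {z} := by
  have hx : x ∈ nbrsIn G S v := by simp [h]
  have hy : y ∈ nbrsIn G S v := by simp [h]
  rw [mem_nbrsIn] at hx hy
  have hC : ((nbrsIn G S x).erase v ∩ (nbrsIn G S y).erase v).card ≤ 1 := by
    have := hG.card_common_le (S := S) hne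
    have hvm : v ∈ nbrsIn G S x ∩ nbrsIn G S y := by
      simp [hv, hx.2.symm, hy.2.symm]
    rw [← Finset.card_erase_add_one hvm] at this
    rw [Finset.erase_inter, Finset.inter_erase, Finset.erase_idem]
    omega
  rcases Nat.le_one_iff_eq_zero_or_eq_one.1 hC with h0 | h1
  · exact Or.inl (Finset.card_eq_zero.1 h0)
  · obtain ⟨z, hz⟩ := Finset.card_eq_one.1 h1
    have hzm : z ∈ (nbrsIn G S x).erase v ∩ (nbrsIn G S y).erase v := by simp [hz]
    simp only [Finset.mem_inter, Finset.mem_erase, mem_nbrsIn] at hzm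
    exact Or.inr ⟨z, hzm.1.2.1, hzm.1.1, hzm.1.2.2, hzm.2.2.2, hz⟩

/-- A vertex of degree two with non-adjacent neighbours lies on few paths. -/
lemma NoOuterObstruction.pathsThrough_le_of_not_adj (hG : NoOuterObstruction G) {v x y : V}
    (hv : v ∈ S) (hne : x ≠ y) (h : nbrsIn G S v = {x, y}) (hxy : ¬ G.Adj x y) :
    pathsThrough G S v + 10 ≤ 4 * S.card := by
  have hx : x ∈ nbrsIn G S v := by simp [h]
  have hy : y ∈ nbrsIn G S v := by simp [h]
  rw [mem_nbrsIn] at hx hy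
  have e := pathsThrough_of_not_adj hv hne h hxy
  rw [← Finset.sum_union_inter] at e
  set A := (nbrsIn G S x).erase v with hA
  set B := (nbrsIn G S y).erase v with hB
  set R := ((S.erase v) \ {x, y}) \ (A ∪ B) with hR
  have hd : degIn G S v = 2 := by rw [degIn, h, Finset.card_pair hne]
  have hAB : A ∪ B ⊆ (S.erase v) \ {x, y} := by
    intro c hc
    simp only [hA, hB, Finset.mem_union, Finset.mem_erase, mem_nbrsIn, Finset.mem_sdiff,
      Finset.mem_insert, Finset.mem_singleton] at hc ⊢
    refine ⟨by tauto, ?_⟩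
    rintro (rfl | rfl)
    · rcases hc with hc | hc
      · exact hc.2.2.ne rfl
      · exact hxy hc.2.2.symm
    · rcases hc with hc | hc
      · exact hxy hc.2.2
      · exact hc.2.2.ne rfl
  have hsub : ({x, y} : Finset V) ⊆ S.erase v := by
    intro c hc
    simp only [Finset.mem_insert, Finset.mem_singleton] at hc
    rcases hc with rfl | rfl
    · exact Finset.mem_erase.2 ⟨hx.2.ne', hx.1⟩
    · exact Finset.mem_erase.2 ⟨hy.2.ne', hy.1⟩
  have hsum : degSumIn G S = 2 + (degIn G S x + degIn G S y) +
      (∑ c ∈ R, degIn G S c + ∑ c ∈ A ∪ B, degIn G S c) := by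
    rw [Finset.sum_sdiff hAB, degSumIn, ← Finset.add_sum_erase _ _ hv, ← Finset.sum_sdiff hsub,
      Finset.sum_pair hne, hd]
    ring
  have hcard : 3 ≤ S.card := by
    have h1 := Finset.card_le_card hsub
    rw [Finset.card_pair hne] at h1
    have h2 := Finset.card_erase_add_one hv
    omega
  have hle := hG.degSumIn_le (S := S) (by omega)
  have hx1 : 1 ≤ degIn G S x := degIn_pos hv hx.2.symm
  have hy1 : 1 ≤ degIn G S y := degIn_pos hv hy.2.symm
  rcases hG.third_common hv hne h with hC | ⟨z, hzS, hzv, hxz, hyz, hC⟩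
  · rw [hC, Finset.sum_empty] at e
    omega
  · rw [hC, Finset.sum_singleton] at e
    have hvz : ¬ G.Adj z v := by
      intro hadj
      have : z ∈ nbrsIn G S v := mem_nbrsIn.2 ⟨hzS, hadj.symm⟩
      rw [h] at this
      simp only [Finset.mem_insert, Finset.mem_singleton] at this
      rcases this with rfl | rfl
      · exact hxz.ne rfl
      · exact hyz.ne rfl
    have hcover : nbrsIn G S z ⊆ {x, y} ∪
        ((((nbrsIn G S x).erase v).erase z ∪ ((nbrsIn G S y).erase v).erase z) ∪
          (nbrsIn G S z ∩ R)) := by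
      intro u hu
      have hu' := mem_nbrsIn.1 hu
      have huz : u ≠ z := hu'.2.ne'
      have huv : u ≠ v := fun h' ↦ hvz (h' ▸ hu'.2)
      simp only [hR, hA, hB, Finset.mem_union, Finset.mem_insert, Finset.mem_singleton,
        Finset.mem_erase, mem_nbrsIn, Finset.mem_inter, Finset.mem_sdiff]
      tauto
    have hbd : ∀ w, G.Adj w v → G.Adj w z →
        (((nbrsIn G S w).erase v).erase z).card + 2 = degIn G S w := by
      intro w hwv hwz
      rw [degIn, ← Finset.card_erase_add_one (mem_nbrsIn.2 ⟨hv, hwv⟩),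
        ← Finset.card_erase_add_one (a := z) (s := (nbrsIn G S w).erase v)]
      exact Finset.mem_erase.2 ⟨hzv, mem_nbrsIn.2 ⟨hzS, hwz⟩⟩
    have hbx := hbd x hx.2.symm hxz
    have hby := hbd y hy.2.symm hyz
    -- The vertex `z` is counted twice in the path count. Its degree is paid for by the degrees of
    -- `x`, `y` and of the vertices in `R`, none of which enter that count.
    have hdz : degIn G S z ≤ 2 + ((((nbrsIn G S x).erase v).erase z).card +
        (((nbrsIn G S y).erase v).erase z).card + (nbrsIn G S z ∩ R).card) := by
      refine (Finset.card_le_card hcover).trans ((Finset.card_union_le _ _).trans ?_)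
      gcongr
      · exact Finset.card_le_two
      · refine (Finset.card_union_le _ _).trans ?_
        gcongr
        exact Finset.card_union_le _ _
    have hRsum : (nbrsIn G S z ∩ R).card ≤ ∑ c ∈ R, degIn G S c := by
      calc (nbrsIn G S z ∩ R).card = ∑ c ∈ nbrsIn G S z ∩ R, 1 := by simp
        _ ≤ ∑ c ∈ nbrsIn G S z ∩ R, degIn G S c := by
            refine Finset.sum_le_sum fun c hc ↦ ?_
            rw [Finset.mem_inter, mem_nbrsIn] at hc
            exact degIn_pos hzS hc.1.2.symm
        _ ≤ _ := Finset.sum_le_sum_of_subset Finset.inter_subset_right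
    omega

/-- The exact number of paths through a vertex `v` of degree two with adjacent neighbours. -/
lemma pathsThrough_ear {v x y : V} (hv : v ∈ S) (h : nbrsIn G S v = {x, y}) (hxy : G.Adj x y) :
    pathsThrough G S v + 6 +
      ∑ c ∈ (S.erase v) \ ((nbrsIn G S x).erase v ∪ (nbrsIn G S y).erase v), degIn G S c =
    degSumIn G S + ∑ c ∈ (nbrsIn G S x).erase v ∩ (nbrsIn G S y).erase v, degIn G S c := by
  have e := pathsThrough_of_adj hv h hxy
  rw [← Finset.sum_union_inter] at e
  have hd : degIn G S v = 2 := by rw [degIn, h, Finset.card_pair hxy.ne]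
  have hAB : (nbrsIn G S x).erase v ∪ (nbrsIn G S y).erase v ⊆ S.erase v := by
    intro c hc
    simp only [Finset.mem_union, Finset.mem_erase, mem_nbrsIn] at hc ⊢
    tauto
  have hsum : degSumIn G S = 2 + (∑ c ∈ (S.erase v) \ ((nbrsIn G S x).erase v ∪
      (nbrsIn G S y).erase v), degIn G S c +
      ∑ c ∈ (nbrsIn G S x).erase v ∪ (nbrsIn G S y).erase v, degIn G S c) := by
    rw [Finset.sum_sdiff hAB, degSumIn, ← Finset.add_sum_erase _ _ hv, hd]
  omega

lemma not_adj_ear {v x y z : V} (h : nbrsIn G S v = {x, y}) (hz : z ∈ S) (hxz : G.Adj x z)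
    (hyz : G.Adj y z) : ¬ G.Adj v z := by
  intro hadj
  have : z ∈ nbrsIn G S v := mem_nbrsIn.2 ⟨hz, hadj⟩
  rw [h] at this
  simp only [Finset.mem_insert, Finset.mem_singleton] at this
  rcases this with rfl | rfl
  · exact hxz.ne rfl
  · exact hyz.ne rfl

/-- Here the degree of `z` is bounded trivially by `n - 2`, as `z` is not adjacent to `v`. For four
and five vertices this beats the bounds of order `4n`. -/
lemma NoOuterObstruction.pathsThrough_le_small (hG : NoOuterObstruction G) {v x y : V}
    (hv : v ∈ S) (h : nbrsIn G S v = {x, y}) (hxy : G.Adj x y) (hS : 3 ≤ S.card) :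
    pathsThrough G S v + 14 ≤ 5 * S.card := by
  have e := pathsThrough_ear hv h hxy
  have hle := hG.degSumIn_le (S := S) (by omega)
  rcases hG.third_common hv hxy.ne h with hC | ⟨z, hzS, hzv, hxz, hyz, hC⟩
  · rw [hC, Finset.sum_empty] at e
    omega
  · rw [hC, Finset.sum_singleton] at e
    have h1 := degIn_erase_of_not_adj (S := S) (fun h' : G.Adj z v ↦ not_adj_ear h hzS hxz hyz h'.symm)
    have h2 := degIn_le_card_sub_one (G := G) (Finset.mem_erase.2 ⟨hzv, hzS⟩)
    have h3 := Finset.card_erase_add_one hv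
    omega

/-- The vertex `v` has the two adjacent neighbours `x` and `y`, which have the further common
neighbour `z`. -/
structure IsEar (G : SimpleGraph V) (S : Finset V) (v x y z : V) : Prop where
  mem : v ∈ S
  nbrs : nbrsIn G S v = {x, y}
  adj : G.Adj x y
  mem_z : z ∈ S
  ne : z ≠ v
  adj_xz : G.Adj x z
  adj_yz : G.Adj y z

namespace IsEar

variable {v x y z : V}

lemma mem_x (h : IsEar G S v x y z) : x ∈ S ∧ G.Adj v x :=
  mem_nbrsIn.1 (by simp [h.nbrs])

lemma mem_y (h : IsEar G S v x y z) : y ∈ S ∧ G.Adj v y :=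
  mem_nbrsIn.1 (by simp [h.nbrs])

lemma swap (h : IsEar G S v x y z) : IsEar G S v y x z :=
  ⟨h.mem, by rw [h.nbrs, Finset.pair_comm], h.adj.symm, h.mem_z, h.ne, h.adj_yz, h.adj_xz⟩

lemma eq_of_adj (h : IsEar G S v x y z) {u : V} (hu : u ∈ S) (hvu : G.Adj v u) :
    u = x ∨ u = y := by
  have : u ∈ nbrsIn G S v := mem_nbrsIn.2 ⟨hu, hvu⟩
  simpa [h.nbrs] using this

lemma common (h : IsEar G S v x y z) (hG : NoOuterObstruction G) {a : V} (hx : G.Adj x a)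
    (hy : G.Adj y a) : a = v ∨ a = z := by
  by_contra! hcon
  exact hG.k23 x y v z a h.adj.ne h.ne.symm hcon.1.symm hcon.2.symm h.mem_x.2.symm h.adj_xz hx
    h.mem_y.2.symm h.adj_yz hy

/-- The paths from `x` to `y` through `v` and through `z`, together with `x, a, b, y`, form the
subdivided `K₂,₃`. Hence the remaining neighbours of `x` are never joined to those of `y`. -/
lemma no_cross (h : IsEar G S v x y z) (hG : NoOuterObstruction G) {a b : V} (hxa : G.Adj x a)
    (hyb : G.Adj y b) (hab : G.Adj a b) (hav : a ≠ v) (haz : a ≠ z) (hay : a ≠ y)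
    (hbv : b ≠ v) (hbz : b ≠ z) (hbx : b ≠ x) : False :=
  hG.theta x y v z a b h.adj.ne h.ne.symm hav haz hay hbv hbz hbx h.mem_x.2.symm h.adj_xz
    h.mem_y.2.symm h.adj_yz hxa hyb hab

end IsEar

/-- The three kinds of ears that lie on many paths. -/
inductive IsHeavyEar (G : SimpleGraph V) (S : Finset V) (v x y z : V) : Prop
  | three (hdeg : degIn G S z = 3) (hdom : ∀ u ∈ S, G.Adj x u ∨ G.Adj y u)
      (hp : pathsThrough G S v + 9 = 4 * S.card)
  | four (hdeg : degIn G S z = 4) (hdom : ∀ u ∈ S, G.Adj x u ∨ G.Adj y u)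
      (hp : pathsThrough G S v + 8 = 4 * S.card)
  | five (hdeg : degIn G S z = 5) (r : V) (hr : r ∈ S) (hrz : G.Adj z r) (hrdeg : degIn G S r = 2)
      (hrx : ¬ G.Adj x r) (hry : ¬ G.Adj y r)
      (hdom : ∀ u ∈ S, u ≠ r → G.Adj x u ∨ G.Adj y u)
      (hp : pathsThrough G S v + 9 = 4 * S.card)

/-- An ear that lies on many paths is one of the three kinds above, and the graph has the maximum
number of edges. -/
lemma NoOuterObstruction.heavy_ear (hG : NoOuterObstruction G) {v x y : V} (hv : v ∈ S)
    (h : nbrsIn G S v = {x, y}) (hxy : G.Adj x y) (hmin : ∀ u ∈ S, 2 ≤ degIn G S u)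
    (hbig : 4 * S.card ≤ pathsThrough G S v + 9) :
    ∃ z, IsEar G S v x y z ∧ degSumIn G S + 6 = 4 * S.card ∧ IsHeavyEar G S v x y z := by
  have hx : x ∈ nbrsIn G S v := by simp [h]
  have hy : y ∈ nbrsIn G S v := by simp [h]
  have hcard := degIn_le_card_sub_one (G := G) hv
  have hd : degIn G S v = 2 := by rw [degIn, h, Finset.card_pair hxy.ne]
  have e := pathsThrough_ear hv h hxy
  have hle := hG.degSumIn_le (S := S) (by omega)
  rcases hG.third_common hv hxy.ne h with hC | ⟨z, hzS, hzv, hxz, hyz, hC⟩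
  · rw [hC, Finset.sum_empty] at e
    omega
  rw [hC, Finset.sum_singleton] at e
  rw [mem_nbrsIn] at hx hy
  have hear : IsEar G S v x y z := ⟨hv, h, hxy, hzS, hzv, hxz, hyz⟩
  refine ⟨z, hear, ?_⟩
  set R := (S.erase v) \ ((nbrsIn G S x).erase v ∪ (nbrsIn G S y).erase v) with hR
  have memR : ∀ u, u ∈ R ↔ u ∈ S ∧ ¬ (G.Adj x u ∨ G.Adj y u) := by
    intro u
    simp only [hR, Finset.mem_sdiff, Finset.mem_erase, Finset.mem_union, mem_nbrsIn]
    constructor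
    · tauto
    · rintro ⟨h1, h2⟩
      have : u ≠ v := by
        rintro rfl
        exact h2 (Or.inl hx.2.symm)
      tauto
  have hRsum : 2 * R.card ≤ ∑ c ∈ R, degIn G S c := by
    rw [mul_comm, ← smul_eq_mul, ← Finset.sum_const]
    exact Finset.sum_le_sum fun c hc ↦ hmin c ((memR c).1 hc).1
  have hcover : nbrsIn G S z ⊆ (nbrsIn G S z ∩ nbrsIn G S x) ∪ (nbrsIn G S z ∩ nbrsIn G S y) ∪
      (nbrsIn G S z ∩ R) := by
    intro u hu
    have hu' := mem_nbrsIn.1 hu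
    simp only [Finset.mem_union, Finset.mem_inter, memR, mem_nbrsIn]
    tauto
  have c1 := hG.card_common_le (S := S) hxz.ne'
  have c2 := hG.card_common_le (S := S) hyz.ne'
  have hzle : degIn G S z ≤ 4 + (nbrsIn G S z ∩ R).card := by
    refine (Finset.card_le_card hcover).trans ((Finset.card_union_le _ _).trans ?_)
    gcongr
    exact (Finset.card_union_le _ _).trans (by omega)
  have hRle : (nbrsIn G S z ∩ R).card ≤ R.card := Finset.card_le_card Finset.inter_subset_right
  have dom : R = ∅ → ∀ u ∈ S, G.Adj x u ∨ G.Adj y u := by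
    intro h0 u hu
    by_contra hcon
    have : u ∈ R := (memR u).2 ⟨hu, hcon⟩
    simp [h0] at this
  -- At least `4n - 9` paths require `d(z) ≥ 3 + ∑_R d ≥ 3 + 2|R|`. Together with `d(z) ≤ 4 + |R|`
  -- this leaves `|R| ≤ 1`.
  have hz5 : degIn G S z ≤ 5 := by omega
  have hz3 : 3 ≤ degIn G S z := by omega
  have hRc : R.card ≤ 1 := by omega
  rcases Nat.le_one_iff_eq_zero_or_eq_one.1 hRc with h0 | h1
  · rw [Finset.card_eq_zero] at h0
    have hz4 : degIn G S z ≤ 4 := by simpa [h0] using hzle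
    rw [h0, Finset.sum_empty] at e
    obtain ⟨m, hm⟩ := even_degSumIn (G := G) (S := S)
    have hE : degSumIn G S + 6 = 4 * S.card := by omega
    refine ⟨hE, ?_⟩
    obtain h3 | h4 : degIn G S z = 3 ∨ degIn G S z = 4 := by omega
    · exact .three h3 (dom h0) (by omega)
    · exact .four h4 (dom h0) (by omega)
  · have hz : degIn G S z = 5 := by omega
    obtain ⟨r, hr⟩ := Finset.card_eq_one.1 h1
    have hrR : r ∈ R := by simp [hr]
    have hrS := (memR r).1 hrR
    rw [hr, Finset.sum_singleton] at e
    rw [hr] at hRsum hzle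
    simp only [Finset.card_singleton, Finset.sum_singleton] at hRsum
    refine ⟨by omega, .five hz r hrS.1 ?_ (by omega) (fun h' ↦ hrS.2 (Or.inl h'))
      (fun h' ↦ hrS.2 (Or.inr h')) ?_ (by omega)⟩
    · have : (nbrsIn G S z ∩ {r}).Nonempty := by
        rw [← Finset.card_pos]; omega
      obtain ⟨u, hu⟩ := this
      simp only [Finset.mem_inter, Finset.mem_singleton, mem_nbrsIn] at hu
      exact hu.2 ▸ hu.1.2
    · intro u hu hur
      by_contra hcon
      have : u ∈ R := (memR u).2 ⟨hu, hcon⟩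
      rw [hr, Finset.mem_singleton] at this
      exact hur this

end EarAnalysis

/-! ### Structure around the three kinds of heavy ears -/

section Structure

variable {V : Type*} [DecidableEq V] {G : SimpleGraph V} {S : Finset V}

/-- Degree sums add up over a vertex `y` that separates `B` from the rest of `S`. -/
lemma degSumIn_split {B : Finset V} {y : V} (hB : B ⊆ S) (hy : y ∈ S) (hyB : y ∉ B)
    (h : ∀ b ∈ B, ∀ u ∈ S, G.Adj b u → u = y ∨ u ∈ B) :
    degSumIn G S = degSumIn G (insert y B) + degSumIn G (S \ B) := by
  have h1 : ∀ b ∈ B, degIn G S b = degIn G (insert y B) b := by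
    intro b hb
    rw [degIn, degIn]
    congr 1
    ext u
    simp only [mem_nbrsIn, Finset.mem_insert]
    constructor
    · exact fun hu ↦ ⟨h b hb u hu.1 hu.2, hu.2⟩
    · rintro ⟨rfl | hu, hadj⟩
      · exact ⟨hy, hadj⟩
      · exact ⟨hB hu, hadj⟩
  have h2 : ∀ u ∈ (S \ B).erase y, degIn G S u = degIn G (S \ B) u := by
    intro u hu
    simp only [Finset.mem_erase, Finset.mem_sdiff] at hu
    rw [degIn, degIn]
    congr 1
    ext w
    simp only [mem_nbrsIn, Finset.mem_sdiff]
    constructor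
    · refine fun hw ↦ ⟨⟨hw.1, fun hwB ↦ ?_⟩, hw.2⟩
      rcases h w hwB u hu.2.1 hw.2.symm with h' | h'
      · exact hu.1 h'
      · exact hu.2.2 h'
    · exact fun hw ↦ ⟨hw.1.1, hw.2⟩
  have h3 : degIn G S y = degIn G (insert y B) y + degIn G (S \ B) y := by
    rw [degIn, degIn, degIn, ← Finset.card_union_of_disjoint]
    · congr 1
      ext u
      simp only [mem_nbrsIn, Finset.mem_union, Finset.mem_insert, Finset.mem_sdiff]
      constructor
      · intro hu
        by_cases huB : u ∈ B
        · exact Or.inl ⟨Or.inr huB, hu.2⟩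
        · exact Or.inr ⟨⟨hu.1, huB⟩, hu.2⟩
      · rintro (⟨rfl | hu, hadj⟩ | hu)
        · exact absurd rfl hadj.ne
        · exact ⟨hB hu, hadj⟩
        · exact ⟨hu.1.1, hu.2⟩
    · rw [Finset.disjoint_left]
      intro u hu hu'
      simp only [mem_nbrsIn, Finset.mem_insert, Finset.mem_sdiff] at hu hu'
      rcases hu.1 with rfl | hu1
      · exact hu.2.ne rfl
      · exact hu'.1.2 hu1
  have hyS : y ∈ S \ B := Finset.mem_sdiff.2 ⟨hy, hyB⟩
  rw [degSumIn, ← Finset.sum_sdiff hB, ← Finset.add_sum_erase _ _ hyS, Finset.sum_congr rfl h1,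
    Finset.sum_congr rfl h2, h3, degSumIn, degSumIn, Finset.sum_insert hyB,
    ← Finset.add_sum_erase (S \ B) _ hyS]
  ring

lemma degIn_two_nbrs {u x : V} (h : degIn G S u = 2) (hx : x ∈ S) (hux : G.Adj u x) :
    ∃ w ∈ S, w ≠ x ∧ G.Adj u w ∧ nbrsIn G S u = {x, w} := by
  obtain ⟨a, b, hab, hn⟩ := Finset.card_eq_two.1 h
  have hxm : x ∈ nbrsIn G S u := mem_nbrsIn.2 ⟨hx, hux⟩
  have key : ∀ w, w ≠ x → nbrsIn G S u = {x, w} →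
      ∃ w ∈ S, w ≠ x ∧ G.Adj u w ∧ nbrsIn G S u = {x, w} := by
    intro w hw hnw
    have hwm : w ∈ nbrsIn G S u := by simp [hnw]
    rw [mem_nbrsIn] at hwm
    exact ⟨w, hwm.1, hw, hwm.2, hnw⟩
  rw [hn, Finset.mem_insert, Finset.mem_singleton] at hxm
  rcases hxm with rfl | rfl
  · exact key b hab.symm hn
  · exact key a hab (by rw [hn, Finset.pair_comm])

namespace IsEar

variable {v x y z : V}

/-- An ear of the first kind whose vertex `z` has its third neighbour adjacent to `x`: then `x` is
adjacent to everything. -/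
lemma universal_of_three (h : IsEar G S v x y z) (hG : NoOuterObstruction G)
    (hE : degSumIn G S + 6 = 4 * S.card) (hdeg : degIn G S z = 3)
    (hdom : ∀ u ∈ S, G.Adj x u ∨ G.Adj y u) {p : V} (hp : p ∈ S) (hpy : p ≠ y) (hzp : G.Adj z p)
    (hxp : G.Adj x p) : ∀ u ∈ S, u ≠ x → G.Adj x u := by
  classical
  by_contra! hcon
  obtain ⟨b, hb, hbx, hxb⟩ := hcon
  set B := S.filter (fun u ↦ u ≠ x ∧ ¬ G.Adj x u) with hBdef
  have hBsub : B ⊆ S := Finset.filter_subset _ _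
  have hzn : nbrsIn G S z = {x, y, p} := by
    symm
    apply Finset.eq_of_subset_of_card_le
    · intro u hu
      simp only [Finset.mem_insert, Finset.mem_singleton] at hu
      rcases hu with rfl | rfl | rfl
      · exact mem_nbrsIn.2 ⟨h.mem_x.1, h.adj_xz.symm⟩
      · exact mem_nbrsIn.2 ⟨h.mem_y.1, h.adj_yz.symm⟩
      · exact mem_nbrsIn.2 ⟨hp, hzp⟩
    · change degIn G S z ≤ _
      rw [hdeg, Finset.card_eq_three.2 ⟨x, y, p, h.adj.ne, hxp.ne, hpy.symm, rfl⟩]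
  -- An edge from `B` to a neighbour `u ≠ y` of `x` would contradict `no_cross`. The exceptions `u =
  -- v` and `u = z` are excluded because all their neighbours are known.
  have hsep : ∀ b ∈ B, ∀ u ∈ S, G.Adj b u → u = y ∨ u ∈ B := by
    intro b hb u hu hbu
    simp only [hBdef, Finset.mem_filter] at hb ⊢
    by_contra! hcon
    have hyb := (hdom b hb.1).resolve_left hb.2.2
    have hux : u ≠ x := by
      rintro rfl
      exact hb.2.2 hbu.symm
    have hxu : G.Adj x u := by
      by_contra h'
      exact h' (hcon.2 hu hux)
    have hbv : b ≠ v := by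
      rintro rfl
      exact hb.2.2 h.mem_x.2.symm
    have hbz : b ≠ z := by
      rintro rfl
      exact hb.2.2 h.adj_xz
    have hby : b ≠ y := hyb.ne'
    refine h.no_cross hG hxu hyb hbu.symm ?_ ?_ hcon.1 hbv hbz hb.2.1
    · rintro rfl
      rcases h.eq_of_adj hb.1 hbu.symm with h' | h'
      · exact hb.2.1 h'
      · exact hby h'
    · rintro rfl
      have : b ∈ nbrsIn G S u := mem_nbrsIn.2 ⟨hb.1, hbu.symm⟩
      rw [hzn] at this
      simp only [Finset.mem_insert, Finset.mem_singleton] at this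
      rcases this with rfl | rfl | rfl
      · exact hb.2.1 rfl
      · exact hby rfl
      · exact hb.2.2 hxp
  have hyB : y ∉ B := by
    simp only [hBdef, Finset.mem_filter, not_and, not_not]
    exact fun _ _ ↦ h.adj
  have hxB : x ∉ B := by simp [hBdef]
  have hbB : b ∈ B := by
    simp only [hBdef, Finset.mem_filter]
    exact ⟨hb, hbx, hxb⟩
  have hsplit := degSumIn_split hBsub h.mem_y.1 hyB hsep
  have c1 : (insert y B).card = B.card + 1 := Finset.card_insert_of_notMem hyB
  have c2 : (S \ B).card + B.card = S.card := Finset.card_sdiff_add_card_eq_card hBsub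
  have c3 : 0 < B.card := Finset.card_pos.2 ⟨b, hbB⟩
  have c4 : 2 ≤ (S \ B).card := by
    rw [← Finset.card_pair h.adj.ne]
    apply Finset.card_le_card
    intro u hu
    simp only [Finset.mem_insert, Finset.mem_singleton] at hu
    rcases hu with rfl | rfl
    · exact Finset.mem_sdiff.2 ⟨h.mem_x.1, hxB⟩
    · exact Finset.mem_sdiff.2 ⟨h.mem_y.1, hyB⟩
  -- Thus `y` is a cut vertex. The edge bounds of the two sides add up to a degree sum of at most
  -- `4n - 8`, short of the maximum.
  have l1 := hG.degSumIn_le (S := insert y B) (by omega)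
  have l2 := hG.degSumIn_le (S := S \ B) c4
  omega

/-- The third neighbour of `z` is adjacent to `x` or to `y`; that vertex is the universal one. -/
lemma exists_universal_of_three (h : IsEar G S v x y z) (hG : NoOuterObstruction G)
    (hE : degSumIn G S + 6 = 4 * S.card) (hdeg : degIn G S z = 3)
    (hdom : ∀ u ∈ S, G.Adj x u ∨ G.Adj y u) :
    ∃ c ∈ S, c ≠ v ∧ ∀ u ∈ S, u ≠ c → G.Adj c u := by
  obtain ⟨p, hp, hp'⟩ : ∃ p ∈ nbrsIn G S z, p ∉ ({x, y} : Finset V) := by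
    apply Finset.exists_mem_notMem_of_card_lt_card
    refine lt_of_le_of_lt Finset.card_le_two ?_
    change 2 < degIn G S z
    omega
  rw [mem_nbrsIn] at hp
  simp only [Finset.mem_insert, Finset.mem_singleton, not_or] at hp'
  rcases hdom p hp.1 with hxp | hyp
  · exact ⟨x, h.mem_x.1, h.mem_x.2.ne', h.universal_of_three hG hE hdeg hdom hp.1 hp'.2 hp.2 hxp⟩
  · exact ⟨y, h.mem_y.1, h.mem_y.2.ne', h.swap.universal_of_three hG hE hdeg
      (fun u hu ↦ (hdom u hu).symm) hp.1 hp'.1 hp.2 hyp⟩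

/-- If `z` has four neighbours that are adjacent to `x` or `y`, then these are `x`, `y`, a vertex
`p` adjacent to `x` only, and a vertex `q` adjacent to `y` only. -/
lemma exists_sides (h : IsEar G S v x y z) (hG : NoOuterObstruction G) {T : Finset V}
    (hT : T ⊆ nbrsIn G S z) (hTc : T.card = 4) (hdom : ∀ u ∈ T, G.Adj x u ∨ G.Adj y u) :
    ∃ p ∈ S, ∃ q ∈ S, G.Adj z p ∧ G.Adj z q ∧ G.Adj x p ∧ G.Adj y q ∧ ¬ G.Adj y p ∧
      ¬ G.Adj x q ∧ p ≠ y ∧ q ≠ x ∧ T = {x, y, p, q} := by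
  have c1 := hG.card_common_le (S := S) h.adj_xz.ne'
  have c2 := hG.card_common_le (S := S) h.adj_yz.ne'
  have hcover : T ⊆ (nbrsIn G S z ∩ nbrsIn G S x) ∪ (nbrsIn G S z ∩ nbrsIn G S y) := by
    intro u hu
    have hu' := mem_nbrsIn.1 (hT hu)
    have := hdom u hu
    simp only [Finset.mem_union, Finset.mem_inter, mem_nbrsIn]
    tauto
  have hu := Finset.card_union_add_card_inter (nbrsIn G S z ∩ nbrsIn G S x)
    (nbrsIn G S z ∩ nbrsIn G S y)
  have hle := Finset.card_le_card hcover
  -- Four vertices are covered by two sets of size at most two, so both have size two and they are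
  -- disjoint. One contains `y` and the other `x`.
  have hTeq := Finset.eq_of_subset_of_card_le hcover (by omega)
  have hint : (nbrsIn G S z ∩ nbrsIn G S x) ∩ (nbrsIn G S z ∩ nbrsIn G S y) = ∅ :=
    Finset.card_eq_zero.1 (by omega)
  have hno : ∀ u ∈ S, G.Adj z u → G.Adj x u → G.Adj y u → False := by
    intro u hu h1 h2 h3
    have : u ∈ (nbrsIn G S z ∩ nbrsIn G S x) ∩ (nbrsIn G S z ∩ nbrsIn G S y) := by
      simp [hu, h1, h2, h3]
    simp [hint] at this
  have hym : y ∈ nbrsIn G S z ∩ nbrsIn G S x := by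
    simp [h.mem_y.1, h.adj_yz.symm, h.adj]
  have hxm : x ∈ nbrsIn G S z ∩ nbrsIn G S y := by
    simp [h.mem_x.1, h.adj_xz.symm, h.adj.symm]
  obtain ⟨p, hp, hpy⟩ := Finset.exists_mem_ne (by omega : 1 < (nbrsIn G S z ∩ nbrsIn G S x).card) y
  obtain ⟨q, hq, hqx⟩ := Finset.exists_mem_ne (by omega : 1 < (nbrsIn G S z ∩ nbrsIn G S y).card) x
  have e1 : {y, p} = nbrsIn G S z ∩ nbrsIn G S x := by
    apply Finset.eq_of_subset_of_card_le
    · intro u hu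
      simp only [Finset.mem_insert, Finset.mem_singleton] at hu
      rcases hu with rfl | rfl <;> assumption
    · rw [Finset.card_pair hpy.symm]; exact c1
  have e2 : {x, q} = nbrsIn G S z ∩ nbrsIn G S y := by
    apply Finset.eq_of_subset_of_card_le
    · intro u hu
      simp only [Finset.mem_insert, Finset.mem_singleton] at hu
      rcases hu with rfl | rfl <;> assumption
    · rw [Finset.card_pair hqx.symm]; exact c2
  have hTset : T = {x, y, p, q} := by
    rw [hTeq, ← e1, ← e2]
    ext u
    simp only [Finset.mem_union, Finset.mem_insert, Finset.mem_singleton]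
    tauto
  simp only [Finset.mem_inter, mem_nbrsIn] at hp hq
  exact ⟨p, hp.1.1, q, hq.1.1, hp.1.2, hq.1.2, hp.2.2, hq.2.2,
    fun h' ↦ hno p hp.1.1 hp.1.2 hp.2.2 h', fun h' ↦ hno q hq.1.1 hq.1.2 h' hq.2.2, hpy, hqx, hTset⟩

/-- An ear of the second kind, with a further vertex next to `x`: there is another vertex on few
paths. -/
lemma exists_light_of_four (h : IsEar G S v x y z) (hG : NoOuterObstruction G)
    (hmin : ∀ u ∈ S, 2 ≤ degIn G S u) (hdeg : degIn G S z = 4)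
    (hdom : ∀ u ∈ S, G.Adj x u ∨ G.Adj y u) {p q : V} (hp : p ∈ S) (hq : q ∈ S)
    (hzq : G.Adj z q) (hxp : G.Adj x p) (hyq : G.Adj y q) (hyp : ¬ G.Adj y p)
    (hxq : ¬ G.Adj x q) (hpy : p ≠ y) (hqx : q ≠ x) (hzn : nbrsIn G S z = {x, y, p, q}) {a : V}
    (ha : a ∈ S) (hxa : G.Adj x a) (hav : a ≠ v) (hay : a ≠ y) (haz : a ≠ z) (hap : a ≠ p) :
    ∃ u ∈ S, pathsThrough G S u + 10 ≤ 4 * S.card := by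
  classical
  have hqv : q ≠ v := by
    rintro rfl
    exact hxq h.mem_x.2.symm
  have hpv : p ≠ v := by
    rintro rfl
    exact hyp h.mem_y.2.symm
  have hpz : p ≠ z := by
    rintro rfl
    exact hyp h.adj_yz
  have hqz : q ≠ z := hzq.ne'
  set A := S.filter (fun u ↦ G.Adj x u ∧ u ≠ v ∧ u ≠ y ∧ u ≠ z) with hA
  have memA : ∀ u, u ∈ A ↔ u ∈ S ∧ G.Adj x u ∧ u ≠ v ∧ u ≠ y ∧ u ≠ z := by simp [hA]
  have hpA : p ∈ A := (memA p).2 ⟨hp, hxp, hpv, hpy, hpz⟩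
  have haA : a ∈ A := (memA a).2 ⟨ha, hxa, hav, hay, haz⟩
  have hxA : x ∉ A := fun h' ↦ ((memA x).1 h').2.1.ne rfl
  -- Apart from `p`, which is adjacent to `z`, the further neighbours of `x` see nothing outside `A`
  -- and `x`. Degrees inside that set are therefore true degrees.
  have hclosed : ∀ u ∈ A, u ≠ p → ∀ w ∈ S, G.Adj u w → w ∈ insert x A := by
    intro u hu hup w hw huw
    rw [memA] at hu
    rw [Finset.mem_insert, memA]
    by_contra! hcon
    have hwv : w ≠ v := by
      rintro rfl
      rcases h.eq_of_adj hu.1 huw.symm with h' | h'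
      · exact hu.2.1.ne h'.symm
      · exact hu.2.2.2.1 h'
    have hwy : w ≠ y := by
      rintro rfl
      rcases h.common hG hu.2.1 huw.symm with h' | h'
      · exact hu.2.2.1 h'
      · exact hu.2.2.2.2 h'
    have hwz : w ≠ z := by
      rintro rfl
      have : u ∈ nbrsIn G S w := mem_nbrsIn.2 ⟨hu.1, huw.symm⟩
      rw [hzn] at this
      simp only [Finset.mem_insert, Finset.mem_singleton] at this
      rcases this with rfl | rfl | rfl | rfl
      · exact hu.2.1.ne rfl
      · exact hu.2.2.2.1 rfl
      · exact hup rfl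
      · exact hxq hu.2.1
    rcases hdom w hw with hxw | hyw
    · exact hwz (hcon.2 hw hxw hwv hwy)
    · exact h.no_cross hG hu.2.1 hyw huw hu.2.2.1 hu.2.2.2.2 hu.2.2.2.1 hwv hwz hcon.1
  have hlowdeg : ∀ u ∈ A, u ≠ p → degIn G S u = degIn G (insert x A) u := by
    intro u hu hup
    rw [degIn, degIn]
    congr 1
    ext w
    simp only [mem_nbrsIn]
    constructor
    · exact fun hw ↦ ⟨hclosed u hu hup w hw.1 hw.2, hw.2⟩
    · rintro ⟨hw, hadj⟩
      rw [Finset.mem_insert, memA] at hw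
      rcases hw with rfl | hw
      · exact ⟨h.mem_x.1, hadj⟩
      · exact ⟨hw.1, hadj⟩
  obtain ⟨u, huA, hup, hu2⟩ : ∃ u ∈ A, u ≠ p ∧ degIn G S u ≤ 2 := by
    -- The low vertex has to avoid `p`, hence the form of `exists_low_ne`. If it is `x` itself, then
    -- `A` has at most two elements and `a` will do.
    obtain ⟨u, huT, hup, -, hu2⟩ := hG.exists_low_ne (S := insert x A)
      (Finset.mem_insert_of_mem hpA) (Finset.mem_insert_self x A) hxp.symm
    rw [Finset.mem_insert] at huT
    rcases huT with rfl | huA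
    · have hall : nbrsIn G (insert u A) u = A := by
        ext w
        simp only [mem_nbrsIn, Finset.mem_insert, memA]
        constructor
        · rintro ⟨rfl | hw, hadj⟩
          · exact absurd rfl hadj.ne
          · exact hw
        · exact fun hw ↦ ⟨Or.inr hw, hw.2.1⟩
      rw [degIn, hall] at hu2
      refine ⟨a, haA, hap, ?_⟩
      rw [hlowdeg a haA hap]
      have := degIn_le_card_sub_one (G := G) (Finset.mem_insert_of_mem haA : a ∈ insert u A)
      rw [Finset.card_insert_of_notMem hxA] at this
      omega
    · exact ⟨u, huA, hup, by rw [hlowdeg u huA hup]; exact hu2⟩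
  have huA' := (memA u).1 huA
  refine ⟨u, huA'.1, ?_⟩
  obtain ⟨b, hbS, hbx, hub, hun⟩ := degIn_two_nbrs
    (le_antisymm hu2 (hmin u huA'.1)) h.mem_x.1 huA'.2.1.symm
  have hbA := hclosed u huA hup b hbS hub
  rw [Finset.mem_insert, memA] at hbA
  replace hbA := hbA.resolve_left hbx
  have hbq : ¬ G.Adj b q := fun h' ↦ h.no_cross hG hbA.2.1 hyq h' hbA.2.2.1 hbA.2.2.2.2
    hbA.2.2.2.1 hqv hqz hqx
  by_contra! hlt
  -- If `u` were heavy, its ear on `x b` would leave `q` undominated, so it is of the third kind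
  -- with exceptional vertex `q`. Its vertex `z'` then gives the forbidden path `x, z', q, y`.
  obtain ⟨z', hear, -, hheavy⟩ := hG.heavy_ear huA'.1 hun hbA.2.1 hmin (by omega)
  have hnd : ∀ w ∈ S, (∀ s ∈ S, G.Adj x s ∨ G.Adj w s) → G.Adj w q := fun w _ hw ↦
    (hw q hq).resolve_left hxq
  cases hheavy with
  | three _ hd _ => exact hbq (hnd b hbS hd)
  | four _ hd _ => exact hbq (hnd b hbS hd)
  | five hd5 r hr hrz' _ hrx hrb hd _ =>
    have hqr : q = r := by
      by_contra hne
      exact hbq ((hd q hq hne).resolve_left hxq)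
    subst hqr
    have hxz' := hear.adj_xz
    have hbz' := hear.adj_yz
    have hz'v : z' ≠ v := by
      rintro rfl
      rcases h.eq_of_adj hbS hbz'.symm with h' | h'
      · exact hbx h'
      · exact hbA.2.2.2.1 h'
    have hz'y : z' ≠ y := by
      rintro rfl
      rcases h.common hG hbA.2.1 hbz'.symm with h' | h'
      · exact hbA.2.2.1 h'
      · exact hbA.2.2.2.2 h'
    have hz'z : z' ≠ z := by
      rintro rfl
      omega
    exact h.no_cross hG hxz' hyq hrz' hz'v hz'z hz'y hqv hqz hqx

/-- An ear of the third kind whose exceptional vertex `r` is attached to `p`: only on eight vertices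
can `r` lie on many paths. -/
lemma light_of_five (h : IsEar G S v x y z) (hG : NoOuterObstruction G)
    (hmin : ∀ u ∈ S, 2 ≤ degIn G S u) (hS : S.card ≠ 8) {r p q : V} (hr : r ∈ S)
    (hrx : ¬ G.Adj x r) (hry : ¬ G.Adj y r) (hdom : ∀ u ∈ S, u ≠ r → G.Adj x u ∨ G.Adj y u)
    (hp : p ∈ S) (hq : q ∈ S) (hzp : G.Adj z p) (hzq : G.Adj z q) (hxp : G.Adj x p)
    (hyq : G.Adj y q) (hyp : ¬ G.Adj y p) (hxq : ¬ G.Adj x q) (hpy : p ≠ y) (hqx : q ≠ x)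
    (hzn : nbrsIn G S z = {x, y, p, q, r}) (hrn : nbrsIn G S r = {z, p}) :
    pathsThrough G S r + 10 ≤ 4 * S.card := by
  by_contra! hlt
  have hqv : q ≠ v := by
    rintro rfl
    exact hxq h.mem_x.2.symm
  have hpv : p ≠ v := by
    rintro rfl
    exact hyp h.mem_y.2.symm
  have hqz : q ≠ z := hzq.ne'
  have hrx' : r ≠ x := by
    rintro rfl
    exact hry h.adj.symm
  have hqr : q ≠ r := by
    rintro rfl
    exact hry hyq
  obtain ⟨z', hear, -, hheavy⟩ := hG.heavy_ear hr hrn hzp hmin (by omega)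
  have hzv : ¬ G.Adj z v := fun h' ↦ not_adj_ear h.nbrs h.mem_z h.adj_xz h.adj_yz h'.symm
  have hpv' : ¬ G.Adj p v := by
    intro h'
    rcases h.eq_of_adj hp h'.symm with h2 | h2
    · exact hxp.ne h2.symm
    · exact hpy h2
  -- A heavy ear at `r` would rest on the edge `z p`, which does not dominate `v`. Only the third
  -- kind, with `v` as its exceptional vertex, remains.
  have hnv : ¬ ∀ u ∈ S, G.Adj z u ∨ G.Adj p u := by
    intro h'
    rcases h' v h.mem with h2 | h2
    · exact hzv h2
    · exact hpv' h2
  cases hheavy with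
  | three _ hd _ => exact hnv hd
  | four _ hd _ => exact hnv hd
  | five hd5 s hs hsz' _ _ _ hd _ =>
    have hvs : v = s := by
      by_contra hne
      rcases hd v h.mem hne with h2 | h2
      · exact hzv h2
      · exact hpv' h2
    subst hvs
    have hz'x : z' = x := by
      rcases h.eq_of_adj hear.mem_z hsz'.symm with h' | h'
      · exact h'
      · rw [h'] at hear
        exact absurd hear.adj_yz.symm hyp
    rw [hz'x] at hd5
    -- The new ear has `x` as its third vertex, so `x` has degree five. Everything else except `q`
    -- and `r` is adjacent to `x`, which makes eight vertices.
    have hSeq : S = nbrsIn G S x ∪ {x, q, r} := by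
      ext u
      simp only [Finset.mem_union, mem_nbrsIn, Finset.mem_insert, Finset.mem_singleton]
      constructor
      · intro hu
        by_contra! hcon
        have hxu : ¬ G.Adj x u := hcon.1 hu
        have huv : u ≠ v := by
          rintro rfl
          exact hxu h.mem_x.2.symm
        have hyu := (hdom u hu hcon.2.2.2).resolve_left hxu
        rcases hd u hu huv with h' | h'
        · have : u ∈ nbrsIn G S z := mem_nbrsIn.2 ⟨hu, h'⟩
          rw [hzn] at this
          simp only [Finset.mem_insert, Finset.mem_singleton] at this
          rcases this with rfl | rfl | rfl | rfl | rfl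
          · exact hcon.2.1 rfl
          · exact hyu.ne rfl
          · exact hxu hxp
          · exact hcon.2.2.1 rfl
          · exact hcon.2.2.2 rfl
        · refine h.no_cross hG hxp hyu h' hpv hzp.ne' hpy huv ?_ hcon.2.1
          rintro rfl
          exact hxu h.adj_xz
      · rintro (hu | rfl | rfl | rfl)
        exacts [hu.1, h.mem_x.1, hq, hr]
    have hc : S.card = 8 := by
      rw [hSeq, Finset.card_union_of_disjoint, Finset.card_eq_three.2 ⟨x, q, r, hqx.symm, hrx'.symm,
        hqr, rfl⟩]
      · change degIn G S x + 3 = 8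
        omega
      · rw [Finset.disjoint_left]
        intro u hu hu'
        rw [mem_nbrsIn] at hu
        simp only [Finset.mem_insert, Finset.mem_singleton] at hu'
        rcases hu' with rfl | rfl | rfl
        · exact hu.2.ne rfl
        · exact hxq hu.2
        · exact hrx hu.2
    exact hS hc

end IsEar

end Structure

/-! ### Induction on the number of vertices -/

section Extremal

variable {V : Type*} [DecidableEq V] {G : SimpleGraph V} {S : Finset V}

lemma NoOuterObstruction.light_or_adj (hG : NoOuterObstruction G) (hS : 3 ≤ S.card) {v : V}
    (hv : v ∈ S) (h : degIn G S v ≤ 2) :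
    pathsThrough G S v + 10 ≤ 4 * S.card ∨ ∃ x y, nbrsIn G S v = {x, y} ∧ G.Adj x y := by
  rcases Nat.lt_or_eq_of_le h with h1 | h2
  · exact Or.inl (hG.pathsThrough_le_of_degIn_le_one hv hS (by omega))
  · obtain ⟨x, y, hxy, hn⟩ := Finset.card_eq_two.1 h2
    by_cases hadj : G.Adj x y
    · exact Or.inr ⟨x, y, hn, hadj⟩
    · exact Or.inl (hG.pathsThrough_le_of_not_adj hv hxy hn hadj)

/-- If no vertex lies on few paths, then there is an ear lying on many paths. -/
lemma NoOuterObstruction.exists_heavy_ear (hG : NoOuterObstruction G) (hS : 3 ≤ S.card)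
    (hno : ∀ u ∈ S, 4 * S.card ≤ pathsThrough G S u + 9) :
    (∀ u ∈ S, 2 ≤ degIn G S u) ∧ degSumIn G S + 6 = 4 * S.card ∧
      ∃ v x y z, IsEar G S v x y z ∧ IsHeavyEar G S v x y z := by
  have hmin : ∀ u ∈ S, 2 ≤ degIn G S u := by
    intro u hu
    by_contra hlt
    have := hG.pathsThrough_le_of_degIn_le_one hu hS (by omega)
    have := hno u hu
    omega
  obtain ⟨v, hv, hv2⟩ := hG.exists_low (S := S) (Finset.card_pos.1 (by omega))
  have h1 := hno v hv
  rcases hG.light_or_adj hS hv hv2 with h | ⟨x, y, hn, hxy⟩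
  · omega
  · obtain ⟨z, hear, hE, hheavy⟩ := hG.heavy_ear hv hn hxy hmin h1
    exact ⟨hmin, hE, v, x, y, z, hear, hheavy⟩

lemma IsEar.sides_of_four {v x y z : V} (h : IsEar G S v x y z) (hG : NoOuterObstruction G)
    (hdeg : degIn G S z = 4) (hdom : ∀ u ∈ S, G.Adj x u ∨ G.Adj y u) :
    ∃ p ∈ S, ∃ q ∈ S, G.Adj z p ∧ G.Adj z q ∧ G.Adj x p ∧ G.Adj y q ∧ ¬ G.Adj y p ∧
      ¬ G.Adj x q ∧ p ≠ y ∧ q ≠ x ∧ nbrsIn G S z = {x, y, p, q} :=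
  h.exists_sides hG subset_rfl hdeg fun u hu ↦ hdom u (mem_nbrsIn.1 hu).1

/-- Six vertices are accounted for by the ear and the neighbours of `z`. A seventh lies beyond `x`
or beyond `y`, and the two cases are symmetric. -/
lemma IsEar.light_of_four {v x y z : V} (h : IsEar G S v x y z) (hG : NoOuterObstruction G)
    (hmin : ∀ u ∈ S, 2 ≤ degIn G S u) (hS : 7 ≤ S.card) (hdeg : degIn G S z = 4)
    (hdom : ∀ u ∈ S, G.Adj x u ∨ G.Adj y u) :
    ∃ u ∈ S, pathsThrough G S u + 10 ≤ 4 * S.card := by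
  obtain ⟨p, hp, q, hq, hzp, hzq, hxp, hyq, hyp, hxq, hpy, hqx, hzn⟩ :=
    h.sides_of_four hG hdeg hdom
  obtain ⟨a, ha, ha'⟩ : ∃ a ∈ S, a ∉ ({v, x, y, z, p, q} : Finset V) := by
    apply Finset.exists_mem_notMem_of_card_lt_card
    exact lt_of_le_of_lt Finset.card_le_six hS
  simp only [Finset.mem_insert, Finset.mem_singleton, not_or] at ha'
  obtain ⟨hav, hax, hay, haz, hap, haq⟩ := ha'
  rcases hdom a ha with hxa | hya
  · exact h.exists_light_of_four hG hmin hdeg hdom hp hq hzq hxp hyq hyp hxq hpy hqx hzn ha hxa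
      hav hay haz hap
  · refine h.swap.exists_light_of_four hG hmin hdeg (fun u hu ↦ (hdom u hu).symm) hq hp hzp hyq hxp
      hxq hyp hqx hpy ?_ ha hya hav hax haz haq
    rw [hzn]
    ext u
    simp only [Finset.mem_insert, Finset.mem_singleton]
    tauto

/-- The second neighbour of `r` is either not adjacent to `z`, when the bound for non-adjacent
neighbours applies, or it is one of `p`, `q`. -/
lemma IsEar.light_of_exceptional {v x y z r : V} (h : IsEar G S v x y z)
    (hG : NoOuterObstruction G) (hmin : ∀ u ∈ S, 2 ≤ degIn G S u)
    (hS8 : S.card ≠ 8) (hdeg : degIn G S z = 5) (hr : r ∈ S) (hrz : G.Adj z r)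
    (hrdeg : degIn G S r = 2) (hrx : ¬ G.Adj x r) (hry : ¬ G.Adj y r)
    (hdom : ∀ u ∈ S, u ≠ r → G.Adj x u ∨ G.Adj y u) :
    pathsThrough G S r + 10 ≤ 4 * S.card := by
  have hrm : r ∈ nbrsIn G S z := mem_nbrsIn.2 ⟨hr, hrz⟩
  obtain ⟨p, hp, q, hq, hzp, hzq, hxp, hyq, hyp, hxq, hpy, hqx, hT⟩ :=
    h.exists_sides hG (T := (nbrsIn G S z).erase r) (Finset.erase_subset _ _)
      (by rw [Finset.card_erase_of_mem hrm]; change degIn G S z - 1 = 4; omega)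
      (fun u hu ↦ hdom u (mem_nbrsIn.1 (Finset.mem_of_mem_erase hu)).1 (Finset.ne_of_mem_erase hu))
  have hzn : nbrsIn G S z = {x, y, p, q, r} := by
    rw [← Finset.insert_erase hrm, hT]
    ext u
    simp only [Finset.mem_insert, Finset.mem_singleton]
    tauto
  obtain ⟨s, hs, hsz, hrs, hrn⟩ := degIn_two_nbrs hrdeg h.mem_z hrz.symm
  by_cases hzs : G.Adj z s
  · have hsm : s ∈ nbrsIn G S z := mem_nbrsIn.2 ⟨hs, hzs⟩
    rw [hzn] at hsm
    simp only [Finset.mem_insert, Finset.mem_singleton] at hsm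
    rcases hsm with rfl | rfl | rfl | rfl | rfl
    · exact absurd hrs.symm hrx
    · exact absurd hrs.symm hry
    · exact h.light_of_five hG hmin hS8 hr hrx hry hdom hs hq hzp hzq hxp hyq hyp hxq hpy hqx hzn hrn
    · refine h.swap.light_of_five hG hmin hS8 hr hry hrx (fun u hu hur ↦ (hdom u hu hur).symm) hs hp
        hzq hzp hyq hxp hxq hyp hqx hpy ?_ hrn
      rw [hzn]
      ext u
      simp only [Finset.mem_insert, Finset.mem_singleton]
      tauto
    · exact absurd rfl hrs.ne
  · exact hG.pathsThrough_le_of_not_adj hr hsz.symm hrn hzs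

/-- If no vertex lies on few paths, then some vertex is adjacent to all others and the number of
edges is maximum. -/
lemma NoOuterObstruction.universal_of_no_light (hG : NoOuterObstruction G) (hS : 7 ≤ S.card)
    (hS8 : S.card ≠ 8) (hno : ∀ u ∈ S, 4 * S.card ≤ pathsThrough G S u + 9) :
    (∃ c ∈ S, (∀ u ∈ S, u ≠ c → G.Adj c u) ∧
      ∃ v ∈ S, v ≠ c ∧ pathsThrough G S v + 9 = 4 * S.card) ∧
    degSumIn G S + 6 = 4 * S.card := by
  obtain ⟨hmin, hE, v, x, y, z, hear, hheavy⟩ := hG.exists_heavy_ear (by omega) hno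
  refine ⟨?_, hE⟩
  cases hheavy with
  | three hdeg hdom hp =>
    obtain ⟨c, hc, hcv, huniv⟩ := hear.exists_universal_of_three hG hE hdeg hdom
    exact ⟨c, hc, huniv, v, hear.mem, hcv.symm, hp⟩
  | four hdeg hdom hp =>
    obtain ⟨u, hu, hlt⟩ := hear.light_of_four hG hmin hS hdeg hdom
    have := hno u hu
    omega
  | five hdeg r hr hrz hrdeg hrx hry hdom hp =>
    have := hear.light_of_exceptional hG hmin hS8 hdeg hr hrz hrdeg hrx hry hdom
    have := hno r hr
    omega

/-- Some vertex lies on at most `4 n - 9` paths. -/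
lemma NoOuterObstruction.exists_pathsThrough_le (hG : NoOuterObstruction G) (hS : 7 ≤ S.card) :
    ∃ u ∈ S, pathsThrough G S u + 9 ≤ 4 * S.card := by
  by_contra! hcon
  obtain ⟨hmin, hE, v, x, y, z, hear, hheavy⟩ := hG.exists_heavy_ear (S := S) (by omega)
    (fun u hu ↦ (hcon u hu).le)
  have := hcon v hear.mem
  cases hheavy with
  | three hdeg hdom hp => omega
  | four hdeg hdom hp =>
    obtain ⟨u, hu, hlt⟩ := hear.light_of_four hG hmin hS hdeg hdom
    have := hcon u hu
    omega
  | five hdeg r hr hrz hrdeg hrx hry hdom hp => omega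

/-- A universal vertex adjacent to the tip of an ear must be `x` or `y`. In an ear of the second
kind both of these miss some vertex, so `4n - 8` does not occur. -/
lemma NoOuterObstruction.exists_pathsThrough_le_of_universal (hG : NoOuterObstruction G)
    (hS : 4 ≤ S.card) {c : V} (hc : c ∈ S) (huniv : ∀ u ∈ S, u ≠ c → G.Adj c u) :
    ∃ u ∈ S, u ≠ c ∧ pathsThrough G S u + 9 ≤ 4 * S.card := by
  have hdc : 3 ≤ degIn G S c := by
    have : nbrsIn G S c = S.erase c := by
      ext u
      rw [mem_nbrsIn, Finset.mem_erase]
      exact ⟨fun hu ↦ ⟨hu.2.ne', hu.1⟩, fun hu ↦ ⟨hu.2, huniv u hu.2 hu.1⟩⟩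
    rw [degIn, this, Finset.card_erase_of_mem hc]
    omega
  have hne : ∀ u, degIn G S u ≤ 2 → u ≠ c := by
    rintro u hu rfl
    omega
  by_contra! hcon
  have hmin : ∀ u ∈ S, 2 ≤ degIn G S u := by
    intro u hu
    by_contra hlt
    have := hG.pathsThrough_le_of_degIn_le_one hu (by omega) (by omega)
    have := hcon u hu (hne u (by omega))
    omega
  obtain ⟨v, hv, hv2⟩ := hG.exists_low (S := S) ⟨c, hc⟩
  have h1 := hcon v hv (hne v hv2)
  rcases hG.light_or_adj (by omega) hv hv2 with h | ⟨x, y, hn, hxy⟩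
  · omega
  · obtain ⟨z, hear, hE, hheavy⟩ := hG.heavy_ear hv hn hxy hmin h1.le
    cases hheavy with
    | three hdeg hdom hp => omega
    | four hdeg hdom hp =>
      obtain ⟨p, hp, q, hq, -, -, -, -, hyp, hxq, hpy, hqx, -⟩ := hear.sides_of_four hG hdeg hdom
      rcases hear.eq_of_adj hc (huniv v hv (hne v hv2)).symm with rfl | rfl
      · exact hxq (huniv q hq hqx)
      · exact hyp (huniv p hp hpy)
    | five hdeg r hr hrz hrdeg hrx hry hdom hp => omega

lemma NoOuterObstruction.exists_pathsThrough_le_small (hG : NoOuterObstruction G)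
    (hS : 4 ≤ S.card) :
    ∃ u ∈ S, pathsThrough G S u + 8 ≤ 4 * S.card ∧ pathsThrough G S u + 14 ≤ 5 * S.card := by
  by_cases hno : ∀ u ∈ S, 4 * S.card ≤ pathsThrough G S u + 9
  · obtain ⟨hmin, hE, v, x, y, z, hear, hheavy⟩ := hG.exists_heavy_ear (S := S) (by omega) hno
    refine ⟨v, hear.mem, ?_, hG.pathsThrough_le_small hear.mem hear.nbrs hear.adj (by omega)⟩
    cases hheavy <;> omega
  · push Not at hno
    obtain ⟨u, hu, h⟩ := hno
    exact ⟨u, hu, by omega, by omega⟩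

lemma card_pathQuads_eq_zero (hS : S.card ≤ 3) : (pathQuads G S).card = 0 := by
  rw [Finset.card_eq_zero, Finset.eq_empty_iff_forall_notMem]
  rintro ⟨a, b, c, d⟩ h
  rw [mem_pathQuads] at h
  obtain ⟨⟨ha, hb, hc, hd⟩, h1, h2, h3, h4, h5, h6⟩ := h
  have : ({a, b, c, d} : Finset V) ⊆ S := by
    intro u hu
    simp only [Finset.mem_insert, Finset.mem_singleton] at hu
    rcases hu with rfl | rfl | rfl | rfl <;> assumption
  have h8 := Finset.card_le_card this
  have e : ({a, b, c, d} : Finset V).card = 4 := by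
    rw [Finset.card_insert_of_notMem, Finset.card_eq_three.2 ⟨b, c, d, h2.ne, h5, h3.ne, rfl⟩]
    simp only [Finset.mem_insert, Finset.mem_singleton, not_or]
    exact ⟨h1.ne, h4, h6⟩
  omega

lemma NoOuterObstruction.card_pathQuads_four (hG : NoOuterObstruction G) (hS : S.card = 4) :
    (pathQuads G S).card ≤ 12 := by
  obtain ⟨u, hu, -, h2⟩ := hG.exists_pathsThrough_le_small (S := S) (by omega)
  have hc := Finset.card_erase_add_one hu
  rw [card_pathQuads_erase hu, card_pathQuads_eq_zero (by omega)]
  omega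

lemma NoOuterObstruction.card_pathQuads_five (hG : NoOuterObstruction G) (hS : S.card = 5) :
    (pathQuads G S).card ≤ 34 := by
  obtain ⟨u, hu, -, h2⟩ := hG.exists_pathsThrough_le_small (S := S) (by omega)
  have hc := Finset.card_erase_add_one hu
  have := hG.card_pathQuads_four (S := S.erase u) (by omega)
  rw [card_pathQuads_erase hu]
  omega

/-- This exceeds the value `64` of the general formula; the excess comes from ears of the second
kind, and the next step has to make up for it. -/
lemma NoOuterObstruction.card_pathQuads_six (hG : NoOuterObstruction G) (hS : S.card = 6) :
    (pathQuads G S).card ≤ 66 := by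
  obtain ⟨u, hu, h1, h2⟩ := hG.exists_pathsThrough_le_small (S := S) (by omega)
  have hc := Finset.card_erase_add_one hu
  have := hG.card_pathQuads_five (S := S.erase u) (by omega)
  rw [card_pathQuads_erase hu]
  omega

lemma NoOuterObstruction.card_pathQuads_six_of_universal (hG : NoOuterObstruction G)
    (hS : S.card = 6) {c : V} (hc : c ∈ S) (huniv : ∀ u ∈ S, u ≠ c → G.Adj c u) :
    (pathQuads G S).card ≤ 64 := by
  obtain ⟨u, hu, -, h2⟩ := hG.exists_pathsThrough_le_of_universal (by omega) hc huniv
  have hc := Finset.card_erase_add_one hu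
  have := hG.card_pathQuads_five (S := S.erase u) (by omega)
  rw [card_pathQuads_erase hu]
  omega

lemma NoOuterObstruction.card_pathQuads_seven (hG : NoOuterObstruction G) (hS : S.card = 7) :
    (pathQuads G S).card ≤ 102 := by
  by_cases hno : ∀ u ∈ S, 4 * S.card ≤ pathsThrough G S u + 9
  -- Either a universal vertex survives the deletion and `64 + 2 · 19` results, or a vertex on at
  -- most `18` paths gives `66 + 2 · 18`. Both are `102`.
  · obtain ⟨⟨c, hc, huniv, v, hv, hvc, hp⟩, -⟩ := hG.universal_of_no_light (by omega) (by omega) hno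
    have hc1 := Finset.card_erase_add_one hv
    have := hG.card_pathQuads_six_of_universal (S := S.erase v) (by omega)
      (Finset.mem_erase.2 ⟨hvc.symm, hc⟩) (fun u hu ↦ huniv u (Finset.mem_of_mem_erase hu))
    rw [card_pathQuads_erase hv]
    omega
  · push Not at hno
    obtain ⟨u, hu, h⟩ := hno
    have hc := Finset.card_erase_add_one hu
    have := hG.card_pathQuads_six (S := S.erase u) (by omega)
    rw [card_pathQuads_erase hu]
    omega

/-- The upper bound on the number of paths on four vertices. -/
lemma NoOuterObstruction.card_pathQuads_le (hG : NoOuterObstruction G) {n : ℕ} (hn : 7 ≤ n)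
    (hS : S.card = n) : (pathQuads G S).card + 14 * n ≤ 4 * n ^ 2 + 4 := by
  induction n, hn using Nat.le_induction generalizing S with
  | base =>
    have := hG.card_pathQuads_seven hS
    omega
  | succ n hn ih =>
    obtain ⟨u, hu, h⟩ := hG.exists_pathsThrough_le (S := S) (by omega)
    have hc := Finset.card_erase_add_one hu
    have := ih (S := S.erase u) (by omega)
    rw [card_pathQuads_erase hu]
    nlinarith

/-- In the case of equality some vertex is adjacent to all others, and the number of edges is
maximum. -/
lemma NoOuterObstruction.universal_of_card_pathQuads_eq (hG : NoOuterObstruction G)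
    (hn : 9 ≤ S.card) (h : (pathQuads G S).card + 14 * S.card = 4 * S.card ^ 2 + 4) :
    (∃ c ∈ S, ∀ u ∈ S, u ≠ c → G.Adj c u) ∧ degSumIn G S + 6 = 4 * S.card := by
  -- Deleting a vertex on fewer than `4n - 9` paths would leave more paths than the bound for `n -
  -- 1` vertices permits.
  have hno : ∀ u ∈ S, 4 * S.card ≤ pathsThrough G S u + 9 := by
    intro u hu
    by_contra! hlt
    have hc := Finset.card_erase_add_one hu
    have := hG.card_pathQuads_le (S := S.erase u) (n := S.card - 1) (by omega) (by omega)
    rw [card_pathQuads_erase hu] at h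
    obtain ⟨m, hm⟩ : ∃ m, S.card = m + 1 := ⟨S.card - 1, by omega⟩
    rw [hm, Nat.add_sub_cancel] at this
    rw [hm] at h hlt
    nlinarith
  obtain ⟨⟨c, hc, huniv, -⟩, hE⟩ := hG.universal_of_no_light (by omega) (by omega) hno
  exact ⟨⟨c, hc, huniv⟩, hE⟩

end Extremal

/-! ### Copies of the path as ordered quadruples -/

section CopyCount

variable {V : Type*} {G : SimpleGraph V}

/-- The subgraph of `G` formed by a path on four vertices. -/
def quadSubgraph (G : SimpleGraph V) (q : V × V × V × V) : G.Subgraph where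
  verts := {q.1, q.2.1, q.2.2.1, q.2.2.2}
  Adj u w := G.Adj u w ∧
    (s(u, w) = s(q.1, q.2.1) ∨ s(u, w) = s(q.2.1, q.2.2.1) ∨ s(u, w) = s(q.2.2.1, q.2.2.2))
  adj_sub h := h.1
  edge_vert := by
    rintro u w ⟨-, h⟩
    simp only [Sym2.eq_iff] at h
    simp only [Set.mem_insert_iff, Set.mem_singleton_iff]
    tauto
  symm := ⟨by
    rintro u w ⟨h1, h2⟩
    rw [Sym2.eq_swap]
    exact ⟨h1.symm, h2⟩⟩

lemma quadSubgraph_reverse (a b c d : V) :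
    quadSubgraph G (d, c, b, a) = quadSubgraph G (a, b, c, d) := by
  ext u w
  · simp only [quadSubgraph, Set.mem_insert_iff, Set.mem_singleton_iff]
    tauto
  · simp only [quadSubgraph, Sym2.eq_iff]
    tauto

/-- The edges alone determine the order of the vertices up to reversal, so it is enough to compare
the three edges. -/
lemma eq_or_reverse_of_quadSubgraph_eq {a b c d a' b' c' d' : V}
    (h : IsPathQuad G (a, b, c, d)) (h' : IsPathQuad G (a', b', c', d'))
    (he : quadSubgraph G (a', b', c', d') = quadSubgraph G (a, b, c, d)) :
    (a', b', c', d') = (a, b, c, d) ∨ (a', b', c', d') = (d, c, b, a) := by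
  have key : ∀ u w, (quadSubgraph G (a', b', c', d')).Adj u w →
      (quadSubgraph G (a, b, c, d)).Adj u w := fun u w huw ↦ he ▸ huw
  obtain ⟨h1, h2, h3, h4, h5, h6⟩ := h
  obtain ⟨g1, g2, g3, g4, g5, g6⟩ := h'
  have k1 := (key a' b' ⟨g1, Or.inl rfl⟩).2
  have k2 := (key b' c' ⟨g2, Or.inr (Or.inl rfl)⟩).2
  have k3 := (key c' d' ⟨g3, Or.inr (Or.inr rfl)⟩).2
  simp only [Sym2.eq_iff] at k1 k2 k3
  have := h1.ne
  have := h2.ne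
  have := h3.ne
  have := g1.ne
  have := g2.ne
  have := g3.ne
  simp only [Prod.mk.injEq]
  simp only at *
  grind

/-- The quadruple of a labelled copy of the path. -/
lemma toSubgraph_eq_quadSubgraph (f : SimpleGraph.Copy (SimpleGraph.pathGraph 4) G) :
    f.toSubgraph = quadSubgraph G (f 0, f 1, f 2, f 3) ∧
      IsPathQuad G (f 0, f 1, f 2, f 3) := by
  have hq : IsPathQuad G (f 0, f 1, f 2, f 3) := by
    refine ⟨f.toHom.map_adj ?_, f.toHom.map_adj ?_, f.toHom.map_adj ?_, f.injective.ne ?_,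
      f.injective.ne ?_, f.injective.ne ?_⟩ <;> simp [SimpleGraph.pathGraph_adj]
  refine ⟨?_, hq⟩
  ext u w
  · simp only [SimpleGraph.Copy.toSubgraph, SimpleGraph.Subgraph.map_verts,
      SimpleGraph.Subgraph.verts_top, Set.image_univ, Set.mem_range, quadSubgraph,
      Set.mem_insert_iff, Set.mem_singleton_iff]
    constructor
    · rintro ⟨i, rfl⟩
      fin_cases i
      exacts [Or.inl rfl, Or.inr (Or.inl rfl), Or.inr (Or.inr (Or.inl rfl)),
        Or.inr (Or.inr (Or.inr rfl))]
    · rintro (rfl | rfl | rfl | rfl)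
      exacts [⟨0, rfl⟩, ⟨1, rfl⟩, ⟨2, rfl⟩, ⟨3, rfl⟩]
  · simp only [SimpleGraph.Copy.toSubgraph, SimpleGraph.Subgraph.map_adj, Relation.Map,
      SimpleGraph.Subgraph.top_adj, quadSubgraph, Sym2.eq_iff]
    constructor
    · rintro ⟨i, j, hij, rfl, rfl⟩
      refine ⟨f.toHom.map_adj hij, ?_⟩
      rw [SimpleGraph.pathGraph_adj] at hij
      fin_cases i <;> fin_cases j <;> simp at hij <;>
        first
        | exact Or.inl (Or.inl ⟨rfl, rfl⟩)
        | exact Or.inl (Or.inr ⟨rfl, rfl⟩)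
        | exact Or.inr (Or.inl (Or.inl ⟨rfl, rfl⟩))
        | exact Or.inr (Or.inl (Or.inr ⟨rfl, rfl⟩))
        | exact Or.inr (Or.inr (Or.inl ⟨rfl, rfl⟩))
        | exact Or.inr (Or.inr (Or.inr ⟨rfl, rfl⟩))
    · have e : ∀ i j : Fin 4, (i : ℕ) + 1 = j → (SimpleGraph.pathGraph 4).Adj i j :=
        fun i j h ↦ SimpleGraph.pathGraph_adj.2 (Or.inl h)
      rintro ⟨-, (⟨rfl, rfl⟩ | ⟨rfl, rfl⟩) | (⟨rfl, rfl⟩ | ⟨rfl, rfl⟩) |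
        (⟨rfl, rfl⟩ | ⟨rfl, rfl⟩)⟩
      exacts [⟨0, 1, e 0 1 rfl, rfl, rfl⟩, ⟨1, 0, (e 0 1 rfl).symm, rfl, rfl⟩,
        ⟨1, 2, e 1 2 rfl, rfl, rfl⟩, ⟨2, 1, (e 1 2 rfl).symm, rfl, rfl⟩,
        ⟨2, 3, e 2 3 rfl, rfl, rfl⟩, ⟨3, 2, (e 2 3 rfl).symm, rfl, rfl⟩]

/-- A path quadruple as a labelled copy of the path. -/
lemma exists_copy_of_isPathQuad {a b c d : V} (h : IsPathQuad G (a, b, c, d)) :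
    ∃ f : SimpleGraph.Copy (SimpleGraph.pathGraph 4) G, (f 0, f 1, f 2, f 3) = (a, b, c, d) := by
  obtain ⟨h1, h2, h3, h4, h5, h6⟩ := h
  simp only at h1 h2 h3 h4 h5 h6
  refine ⟨⟨⟨![a, b, c, d], ?_⟩, ?_⟩, rfl⟩
  · intro i j hij
    rw [SimpleGraph.pathGraph_adj] at hij
    fin_cases i <;> fin_cases j <;> simp at hij ⊢ <;> first | assumption | (symm; assumption)
  · intro i j hij
    have := h1.ne
    have := h2.ne
    have := h3.ne
    fin_cases i <;> fin_cases j <;> simp at hij ⊢ <;> grind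

/-- Every copy of the path on four vertices appears as exactly two quadruples. -/
theorem two_mul_copyCount [Fintype V] :
    2 * G.copyCount (SimpleGraph.pathGraph 4) = (pathQuads G Finset.univ).card := by
  classical
  have himg : (Finset.univ : Finset (SimpleGraph.Copy (SimpleGraph.pathGraph 4) G)).image
      SimpleGraph.Copy.toSubgraph = (pathQuads G Finset.univ).image (quadSubgraph G) := by
    ext H
    simp only [Finset.mem_image, Finset.mem_univ, true_and]
    constructor
    · rintro ⟨f, rfl⟩
      obtain ⟨h1, h2⟩ := toSubgraph_eq_quadSubgraph f
      exact ⟨_, mem_pathQuads.2 ⟨by simp, h2⟩, h1.symm⟩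
    · rintro ⟨⟨a, b, c, d⟩, hq, rfl⟩
      obtain ⟨f, hf⟩ := exists_copy_of_isPathQuad (mem_pathQuads.1 hq).2
      exact ⟨f, by rw [(toSubgraph_eq_quadSubgraph f).1, hf]⟩
  rw [SimpleGraph.copyCount_eq_card_image_copyToSubgraph, himg,
    Finset.card_eq_sum_card_image (quadSubgraph G) (pathQuads G Finset.univ)]
  rw [Finset.sum_congr rfl (g := fun _ ↦ 2), Finset.sum_const, smul_eq_mul, mul_comm]
  intro H hH
  obtain ⟨⟨a, b, c, d⟩, hq, rfl⟩ := Finset.mem_image.1 hH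
  have hq' := (mem_pathQuads.1 hq).2
  have : (pathQuads G Finset.univ).filter
      (fun q ↦ quadSubgraph G q = quadSubgraph G (a, b, c, d)) = {(a, b, c, d), (d, c, b, a)} := by
    ext ⟨a', b', c', d'⟩
    simp only [Finset.mem_filter, Finset.mem_insert, Finset.mem_singleton]
    constructor
    · rintro ⟨h1, h2⟩
      exact eq_or_reverse_of_quadSubgraph_eq hq' (mem_pathQuads.1 h1).2 h2
    · rintro (h | h)
      · rw [h]; exact ⟨hq, rfl⟩
      · rw [h]
        exact ⟨mem_pathQuads.2 ⟨by simp, hq'.reverse⟩, quadSubgraph_reverse a b c d⟩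
  rw [this, Finset.card_pair]
  intro h
  exact hq'.2.2.2.2.2 (congrArg Prod.fst h)

/-- Path quadruples are transported along embeddings that reflect and preserve adjacency. -/
lemma card_pathQuads_map {W : Type*} {H : SimpleGraph W} (φ : H ↪g G) (T : Finset W) :
    (pathQuads G (T.map φ.toEmbedding)).card = (pathQuads H T).card := by
  symm
  refine Finset.card_bij (fun q _ ↦ (φ q.1, φ q.2.1, φ q.2.2.1, φ q.2.2.2)) ?_ ?_ ?_
  · rintro ⟨a, b, c, d⟩ h
    rw [mem_pathQuads] at h ⊢
    simpa [IsPathQuad] using h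
  · rintro ⟨a, b, c, d⟩ - ⟨a', b', c', d'⟩ - h
    simpa using h
  · rintro ⟨a, b, c, d⟩ h
    rw [mem_pathQuads] at h
    obtain ⟨⟨ha, hb, hc, hd⟩, hq⟩ := h
    simp only [Finset.mem_map] at ha hb hc hd
    obtain ⟨a, ha, rfl⟩ := ha
    obtain ⟨b, hb, rfl⟩ := hb
    obtain ⟨c, hc, rfl⟩ := hc
    obtain ⟨d, hd, rfl⟩ := hd
    refine ⟨(a, b, c, d), mem_pathQuads.2 ⟨⟨ha, hb, hc, hd⟩, ?_⟩, rfl⟩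
    simpa [IsPathQuad] using hq

end CopyCount

/-! ### Recognising the fan -/

section PathRecognition

variable {V : Type*} {G : SimpleGraph V}

/-- The sequence `w` enumerates `T` such that exactly the consecutive members are adjacent. -/
def IsPathEnumeration (G : SimpleGraph V) (T : Finset V) (w : ℕ → V) : Prop :=
  (∀ i < T.card, w i ∈ T) ∧ Set.InjOn w (Set.Iio T.card) ∧
    ∀ i < T.card, ∀ j < T.card, (G.Adj (w i) (w j) ↔ i + 1 = j ∨ j + 1 = i)

lemma IsPathEnumeration.reverse {T : Finset V} {w : ℕ → V} (h : IsPathEnumeration G T w) :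
    IsPathEnumeration G T (fun i ↦ w (T.card - 1 - i)) := by
  refine ⟨fun i hi ↦ h.1 _ (by omega), ?_, ?_⟩
  · intro i hi j hj hij
    simp only [Set.mem_Iio] at hi hj
    have := h.2.1 (by simp; omega) (by simp; omega) hij
    omega
  · intro i hi j hj
    rw [h.2.2 _ (by omega) _ (by omega)]
    omega

variable [DecidableEq V]

lemma IsPathEnumeration.exists_index {T : Finset V} {w : ℕ → V} (h : IsPathEnumeration G T w)
    {u : V} (hu : u ∈ T) : ∃ i < T.card, w i = u := by
  have hsub : (Finset.range T.card).image w ⊆ T := by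
    intro x hx
    obtain ⟨i, hi, rfl⟩ := Finset.mem_image.1 hx
    exact h.1 i (Finset.mem_range.1 hi)
  have heq := Finset.eq_of_subset_of_card_le hsub (by
    rw [Finset.card_image_of_injOn (by simpa using h.2.1), Finset.card_range])
  rw [← heq] at hu
  obtain ⟨i, hi, h'⟩ := Finset.mem_image.1 hu
  exact ⟨i, Finset.mem_range.1 hi, h'⟩

/-- A path can be prolonged by a vertex that is adjacent to its first vertex only. -/
lemma IsPathEnumeration.cons {T : Finset V} {w : ℕ → V} {v : V} (hv : v ∈ T)
    (h : IsPathEnumeration G (T.erase v) w) (hn : nbrsIn G T v = {w 0}) :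
    IsPathEnumeration G T (fun i ↦ if i = 0 then v else w (i - 1)) := by
  have hc := Finset.card_erase_add_one hv
  have hmem : ∀ i < (T.erase v).card, w i ≠ v ∧ w i ∈ T := fun i hi ↦
    Finset.mem_erase.1 (h.1 i hi)
  have hpos : 0 < (T.erase v).card := by
    have : w 0 ∈ nbrsIn G T v := by simp [hn]
    rw [mem_nbrsIn] at this
    exact Finset.card_pos.2 ⟨w 0, Finset.mem_erase.2 ⟨this.2.ne', this.1⟩⟩
  have hadj : ∀ i < (T.erase v).card, (G.Adj v (w i) ↔ i = 0) := by
    intro i hi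
    have : G.Adj v (w i) ↔ w i ∈ nbrsIn G T v := by
      rw [mem_nbrsIn]
      exact ⟨fun h' ↦ ⟨(hmem i hi).2, h'⟩, fun h' ↦ h'.2⟩
    rw [this, hn, Finset.mem_singleton]
    exact ⟨fun h' ↦ h.2.1 hi hpos h', fun h' ↦ by rw [h']⟩
  refine ⟨?_, ?_, ?_⟩
  · intro i hi
    dsimp only
    split_ifs with h0
    · exact hv
    · exact (hmem (i - 1) (by omega)).2
  · intro i hi j hj hij
    simp only [Set.mem_Iio] at hi hj
    dsimp only at hij
    split_ifs at hij with h1 h2 h2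
    · omega
    · exact absurd hij.symm (hmem (j - 1) (by omega)).1
    · exact absurd hij (hmem (i - 1) (by omega)).1
    · have := h.2.1 (by simp; omega) (by simp; omega) hij
      omega
  · intro i hi j hj
    dsimp only
    split_ifs with h1 h2 h2
    · simp [h1, h2]
    · rw [hadj _ (by omega)]; omega
    · rw [G.adj_comm, hadj _ (by omega)]; omega
    · rw [h.2.2 _ (by omega) _ (by omega)]; omega

lemma degSumIn_forest_le {T : Finset V} (hT : T.Nonempty)
    (hlow : ∀ T' ⊆ T, T'.Nonempty → ∃ u ∈ T', degIn G T' u ≤ 1) :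
    degSumIn G T + 2 ≤ 2 * T.card := by
  induction hn : T.card generalizing T with
  | zero => exact absurd (Finset.card_eq_zero.1 hn) hT.ne_empty
  | succ n ih =>
    obtain ⟨u, hu, hu1⟩ := hlow T subset_rfl hT
    have hc := Finset.card_erase_add_one hu
    rw [degSumIn_erase hu]
    rcases Finset.eq_empty_or_nonempty (T.erase u) with h0 | h0
    · have := degIn_le_card_sub_one (G := G) hu
      rw [h0, Finset.card_empty] at hc
      rw [h0]
      simp only [degSumIn, Finset.sum_empty]
      omega
    · have := ih h0 (fun T' hT' ↦ hlow T' (hT'.trans (Finset.erase_subset _ _))) (by omega)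
      omega

/-- A tree with maximum degree at most two is a path. -/
lemma exists_pathEnumeration {T : Finset V} (hT : T.Nonempty)
    (hlow : ∀ T' ⊆ T, T'.Nonempty → ∃ u ∈ T', degIn G T' u ≤ 1)
    (hdeg : ∀ u ∈ T, degIn G T u ≤ 2) (hsum : degSumIn G T + 2 = 2 * T.card) :
    ∃ w, IsPathEnumeration G T w := by
  induction hn : T.card generalizing T with
  | zero => exact absurd (Finset.card_eq_zero.1 hn) hT.ne_empty
  | succ n ih =>
    obtain ⟨v, hv, hv1⟩ := hlow T subset_rfl hT
    have hc := Finset.card_erase_add_one hv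
    rcases Finset.eq_empty_or_nonempty (T.erase v) with h0 | h0
    · rw [h0, Finset.card_empty] at hc
      refine ⟨fun _ ↦ v, fun i _ ↦ hv, ?_, ?_⟩
      · intro i hi j hj _
        simp only [Set.mem_Iio] at hi hj
        omega
      · intro i hi j hj
        simp only [SimpleGraph.irrefl, false_iff]
        omega
    · have hlow' : ∀ T' ⊆ T.erase v, T'.Nonempty → ∃ u ∈ T', degIn G T' u ≤ 1 :=
        fun T' hT' ↦ hlow T' (hT'.trans (Finset.erase_subset _ _))
      -- The forest bound for the rest forces `v` to have degree exactly one and makes the rest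
      -- attain equality again.
      have hforest := degSumIn_forest_le h0 hlow'
      rw [degSumIn_erase hv] at hsum
      obtain ⟨w, hw⟩ := ih h0 hlow' (fun u hu ↦ (degIn_mono (Finset.erase_subset _ _) u).trans
        (hdeg u (Finset.mem_of_mem_erase hu))) (by omega) (by omega)
      obtain ⟨u, hu⟩ := Finset.card_eq_one.1 (by omega : degIn G T v = 1)
      have hum : u ∈ nbrsIn G T v := by simp [hu]
      rw [mem_nbrsIn] at hum
      obtain ⟨i, hi, rfl⟩ := hw.exists_index (Finset.mem_erase.2 ⟨hum.2.ne', hum.1⟩)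
      -- An inner vertex of the path would acquire `v` as a third neighbour.
      have hend : i = 0 ∨ i = (T.erase v).card - 1 := by
        by_contra! hcon
        have h3 : ({v, w (i - 1), w (i + 1)} : Finset V) ⊆ nbrsIn G T (w i) := by
          intro x hx
          simp only [Finset.mem_insert, Finset.mem_singleton] at hx
          rcases hx with rfl | rfl | rfl
          · exact mem_nbrsIn.2 ⟨hv, hum.2.symm⟩
          · exact mem_nbrsIn.2 ⟨Finset.mem_of_mem_erase (hw.1 _ (by omega)),
              (hw.2.2 _ hi _ (by omega)).2 (by omega)⟩
          · exact mem_nbrsIn.2 ⟨Finset.mem_of_mem_erase (hw.1 _ (by omega)),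
              (hw.2.2 _ hi _ (by omega)).2 (by omega)⟩
        have h4 := Finset.card_le_card h3
        rw [Finset.card_eq_three.2 ⟨v, w (i - 1), w (i + 1),
          (Finset.ne_of_mem_erase (hw.1 _ (by omega))).symm,
          (Finset.ne_of_mem_erase (hw.1 _ (by omega))).symm,
          fun h ↦ by
            have := hw.2.1 (by simp; omega) (by simp; omega) h
            omega, rfl⟩] at h4
        have := hdeg _ hum.1
        rw [degIn] at this
        omega
      rcases hend with rfl | h
      · exact ⟨_, hw.cons hv hu⟩
      · exact ⟨_, hw.reverse.cons hv (by rw [hu, Nat.sub_zero, ← h])⟩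

lemma fanGraph_adj_inl_inl {m : ℕ} (a b : Fin 1) : ¬ (fanGraph m).Adj (.inl a) (.inl b) := by
  simp [fanGraph, graphJoin, Subsingleton.elim a b]

lemma fanGraph_adj_inl_inr {m : ℕ} (a : Fin 1) (i : Fin m) :
    (fanGraph m).Adj (.inl a) (.inr i) := by
  simp [fanGraph, graphJoin]

lemma fanGraph_adj_inr_inr {m : ℕ} (i j : Fin m) :
    (fanGraph m).Adj (.inr i) (.inr j) ↔ (i : ℕ) + 1 = j ∨ (j : ℕ) + 1 = i := by
  simp [fanGraph, graphJoin, SimpleGraph.pathGraph_adj]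

/-- An obstruction-free graph with the maximum number of edges and a vertex adjacent to all others
is a fan. -/
lemma NoOuterObstruction.nonempty_iso_fanGraph [Fintype V] (hG : NoOuterObstruction G)
    (hcard : 2 ≤ Fintype.card V) {c : V} (huniv : ∀ u, u ≠ c → G.Adj c u)
    (hE : degSumIn G Finset.univ + 6 = 4 * Fintype.card V) :
    Nonempty (G ≃g fanGraph (Fintype.card V - 1)) := by
  set T : Finset V := Finset.univ.erase c with hTdef
  have hTc : T.card = Fintype.card V - 1 := by
    rw [hTdef, Finset.card_erase_of_mem (Finset.mem_univ c), Finset.card_univ]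
  have hcT : c ∉ T := Finset.notMem_erase c _
  have hT : T.Nonempty := Finset.card_pos.1 (by omega)
  have hdc : degIn G Finset.univ c = T.card := by
    rw [degIn]
    congr 1
    ext u
    simp only [mem_nbrsIn, Finset.mem_univ, true_and, hTdef, Finset.mem_erase, and_true]
    exact ⟨fun h ↦ h.ne', huniv u⟩
  have hsum : degSumIn G T + 2 = 2 * T.card := by
    have := degSumIn_erase (G := G) (Finset.mem_univ c)
    rw [← hTdef, hdc] at this
    omega
  -- Every neighbour of `u` in `T` is also a neighbour of `c`, so the absence of `K₂,₃` applies to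
  -- the pair `u, c`.
  have hdeg : ∀ u ∈ T, degIn G T u ≤ 2 := by
    intro u hu
    refine (Finset.card_le_card ?_).trans
      (hG.card_common_le (S := Finset.univ) (Finset.ne_of_mem_erase hu))
    intro x hx
    simp only [hTdef, mem_nbrsIn, Finset.mem_erase, Finset.mem_inter, Finset.mem_univ, and_true,
      true_and] at hx ⊢
    exact ⟨hx.2, huniv x hx.1⟩
  -- Adding the universal vertex raises each degree in `T'` by one, so a vertex of degree at most
  -- two becomes one of degree at most one. If the low vertex is `c` itself, then `T'` has at most
  -- two elements.
  have hlow : ∀ T' ⊆ T, T'.Nonempty → ∃ u ∈ T', degIn G T' u ≤ 1 := by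
    intro T' hT' ⟨x, hx⟩
    have hcT' : c ∉ T' := fun h ↦ hcT (hT' h)
    obtain ⟨u, hu, hu2⟩ := hG.exists_low (S := insert c T') ⟨c, Finset.mem_insert_self c T'⟩
    rcases Finset.mem_insert.1 hu with rfl | huT'
    · have hall : nbrsIn G (insert u T') u = T' := by
        ext y
        simp only [mem_nbrsIn, Finset.mem_insert]
        constructor
        · rintro ⟨rfl | hy, hadj⟩
          · exact absurd rfl hadj.ne
          · exact hy
        · exact fun hy ↦ ⟨Or.inr hy, huniv y fun h ↦ hcT' (h ▸ hy)⟩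
      rw [degIn, hall] at hu2
      have := degIn_le_card_sub_one (G := G) hx
      exact ⟨x, hx, by omega⟩
    · have := degIn_erase_of_adj (Finset.mem_insert_self c T')
        (huniv u fun h ↦ hcT' (h ▸ huT')).symm
      rw [Finset.erase_insert hcT'] at this
      exact ⟨u, huT', by omega⟩
  obtain ⟨w, hw⟩ := exists_pathEnumeration hT hlow hdeg hsum
  rw [← hTc]
  have hwc : ∀ i < T.card, w i ≠ c := fun i hi ↦ Finset.ne_of_mem_erase (hw.1 i hi)
  let f : Fin 1 ⊕ Fin T.card → V := Sum.elim (fun _ ↦ c) (fun i ↦ w i)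
  have hf : Function.Bijective f := by
    constructor
    · rintro (a | i) (b | j) hab
      · rw [Subsingleton.elim a b]
      · exact absurd hab.symm (hwc j j.2)
      · exact absurd hab (hwc i i.2)
      · rw [Fin.ext (hw.2.1 i.2 j.2 hab)]
    · intro u
      by_cases hu : u = c
      · exact ⟨.inl 0, hu.symm⟩
      · obtain ⟨i, hi, h⟩ := hw.exists_index (Finset.mem_erase.2 ⟨hu, Finset.mem_univ u⟩ : u ∈ T)
        exact ⟨.inr ⟨i, hi⟩, h⟩
  refine ⟨SimpleGraph.Iso.symm ⟨Equiv.ofBijective f hf, ?_⟩⟩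
  rintro (a | i) (b | j)
  · simpa [f] using fanGraph_adj_inl_inl a b
  · simpa [f, fanGraph_adj_inl_inr] using huniv _ (hwc j j.2)
  · simpa [f, (fanGraph_adj_inl_inr b i).symm] using (huniv _ (hwc i i.2)).symm
  · simpa [f, fanGraph_adj_inr_inr] using hw.2.2 i i.2 j j.2

end PathRecognition

/-! ### The number of paths in a fan -/

/-- The fan with hub `0` on the natural numbers. -/
def natFan : SimpleGraph ℕ where
  Adj i j := i ≠ j ∧ (i = 0 ∨ j = 0 ∨ i = j + 1 ∨ j = i + 1)
  symm := ⟨fun i j h ↦ ⟨h.1.symm, by tauto⟩⟩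
  loopless := ⟨fun i h ↦ h.1 rfl⟩

lemma natFan_adj {i j : ℕ} :
    natFan.Adj i j ↔ i ≠ j ∧ (i = 0 ∨ j = 0 ∨ i = j + 1 ∨ j = i + 1) := Iff.rfl

lemma natFan_nbrs_last {m : ℕ} (hm : 2 ≤ m) :
    nbrsIn natFan (Finset.range (m + 1)) m = {0, m - 1} := by
  ext u
  simp only [mem_nbrsIn, Finset.mem_range, natFan_adj, Finset.mem_insert, Finset.mem_singleton]
  omega

lemma range_succ_erase (m : ℕ) : (Finset.range (m + 1)).erase m = Finset.range m := by
  ext u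
  simp only [Finset.mem_erase, Finset.mem_range]
  omega

lemma natFan_degSumIn {m : ℕ} (hm : 1 ≤ m) :
    degSumIn natFan (Finset.range (m + 1)) + 6 = 4 * (m + 1) := by
  induction m, hm using Nat.le_induction with
  | base =>
    have h0 : nbrsIn natFan (Finset.range 1) 0 = ∅ := by
      ext u
      simp only [mem_nbrsIn, Finset.mem_range, natFan_adj, Finset.notMem_empty, iff_false]
      omega
    have h1 : nbrsIn natFan (Finset.range (1 + 1)) 1 = {0} := by
      ext u
      simp only [mem_nbrsIn, Finset.mem_range, natFan_adj, Finset.mem_singleton]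
      omega
    rw [degSumIn_erase (Finset.self_mem_range_succ 1), range_succ_erase, degSumIn,
      Finset.sum_range_one, degIn, h0, degIn, h1]
    simp
  | succ m hm ih =>
    rw [degSumIn_erase (Finset.self_mem_range_succ (m + 1)), range_succ_erase, degIn,
      natFan_nbrs_last (by omega), Finset.card_pair (by omega)]
    omega

/-- The last vertex is an ear on the edge from `0` to `m - 1` with third vertex `m - 2`, and no
vertex is undominated. For `m = 3` that third vertex is an end of the path and has degree two
instead of three. -/
lemma natFan_pathsThrough_last {m : ℕ} (hm : 3 ≤ m) :
    pathsThrough natFan (Finset.range (m + 1)) m + (if m = 3 then 10 else 9) = 4 * (m + 1) := by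
  have e := pathsThrough_ear (Finset.self_mem_range_succ m) (natFan_nbrs_last (by omega))
    (natFan_adj.2 (by omega))
  have hR : ((Finset.range (m + 1)).erase m) \ ((nbrsIn natFan (Finset.range (m + 1)) 0).erase m ∪
      (nbrsIn natFan (Finset.range (m + 1)) (m - 1)).erase m) = ∅ := by
    ext u
    simp only [mem_nbrsIn, Finset.mem_range, natFan_adj, Finset.mem_sdiff, Finset.mem_erase,
      Finset.mem_union, Finset.notMem_empty, iff_false, true_or, and_true]
    clear e
    omega
  have hC : (nbrsIn natFan (Finset.range (m + 1)) 0).erase m ∩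
      (nbrsIn natFan (Finset.range (m + 1)) (m - 1)).erase m = {m - 2} := by
    ext u
    simp only [mem_nbrsIn, Finset.mem_range, natFan_adj, Finset.mem_erase, Finset.mem_inter,
      Finset.mem_singleton]
    clear e hR
    constructor
    · rintro ⟨⟨h1, h2, h3, h4⟩, -, h5, h6, h7⟩
      omega
    · rintro rfl
      refine ⟨⟨?_, ?_, ?_, Or.inl trivial⟩, ?_, ?_, ?_, ?_⟩ <;> omega
  have hz : degIn natFan (Finset.range (m + 1)) (m - 2) = if m = 3 then 2 else 3 := by
    split_ifs with h3
    · subst h3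
      have : nbrsIn natFan (Finset.range (3 + 1)) (3 - 2) = {0, 2} := by
        ext u
        simp only [mem_nbrsIn, Finset.mem_range, natFan_adj, Finset.mem_insert,
          Finset.mem_singleton]
        omega
      rw [degIn, this, Finset.card_pair (by omega)]
    · have : nbrsIn natFan (Finset.range (m + 1)) (m - 2) = {0, m - 3, m - 1} := by
        ext u
        simp only [mem_nbrsIn, Finset.mem_range, natFan_adj, Finset.mem_insert,
          Finset.mem_singleton]
        omega
      rw [degIn, this]
      exact Finset.card_eq_three.2 ⟨0, m - 3, m - 1, by omega, by omega, by omega, rfl⟩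
  have hE := natFan_degSumIn (m := m) (by omega)
  rw [hR, hC, Finset.sum_empty, Finset.sum_singleton, hz] at e
  split_ifs at * <;> omega

lemma natFan_card_pathQuads {m : ℕ} (hm : 3 ≤ m) :
    (pathQuads natFan (Finset.range (m + 1))).card + 14 * (m + 1) = 4 * (m + 1) ^ 2 + 4 := by
  induction m, hm using Nat.le_induction with
  | base =>
    have := natFan_pathsThrough_last (m := 3) le_rfl
    rw [card_pathQuads_erase (Finset.self_mem_range_succ 3), range_succ_erase,
      card_pathQuads_eq_zero (by simp)]
    simp only [if_true] at this
    omega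
  | succ m hm ih =>
    have := natFan_pathsThrough_last (m := m + 1) (by omega)
    rw [if_neg (by omega)] at this
    rw [card_pathQuads_erase (Finset.self_mem_range_succ (m + 1)), range_succ_erase]
    nlinarith

/-- The fan as an induced subgraph of the fan on the natural numbers. -/
def fanGraphEmbedding (m : ℕ) : fanGraph m ↪g natFan where
  toFun := Sum.elim (fun _ ↦ 0) (fun i ↦ i + 1)
  inj' := by
    rintro (a | i) (b | j) h
    · rw [Subsingleton.elim a b]
    · simp at h
    · simp at h
    · simp only [Sum.elim_inr, add_left_inj] at h
      rw [Fin.ext h]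
  map_rel_iff' := by
    rintro (a | i) (b | j)
    · exact iff_of_false (fun h ↦ h.1 rfl) (fanGraph_adj_inl_inl a b)
    · exact iff_of_true ⟨(Nat.succ_ne_zero _).symm, Or.inl rfl⟩ (fanGraph_adj_inl_inr a j)
    · exact iff_of_true ⟨Nat.succ_ne_zero _, Or.inr (Or.inl rfl)⟩ (fanGraph_adj_inl_inr b i).symm
    · change natFan.Adj ((i : ℕ) + 1) ((j : ℕ) + 1) ↔ _
      rw [natFan_adj, fanGraph_adj_inr_inr]
      omega

/-- The number of paths on four vertices in a fan. -/
lemma copyCount_of_iso_fanGraph {V : Type*} [Fintype V] {G : SimpleGraph V} {m : ℕ} (hm : 3 ≤ m)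
    (φ : G ≃g fanGraph m) :
    2 * G.copyCount (SimpleGraph.pathGraph 4) + 14 * (m + 1) = 4 * (m + 1) ^ 2 + 4 := by
  rw [two_mul_copyCount, ← natFan_card_pathQuads hm]
  congr 1
  let ψ : G ↪g natFan := (fanGraphEmbedding m).comp φ.toEmbedding
  rw [← card_pathQuads_map ψ]
  congr 2
  ext u
  simp only [Finset.mem_map, Finset.mem_univ, true_and, Finset.mem_range]
  constructor
  · rintro ⟨v, rfl⟩
    change fanGraphEmbedding m (φ v) < m + 1
    rcases φ v with a | i
    · exact Nat.succ_pos m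
    · exact Nat.succ_lt_succ i.2
  · intro hu
    obtain ⟨x, hx⟩ : ∃ x, fanGraphEmbedding m x = u := by
      rcases u with _ | u
      · exact ⟨.inl 0, rfl⟩
      · exact ⟨.inr ⟨u, by omega⟩, rfl⟩
    refine ⟨φ.symm x, ?_⟩
    change fanGraphEmbedding m (φ (φ.symm x)) = u
    rw [φ.apply_symm_apply, hx]

/-! ### An outerplanar drawing of the fan -/

/-- Outerplanarity is invariant under isomorphism. -/
lemma IsOuterplanar.of_iso {V W : Type*} {G : SimpleGraph V} {H : SimpleGraph W} (φ : G ≃g H)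
    (h : IsOuterplanar H) : IsOuterplanar G := by
  obtain ⟨D, hD⟩ := h
  have hedge : ∀ e : Sym2 V, e ∈ G.edgeSet → e.map φ ∈ H.edgeSet := by
    intro e he
    induction e using Sym2.ind with
    | _ u v => exact φ.map_adj_iff.2 he
  let D' : PlaneDrawing G :=
    { point := D.point ∘ φ
      arc := fun e ↦ D.arc (e.map φ)
      point_injective := D.point_injective.comp φ.injective
      arc_spec := fun u v huv ↦ D.arc_spec (φ u) (φ v) (φ.map_adj_iff.2 huv)
      mem_of_point_mem_arc := by
        intro e he w hw
        obtain ⟨u, hu, huw⟩ := Sym2.mem_map.1 (D.mem_of_point_mem_arc _ (hedge e he) _ hw)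
        exact φ.injective huw ▸ hu
      arc_inter_arc := by
        intro e he f hf hef z hz
        obtain ⟨w, hwe, hwf, hwz⟩ := D.arc_inter_arc _ (hedge e he) _ (hedge f hf)
          (fun h ↦ hef (Sym2.map.injective φ.injective h)) z hz
        obtain ⟨u, hu, rfl⟩ := Sym2.mem_map.1 hwe
        obtain ⟨u', hu', huu'⟩ := Sym2.mem_map.1 hwf
        exact ⟨u, hu, φ.injective huu' ▸ hu', hwz⟩ }
  have hsupp : D'.support = D.support := by
    simp only [PlaneDrawing.support]
    congr 1
    · exact φ.surjective.range_comp D.point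
    · ext z
      simp only [Set.mem_iUnion]
      constructor
      · rintro ⟨e, he, hz⟩
        exact ⟨_, hedge e he, hz⟩
      · rintro ⟨e, he, hz⟩
        induction e using Sym2.ind with
        | _ u v =>
          refine ⟨s(φ.symm u, φ.symm v), φ.symm.map_adj_iff.2 he, ?_⟩
          change z ∈ D.arc (Sym2.map φ s(φ.symm u, φ.symm v))
          simpa using hz
  have hface : D'.outerFace = D.outerFace := by
    simp only [PlaneDrawing.outerFace, hsupp]
  exact ⟨D', fun v ↦ by rw [hface]; exact hD (φ v)⟩

/-- The positions of the vertices in a drawing of the fan. -/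
noncomputable def fanPoint (m : ℕ) : Fin 1 ⊕ Fin m → ℂ :=
  Sum.elim (fun _ ↦ 0) (fun i ↦ ⟨i, 1⟩)

lemma fanPoint_injective (m : ℕ) : Function.Injective (fanPoint m) := by
  rintro (a | i) (b | j) h
  · rw [Subsingleton.elim a b]
  · simpa [fanPoint] using congrArg Complex.im h
  · simpa [fanPoint] using congrArg Complex.im h
  · have := congrArg Complex.re h
    simp only [fanPoint, Sum.elim_inr, Nat.cast_inj] at this
    rw [Fin.ext this]

/-- The straight edges of a drawing of the fan. -/
noncomputable def fanArc (m : ℕ) (e : Sym2 (Fin 1 ⊕ Fin m)) : Set ℂ :=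
  convexHull ℝ (fanPoint m '' {w | w ∈ e})

lemma fanArc_mk (m : ℕ) (u v : Fin 1 ⊕ Fin m) :
    fanArc m s(u, v) = segment ℝ (fanPoint m u) (fanPoint m v) := by
  have : {w | w ∈ s(u, v)} = {u, v} := by
    ext w
    simp
  rw [fanArc, this, Set.image_pair, convexHull_pair]

/-- Spokes lie on lines through the origin and path edges on a horizontal line. The incidence
conditions of the drawing thereby become arithmetic with coordinates. -/
lemma fan_edge_cases {m : ℕ} {e : Sym2 (Fin 1 ⊕ Fin m)} (he : e ∈ (fanGraph m).edgeSet) :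
    (∃ i : Fin m, e = s(.inl 0, .inr i) ∧ ∀ z ∈ fanArc m e, 0 ≤ z.im ∧ z.im ≤ 1 ∧
      z.re = z.im * i) ∨
    (∃ i j : Fin m, (i : ℕ) + 1 = j ∧ e = s(.inr i, .inr j) ∧ ∀ z ∈ fanArc m e, z.im = 1 ∧
      (i : ℝ) ≤ z.re ∧ z.re ≤ i + 1) := by
  have hub : ∀ (a : Fin 1) (i : Fin m), ∀ z ∈ fanArc m s(.inl a, .inr i), 0 ≤ z.im ∧ z.im ≤ 1 ∧
      z.re = z.im * i := by
    intro a i z hz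
    rw [fanArc_mk, segment_eq_image] at hz
    obtain ⟨t, ⟨h0, h1⟩, rfl⟩ := hz
    simp [fanPoint, h0, h1]
  have pth : ∀ i j : Fin m, (i : ℕ) + 1 = j → ∀ z ∈ fanArc m s(.inr i, .inr j), z.im = 1 ∧
      (i : ℝ) ≤ z.re ∧ z.re ≤ i + 1 := by
    intro i j hij z hz
    rw [fanArc_mk, segment_eq_image] at hz
    obtain ⟨t, ⟨h0, h1⟩, rfl⟩ := hz
    have hj : (j : ℝ) = i + 1 := by rw [← hij]; push_cast; ring
    simp only [fanPoint, Sum.elim_inr, Complex.add_im, Complex.add_re, Complex.real_smul,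
      Complex.mul_im, Complex.mul_re, Complex.ofReal_re, Complex.ofReal_im, hj]
    refine ⟨by ring, ?_, ?_⟩ <;> nlinarith
  induction e using Sym2.ind with
  | _ u v =>
    rw [SimpleGraph.mem_edgeSet] at he
    rcases u with a | i <;> rcases v with b | j
    · exact absurd he (fanGraph_adj_inl_inl a b)
    · obtain rfl := Subsingleton.elim a 0
      exact Or.inl ⟨j, rfl, hub 0 j⟩
    · obtain rfl := Subsingleton.elim b 0
      refine Or.inl ⟨i, Sym2.eq_swap, ?_⟩
      rw [Sym2.eq_swap]
      exact hub 0 i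
    · rcases (fanGraph_adj_inr_inr i j).1 he with h | h
      · exact Or.inr ⟨i, j, h, rfl, pth i j h⟩
      · refine Or.inr ⟨j, i, h, Sym2.eq_swap, ?_⟩
        rw [Sym2.eq_swap]
        exact pth j i h

/-- A straight-line drawing of the fan. -/
noncomputable def fanDrawing (m : ℕ) : PlaneDrawing (fanGraph m) where
  point := fanPoint m
  arc := fanArc m
  point_injective := fanPoint_injective m
  arc_spec u v huv := by
    have hne : fanPoint m u ≠ fanPoint m v := (fanPoint_injective m).ne huv.ne
    refine ⟨⟨⟨fun t ↦ AffineMap.lineMap (fanPoint m u) (fanPoint m v) (t : ℝ), by fun_prop⟩,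
      by simp, by simp⟩, ?_, ?_⟩
    · intro s t hst
      exact Subtype.ext (AffineMap.lineMap_injective ℝ hne hst)
    · rw [fanArc_mk, segment_eq_image_lineMap]
      ext z
      simp
  mem_of_point_mem_arc e he w hw := by
    rcases fan_edge_cases he with ⟨i, rfl, h⟩ | ⟨i, j, hij, rfl, h⟩
    · have h' := h _ hw
      rcases w with a | k
      · rw [Subsingleton.elim a 0]
        exact Sym2.mem_mk_left _ _
      · simp only [fanPoint, Sum.elim_inr, one_mul, Nat.cast_inj] at h'
        rw [Fin.ext h'.2.2]
        exact Sym2.mem_mk_right _ _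
    · have h' := h _ hw
      rcases w with a | k
      · simp [fanPoint] at h'
      · simp only [fanPoint, Sum.elim_inr] at h'
        have h1 : (i : ℕ) ≤ k := by exact_mod_cast h'.2.1
        have h2 : (k : ℕ) ≤ i + 1 := by exact_mod_cast h'.2.2
        rw [Sym2.mem_iff]
        rcases Nat.eq_or_lt_of_le h1 with h3 | h3
        · exact Or.inl (by rw [Fin.ext h3])
        · exact Or.inr (by rw [Fin.ext (by omega : (k : ℕ) = j)])
  arc_inter_arc := by
    have mixed : ∀ (i k l : Fin m) (z : ℂ), (k : ℕ) + 1 = l → z.re = z.im * i → z.im = 1 →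
        (k : ℝ) ≤ z.re → z.re ≤ k + 1 → (i = k ∨ i = l) ∧ fanPoint m (.inr i) = z := by
      intro i k l z hkl h1 h2 h3 h4
      rw [h2, one_mul] at h1
      rw [h1] at h3 h4
      have h5 : (k : ℕ) ≤ i := by exact_mod_cast h3
      have h6 : (i : ℕ) ≤ k + 1 := by exact_mod_cast h4
      refine ⟨?_, Complex.ext h1.symm h2.symm⟩
      rcases Nat.eq_or_lt_of_le h5 with h7 | h7
      · exact Or.inl (Fin.ext h7.symm)
      · exact Or.inr (Fin.ext (by omega))
    have ordered : ∀ (i j k l : Fin m) (z : ℂ), (i : ℕ) + 1 = j → (k : ℕ) + 1 = l → i < k →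
        z.im = 1 → z.re ≤ i + 1 → (k : ℝ) ≤ z.re → j = k ∧ fanPoint m (.inr k) = z := by
      intro i j k l z hij hkl hik h1 h2 h3
      have h4 : (k : ℝ) ≤ i + 1 := h3.trans h2
      have h5 : (k : ℕ) ≤ i + 1 := by exact_mod_cast h4
      have hik' : (i : ℕ) < k := hik
      have h6 : (k : ℕ) = i + 1 := by omega
      have h7 : (k : ℝ) = i + 1 := by exact_mod_cast h6
      exact ⟨Fin.ext (by omega), Complex.ext (le_antisymm h3 (h2.trans h7.ge)) h1.symm⟩
    rintro e he f hf hef z ⟨hze, hzf⟩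
    rcases fan_edge_cases he with ⟨i, rfl, h⟩ | ⟨i, j, hij, rfl, h⟩ <;>
      rcases fan_edge_cases hf with ⟨k, rfl, g⟩ | ⟨k, l, hkl, rfl, g⟩
    · have h' := h z hze
      have g' := g z hzf
      have hik : (i : ℝ) ≠ k := by
        intro h1
        have : (i : ℕ) = k := by exact_mod_cast h1
        rw [Fin.ext this] at hef
        exact hef rfl
      have him : z.im = 0 := by
        have : z.im * ((i : ℝ) - k) = 0 := by rw [mul_sub, ← h'.2.2, ← g'.2.2, sub_self]
        exact (mul_eq_zero.1 this).resolve_right (sub_ne_zero.2 hik)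
      refine ⟨.inl 0, Sym2.mem_mk_left _ _, Sym2.mem_mk_left _ _, Complex.ext ?_ him.symm⟩
      rw [h'.2.2, him, zero_mul]
      rfl
    · have h' := h z hze
      have g' := g z hzf
      obtain ⟨h1, h2⟩ := mixed i k l z hkl h'.2.2 g'.1 g'.2.1 g'.2.2
      refine ⟨.inr i, Sym2.mem_mk_right _ _, ?_, h2⟩
      rw [Sym2.mem_iff]
      rcases h1 with rfl | rfl
      · exact Or.inl rfl
      · exact Or.inr rfl
    · have h' := h z hze
      have g' := g z hzf
      obtain ⟨h1, h2⟩ := mixed k i j z hij g'.2.2 h'.1 h'.2.1 h'.2.2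
      refine ⟨.inr k, ?_, Sym2.mem_mk_right _ _, h2⟩
      rw [Sym2.mem_iff]
      rcases h1 with rfl | rfl
      · exact Or.inl rfl
      · exact Or.inr rfl
    · have h' := h z hze
      have g' := g z hzf
      rcases lt_trichotomy i k with hik | rfl | hik
      · obtain ⟨rfl, h2⟩ := ordered i j k l z hij hkl hik h'.1 h'.2.2 g'.2.1
        exact ⟨.inr j, Sym2.mem_mk_right _ _, Sym2.mem_mk_left _ _, h2⟩
      · rw [Fin.ext (hij.symm.trans hkl)] at hef
        exact absurd rfl hef
      · obtain ⟨rfl, h2⟩ := ordered k l i j z hkl hij hik g'.1 g'.2.2 h'.2.1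
        exact ⟨.inr l, Sym2.mem_mk_left _ _, Sym2.mem_mk_right _ _, h2⟩

lemma fanDrawing_support_im {m : ℕ} {z : ℂ} (hz : z ∈ (fanDrawing m).support) :
    0 ≤ z.im ∧ z.im ≤ 1 := by
  rcases hz with ⟨v, rfl⟩ | hz
  · rcases v with a | i <;> simp [fanDrawing, fanPoint]
  · simp only [Set.mem_iUnion] at hz
    obtain ⟨e, he, hze⟩ := hz
    rcases fan_edge_cases he with ⟨i, -, h⟩ | ⟨i, j, -, -, h⟩
    · exact ⟨(h z hze).1, (h z hze).2.1⟩
    · have := (h z hze).1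
      constructor <;> linarith

lemma PlaneDrawing.subset_outerFace {V : Type*} {G : SimpleGraph V} (D : PlaneDrawing G)
    {T : Set ℂ} (hT : IsPreconnected T) (hsub : T ⊆ D.supportᶜ)
    (hub : ¬ Bornology.IsBounded T) : T ⊆ D.outerFace :=
  fun _ hz ↦ ⟨hsub hz, fun hb ↦ hub (hb.subset (hT.subset_connectedComponentIn hz hsub))⟩

/-- The drawing lies in the strip `0 ≤ im ≤ 1`. The half-planes above and below it belong to
`outerFace`, which contains every unbounded component; the upper one touches the path and the lower
one the hub. -/
lemma fanGraph_isOuterplanar (m : ℕ) : IsOuterplanar (fanGraph m) := by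
  refine ⟨fanDrawing m, fun v ↦ ?_⟩
  have hupper : {z : ℂ | 1 < z.im} ⊆ (fanDrawing m).outerFace := by
    refine PlaneDrawing.subset_outerFace _ (convex_halfSpace_im_gt 1).isPreconnected ?_ ?_
    · exact fun z hz hz' ↦ absurd (fanDrawing_support_im hz').2 (not_le.2 hz)
    · intro hb
      obtain ⟨R, hR⟩ := hb.exists_norm_le
      have := hR ⟨0, |R| + 2⟩ (by change 1 < |R| + 2; linarith [abs_nonneg R])
      have h2 := (Complex.abs_im_le_norm _).trans this
      simp only at h2
      linarith [le_abs_self (|R| + 2), le_abs_self R]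
  have hlower : {z : ℂ | z.im < 0} ⊆ (fanDrawing m).outerFace := by
    refine PlaneDrawing.subset_outerFace _ (convex_halfSpace_im_lt 0).isPreconnected ?_ ?_
    · exact fun z hz hz' ↦ absurd (fanDrawing_support_im hz').1 (not_le.2 hz)
    · intro hb
      obtain ⟨R, hR⟩ := hb.exists_norm_le
      have := hR ⟨0, -(|R| + 2)⟩ (by change -(|R| + 2) < 0; linarith [abs_nonneg R])
      have h2 := (Complex.abs_im_le_norm _).trans this
      simp only [abs_neg] at h2
      linarith [le_abs_self (|R| + 2), le_abs_self R]
  refine ⟨?_, fun h ↦ (interior_subset h).1 (Or.inl ⟨v, rfl⟩)⟩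
  rcases v with a | i
  · refine closure_mono hlower ?_
    rw [Complex.closure_setOfPred_im_lt]
    simp [fanDrawing, fanPoint]
  · refine closure_mono hupper ?_
    rw [Complex.closure_setOfPred_lt_im]
    simp [fanDrawing, fanPoint]

/-! ### The extremal number and the extremal graph -/

lemma IsOuterplanar.copyCount_le {n : ℕ} (hn : 7 ≤ n) {G : SimpleGraph (Fin n)}
    (hG : IsOuterplanar G) : 2 * G.copyCount (SimpleGraph.pathGraph 4) + 14 * n ≤ 4 * n ^ 2 + 4 := by
  rw [two_mul_copyCount]
  exact hG.noOuterObstruction.card_pathQuads_le hn (by simp)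

lemma exists_isOuterplanar_copyCount_eq {n : ℕ} (hn : 4 ≤ n) :
    ∃ G : SimpleGraph (Fin n), IsOuterplanar G ∧
      2 * G.copyCount (SimpleGraph.pathGraph 4) + 14 * n = 4 * n ^ 2 + 4 := by
  have hcard : Fintype.card (Fin n) = Fintype.card (Fin 1 ⊕ Fin (n - 1)) := by
    simp only [Fintype.card_fin, Fintype.card_sum]
    omega
  let φ := SimpleGraph.Iso.comap (Fintype.equivOfCardEq hcard) (fanGraph (n - 1))
  refine ⟨_, (fanGraph_isOuterplanar (n - 1)).of_iso φ, ?_⟩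
  have := copyCount_of_iso_fanGraph (by omega) φ
  rwa [Nat.sub_add_cancel (by omega)] at this

lemma isGreatest_outerplanarCopyCounts {n : ℕ} (hn : 8 ≤ n) :
    IsGreatest (outerplanarCopyCounts n (SimpleGraph.pathGraph 4)) (2 * n ^ 2 - 7 * n + 2) := by
  -- This keeps the natural number subtraction from truncating.
  have h7 : 7 * n ≤ 2 * n ^ 2 := by nlinarith
  obtain ⟨G, hG, hcount⟩ := exists_isOuterplanar_copyCount_eq (n := n) (by omega)
  refine ⟨⟨G, hG, by omega⟩, ?_⟩
  rintro k ⟨G', hG', rfl⟩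
  have := hG'.copyCount_le (by omega)
  omega

theorem theorem1p3 :
    (∀ n : ℕ, 8 ≤ n →
      IsGreatest (outerplanarCopyCounts n (SimpleGraph.pathGraph 4)) (2 * n ^ 2 - 7 * n + 2) ∧
      (outerplanarTuranNumber n (SimpleGraph.pathGraph 4) : ℤ) = 2 * (n : ℤ) ^ 2 - 7 * n + 2) ∧
    (∀ n : ℕ, 9 ≤ n → ∀ G : SimpleGraph (Fin n),
      (IsOuterplanar G ∧ G.copyCount (SimpleGraph.pathGraph 4) =
          outerplanarTuranNumber n (SimpleGraph.pathGraph 4)) ↔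
        Nonempty (G ≃g fanGraph (n - 1))) := by
  refine ⟨fun n hn ↦ ⟨isGreatest_outerplanarCopyCounts hn, ?_⟩, fun n hn G ↦ ?_⟩
  · have h7 : 7 * n ≤ 2 * n ^ 2 := by nlinarith
    rw [outerplanarTuranNumber, (isGreatest_outerplanarCopyCounts hn).csSup_eq]
    push_cast [h7]
    ring
  · have h7 : 7 * n ≤ 2 * n ^ 2 := by nlinarith
    rw [outerplanarTuranNumber, (isGreatest_outerplanarCopyCounts (by omega : 8 ≤ n)).csSup_eq]
    constructor
    · rintro ⟨hG, hcount⟩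
      have hcard : (Finset.univ : Finset (Fin n)).card = n := by simp
      have hquads := two_mul_copyCount (G := G)
      obtain ⟨⟨c, -, hc⟩, hE⟩ := hG.noOuterObstruction.universal_of_card_pathQuads_eq
        (S := Finset.univ) (by omega) (by rw [hcard]; omega)
      have := hG.noOuterObstruction.nonempty_iso_fanGraph (by rw [Fintype.card_fin]; omega)
        (fun u hu ↦ hc u (Finset.mem_univ u) hu) hE
      rwa [Fintype.card_fin] at this
    · rintro ⟨φ⟩
      refine ⟨(fanGraph_isOuterplanar (n - 1)).of_iso φ, ?_⟩
      have := copyCount_of_iso_fanGraph (by omega) φ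
      rw [Nat.sub_add_cancel (by omega)] at this
      omega
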